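/- \textbf{Setting.} Let $p,q,d\in\mathbb N$, $\gamma\in(0,1)$, let the state space be $\mathcal S=\mathbb R^p$ and let the action space $\mathcal A\subseteq\mathbb R^q$ be a measurable set of positive Lebesgue measure ($\mathcal A=\mathbb R^q$ is allowed). Let $\mathcal P$ be a transition kernel, $\rho$ an initial distribution, $r$ a measurable reward with $|r|\le R$ on $\mathcal S\times\mathcal A$, $\sigma>0$, and $\mu_\theta:\mathcal S\to\mathbb R^q$ measurable for each $\theta\in\mathbb R^d$. The Gaussian policy has the density $$\pi_\theta(a|s)=\frac{1}{Z_\theta(s)}\exp\Big(-\frac{\|\mu_\theta(s)-a\|^2}{2\sigma^2}\Big),\qquad Z_\theta(s)=\int_{\mathcal A}\exp\Big(-\frac{\|\mu_\theta(s)-a\|^2}{2\sigma^2}\Big)da,$$ with respect to Lebesgue measure on $\mathcal A$ (so $Z_\theta(s)=(2\pi\sigma^2)^{q/2}$ if $\mathcal A=\mathbb R^q$). Assume that $\theta\mapsto\mu_\theta(s)$ is $C^1$ and $l_\mu$-Lipschitz uniformly in $s$, and that $\log\pi_\theta(a|s)$ is twice differentiable in $\theta$ with $\|\nabla_\theta\log\pi_\theta(a|s)\|\le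 M_g$ and $\|\nabla^2_\theta\log\pi_\theta(a|s)\|\le M_h$ for all $\theta\in\mathbb R^d$, $s\in\mathcal S$, $a\in\mathcal A$, where $M_g,M_h>0$. Let $J(\theta)=\mathbb E_{\rho,\pi_\theta}[\sum_{t\ge0}\gamma^t r(s_t,a_t)]$, $J^\star=\sup_\theta J(\theta)$. For a trajectory $\tau=(s_0,a_0,\dots,s_{H-1},a_{H-1})$ let $$g(\tau,\theta)=\sum_{t=0}^{H-1}\Big(\sum_{h=t}^{H-1}\gamma^h r(s_h,a_h)\Big)\nabla_\theta\log\pi_\theta(a_t|s_t),\qquad w(\tau|\theta',\theta)=\prod_{h=0}^{H-1}\frac{\pi_{\theta'}(a_h|s_h)}{\pi_\theta(a_h|s_h)}.$$ \textbf{Algorithm (N-VR-PG).} Given $\theta_0$, $T\ge1$, $\alpha_0>0$, set $\alpha_t=\alpha_0T^{-2/3}$, $\eta_t=(2/(t+1))^{2/3}$, $H=\lceil(1-\gamma)^{-1}\log(T+1)\rceil$. Sample $\tau_0$ of length $H$ from $\pi_{\theta_0}$ and put $d_0=g(\tau_0,\theta_0)$; put $\theta_{t+1}=\theta_t+\alpha_t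 d_t/\|d_t\|$ (and $\theta_{t+1}=\theta_t$ if $d_t=0$); for $1\le t\le T-1$ sample, given the past, $\tau_t$ of length $H$ from $\pi_{\theta_t}$, and put $d_t=\eta_tg(\tau_t,\theta_t)+(1-\eta_t)\big(d_{t-1}+g(\tau_t,\theta_t)-w(\tau_t|\theta_{t-1},\theta_t)g(\tau_t,\theta_{t-1})\big)$. The output $\bar\theta_T$ is uniform on $\{\theta_1,\dots,\theta_T\}$. \textbf{Constants.} For $H\in\mathbb N$ and $\alpha>0$, $W=\exp(HM_g^2\alpha^2)$, $C_w=(2H^2M_g^2+HM_h)(W+1)$. Further $V=\frac{M_gR}{(1-\gamma)^{3/2}}$, $L_g=\frac{2M_g^2R}{(1-\gamma)^3}+\frac{M_hR}{(1-\gamma)^2}$, $G=\frac{M_gR}{(1-\gamma)^2}$. \textbf{Theorem.} (1) For all $H\ge1$, $\alpha>0$, $\theta\in\mathbb R^d$, $u\in\mathbb R^d\setminus\{0\}$, with $\theta'=\theta+\alpha u/\|u\|$ and $\tau$ a trajectory of length $H$ sampled from $\pi_{\theta'}$: $w(\tau|\theta,\theta')$ is square integrable, $\mathbb E[w(\tau|\theta,\theta')]=1$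 and $\operatorname{Var}[w(\tau|\theta,\theta')]\le C_w\alpha^2$. Likewise, along N-VR-PG, for $1\le t\le T-1$, $\mathbb E[w(\tau_t|\theta_{t-1},\theta_t)]=1$ and $\operatorname{Var}[w(\tau_t|\theta_{t-1},\theta_t)]\le C_w\alpha_{t-1}^2$, with $C_w$ taken for $\alpha=\alpha_0T^{-2/3}$. (2) $J$ is bounded above and differentiable, and there is an absolute constant $C$ such that, with $C_w$ taken for $\alpha=\alpha_0T^{-2/3}$, $$\mathbb E\|\nabla J(\bar\theta_T)\|\le C\Big(\frac{J^\star-\mathbb E[J(\theta_1)]}{\alpha_0T^{1/3}}+\frac{V+(L_g+G\,C_w^{1/2})\alpha_0}{T^{1/3}}\Big).$$ (3) If $\alpha_0=1-\gamma$, there is a constant $C$ depending only on $M_g,M_h,R$ such that for all $T\ge1$ $$\mathbb E\|\nabla J(\bar\theta_T)\|\le\frac{C\log(T+1)}{(1-\gamma)^2T^{1/3}}.$$ (4) Consequently, with $\alpha_0=1-\gamma$ and for a constant $C$ depending only on $M_g,M_h,R$, for every $\varepsilon\in(0,1)$ there is $T\ge1$, depending only on $M_g,M_h,R,\gamma,\varepsilon$,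 such that $\mathbb E\|\nabla J(\bar\theta_T)\|\le\varepsilon$ for every such problem and every $\theta_0$, with at most $T\le C(1-\gamma)^{-6}\varepsilon^{-3}\log^3\frac{2}{(1-\gamma)\varepsilon}$ trajectories and $TH\le C(1-\gamma)^{-7}\varepsilon^{-3}\log^4\frac{2}{(1-\gamma)\varepsilon}$ state-action samples, i.e. $\tilde O(\varepsilon^{-3})$ samples. -/

import Mathlib

open MeasureTheory ProbabilityTheory
open scoped ENNReal

noncomputable section

namespace GaussianPG

/-- The Euclidean space `ℝⁿ` with its standard inner product and norm. -/
abbrev E (n : ℕ) : Type := EuclideanSpace ℝ (Fin n)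

/-- A discounted decision problem with state space `ℝ^p` and actions in a measurable set
`actions ⊆ ℝ^q` of positive Lebesgue measure (`Set.univ`, i.e. all of `ℝ^q`, is allowed),
together with the data of a Gaussian policy class: the standard deviation `σ` and the mean
`mean θ s`, for a parameter `θ ∈ ℝ^d`. -/
structure Problem (p q d : ℕ) where
  /-- the action set -/
  actions : Set (E q)
  measurableSet_actions : MeasurableSet actions
  volume_actions_pos : 0 < volume actions
  /-- transition kernel -/
  trans : Kernel (E p × E q) (E p)
  isMarkov_trans : IsMarkovKernel trans
  /-- initial state distribution -/
  init : Measure (E p)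
  isProbability_init : IsProbabilityMeasure init
  /-- reward function -/
  reward : E p × E q → ℝ
  measurable_reward : Measurable reward
  /-- standard deviation of the policy -/
  σ : ℝ
  σ_pos : 0 < σ
  /-- mean of the policy -/
  mean : E d → E p → E q
  measurable_mean : ∀ θ, Measurable (mean θ)

/-- A trajectory `(s₀, a₀, …, s_{H-1}, a_{H-1})` of length `H`. -/
abbrev Traj (p q H : ℕ) : Type := Fin H → E p × E q

namespace Problem

variable {p q d : ℕ} (M : Problem p q d)

attribute [instance] Problem.isMarkov_trans Problem.isProbability_init

/-- The unnormalized Gaussian density `exp (-‖μ_θ(s) - a‖² / (2σ²))`. -/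
def weight (θ : E d) (s : E p) (a : E q) : ℝ :=
  Real.exp (-‖M.mean θ s - a‖ ^ 2 / (2 * M.σ ^ 2))

/-- The normalizing constant over the action set; it is `(2πσ²)^(q/2)` if `actions = Set.univ`. -/
def norma (θ : E d) (s : E p) : ℝ :=
  ∫ a in M.actions, M.weight θ s a

/-- The Gaussian policy `π_θ(a|s)`, a probability density with respect to the Lebesgue measure
on the action set. -/
def policy (θ : E d) (s : E p) (a : E q) : ℝ :=
  M.weight θ s a / M.norma θ s

/-- The policy `π_θ(·|s)` as a probability kernel from states to actions. -/
def policyKernel (θ : E d) : Kernel (E p) (E q) :=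
  Kernel.withDensity (Kernel.const (E p) (volume.restrict M.actions))
    (fun s a => ENNReal.ofReal (M.policy θ s a))

lemma integrable_weight (θ : E d) (s : E p) : Integrable (M.weight θ s) := by
  have h := (GaussianFourier.integrable_cexp_neg_mul_sq_norm_add (V := E q)
    (b := ((1 / (2 * M.σ ^ 2) : ℝ) : ℂ))
    (by rw [Complex.ofReal_re]; have := M.σ_pos; positivity) 0 0).norm
  have h2 : Integrable (fun a : E q => Real.exp (-‖a‖ ^ 2 / (2 * M.σ ^ 2))) := by
    refine h.congr (Filter.Eventually.of_forall fun a => ?_)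
    have e : -((1 / (2 * M.σ ^ 2) : ℝ) : ℂ) * (‖a‖ : ℂ) ^ 2 + 0 * ((inner ℝ (0 : E q) a : ℝ) : ℂ) =
        ((-‖a‖ ^ 2 / (2 * M.σ ^ 2) : ℝ) : ℂ) := by
      push_cast; ring
    change ‖Complex.exp (-((1 / (2 * M.σ ^ 2) : ℝ) : ℂ) * (‖a‖ : ℂ) ^ 2 +
      0 * ((inner ℝ (0 : E q) a : ℝ) : ℂ))‖ = _
    rw [e, ← Complex.ofReal_exp, Complex.norm_real, Real.norm_of_nonneg (Real.exp_pos _).le]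
  have h3 := h2.comp_sub_left (M.mean θ s)
  exact h3

lemma norma_pos (θ : E d) (s : E p) : 0 < M.norma θ s := by
  unfold norma
  rw [setIntegral_pos_iff_support_of_nonneg_ae]
  · have : Function.support (M.weight θ s) = Set.univ := by
      ext a; simp [weight, Real.exp_ne_zero]
    rw [this, Set.univ_inter]
    exact M.volume_actions_pos
  · exact Filter.Eventually.of_forall fun a => (Real.exp_pos _).le
  · exact (M.integrable_weight θ s).integrableOn

lemma measurable_weight (θ : E d) : Measurable (Function.uncurry (M.weight θ)) := by
  have := M.measurable_mean θ
  unfold weight Function.uncurry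
  fun_prop

lemma measurable_policy (θ : E d) : Measurable (Function.uncurry (M.policy θ)) := by
  have h1 := M.measurable_weight θ
  have h2 : StronglyMeasurable (M.norma θ) :=
    h1.stronglyMeasurable.integral_prod_right (ν := volume.restrict M.actions)
  exact h1.div (h2.measurable.comp measurable_fst)

instance isMarkov_policyKernel (θ : E d) : IsMarkovKernel (M.policyKernel θ) := by
  refine ⟨fun s => ⟨?_⟩⟩
  have hm : Measurable (Function.uncurry fun s a => ENNReal.ofReal (M.policy θ s a)) :=
    (M.measurable_policy θ).ennreal_ofReal
  have hZ := M.norma_pos θ s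
  rw [policyKernel, Kernel.withDensity_apply' _ hm, Kernel.const_apply, Measure.restrict_univ,
    ← ofReal_integral_eq_lintegral_ofReal]
  · simp only [policy]
    rw [integral_div]
    change ENNReal.ofReal (M.norma θ s / M.norma θ s) = 1
    rw [div_self hZ.ne', ENNReal.ofReal_one]
  · exact ((M.integrable_weight θ s).integrableOn (s := M.actions)).div_const _
  · exact Filter.Eventually.of_forall fun a => div_nonneg (Real.exp_pos _).le hZ.le

/-- The law of `(s₀, a₀)`: `s₀ ∼ init`, `a₀ ∼ π_θ(·|s₀)`. -/
def initLaw (θ : E d) : Measure (E p × E q) :=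
  M.init ⊗ₘ M.policyKernel θ

instance isProbability_initLaw (θ : E d) : IsProbabilityMeasure (M.initLaw θ) := by
  unfold initLaw; infer_instance

/-- One step of the state-action chain: `s' ∼ trans (s, a)`, then `a' ∼ π_θ(·|s')`. -/
def stepKernel (θ : E d) : Kernel (E p × E q) (E p × E q) :=
  M.trans ⊗ₖ Kernel.prodMkLeft (E p × E q) (M.policyKernel θ)

instance isMarkov_stepKernel (θ : E d) : IsMarkovKernel (M.stepKernel θ) := by
  unfold stepKernel; infer_instance

/-- `stepKernel`, as a function of the whole past `(s₀, a₀), …, (s_n, a_n)`. -/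
def stepKernelPast (θ : E d) (n : ℕ) :
    Kernel ((i : Finset.Iic n) → E p × E q) (E p × E q) :=
  (M.stepKernel θ).comap (fun x => x ⟨n, Finset.mem_Iic.2 le_rfl⟩) (measurable_pi_apply _)

instance isMarkov_stepKernelPast (θ : E d) (n : ℕ) : IsMarkovKernel (M.stepKernelPast θ n) := by
  unfold stepKernelPast; infer_instance

/-- The law of the chain `(s_t, a_t)_{t ∈ ℕ}` under the policy `π_θ`. -/
def pathLaw (θ : E d) : Measure (ℕ → E p × E q) :=
  Kernel.trajMeasure (X := fun _ => E p × E q) (M.initLaw θ) (M.stepKernelPast θ)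

/-- The law of a trajectory of length `H` under the policy `π_θ`. -/
def trajLaw (H : ℕ) (θ : E d) : Measure (Traj p q H) :=
  (M.pathLaw θ).map (fun z (h : Fin H) => z h)

/-- The expected return `J(θ) = 𝔼[∑_t γ^t r(s_t, a_t)]`. -/
def J (γ : ℝ) (θ : E d) : ℝ :=
  ∫ z, ∑' t : ℕ, γ ^ t * M.reward (z t) ∂(M.pathLaw θ)

/-- The optimal value `J⋆ = sup_θ J(θ)`. -/
def Jstar (γ : ℝ) : ℝ := ⨆ θ, M.J γ θ

/-- The score `∇_θ log π_θ(a|s)`. -/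
def score (θ : E d) (s : E p) (a : E q) : E d :=
  gradient (fun θ' => Real.log (M.policy θ' s a)) θ

/-- The truncated policy gradient estimate
`g(τ, θ) = ∑_{t<H} (∑_{h=t}^{H-1} γ^h r(s_h, a_h)) ∇ log π_θ(a_t|s_t)`. -/
def gradEst (γ : ℝ) {H : ℕ} (τ : Traj p q H) (θ : E d) : E d :=
  ∑ t : Fin H, (∑ h ∈ Finset.Ici t, γ ^ (h : ℕ) * M.reward (τ h)) •
    M.score θ (τ t).1 (τ t).2

/-- The importance sampling weight `w(τ|θ', θ) = ∏_h π_θ'(a_h|s_h) / π_θ(a_h|s_h)`. -/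
def isWeight {H : ℕ} (τ : Traj p q H) (θ' θ : E d) : ℝ :=
  ∏ h : Fin H, M.policy θ' (τ h).1 (τ h).2 / M.policy θ (τ h).1 (τ h).2

/-- The regularity assumption on the policy class: `θ ↦ μ_θ(s)` is continuously differentiable
and `lμ`-Lipschitz, uniformly in `s`; `log π_θ(a|s)` is twice differentiable in `θ`, with gradient
bounded by `Mg` and Hessian bounded (in spectral norm) by `Mh`, for all parameters, states and
actions. -/
structure Regular (lμ Mg Mh : ℝ) : Prop where
  contDiff_mean : ∀ s, ContDiff ℝ 1 (fun θ => M.mean θ s)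
  lipschitz_mean : ∀ s θ θ', ‖M.mean θ s - M.mean θ' s‖ ≤ lμ * ‖θ - θ'‖
  norm_score_le : ∀ θ s, ∀ a ∈ M.actions, ‖M.score θ s a‖ ≤ Mg
  differentiable_score : ∀ s, ∀ a ∈ M.actions, Differentiable ℝ (fun θ => M.score θ s a)
  norm_hessian_le : ∀ θ s, ∀ a ∈ M.actions, ‖fderiv ℝ (fun θ' => M.score θ' s a) θ‖ ≤ Mh

/-- The reward is bounded by `R` in absolute value. -/
def RewardBound (R : ℝ) : Prop := ∀ s, ∀ a ∈ M.actions, |M.reward (s, a)| ≤ R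

/-- The normalized step `θ + α d / ‖d‖`; it leaves `θ` unchanged if `d = 0`. -/
def normalizedStep (θ : E d) (α : ℝ) (dir : E d) : E d := θ + α • (‖dir‖⁻¹ • dir)

/-- The algorithm N-VR-PG as a function of the sampled trajectories `τ₀, τ₁, …`: the pair
`(θ_t, d_t)`. Here `θ_t` depends on `τ₀, …, τ_{t-1}` only, and `d_t` on `τ₀, …, τ_t`. -/
def nvrpg (γ : ℝ) {H : ℕ} (α η : ℕ → ℝ) (θ₀ : E d) (τ : ℕ → Traj p q H) : ℕ → E d × E d
  | 0 => (θ₀, M.gradEst γ (τ 0) θ₀)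
  | t + 1 =>
    let θ := (nvrpg γ α η θ₀ τ t).1
    let dir := (nvrpg γ α η θ₀ τ t).2
    let θ' := normalizedStep θ (α t) dir
    let v := M.gradEst γ (τ (t + 1)) θ' - M.isWeight (τ (t + 1)) θ θ' • M.gradEst γ (τ (t + 1)) θ
    (θ', η (t + 1) • M.gradEst γ (τ (t + 1)) θ' + (1 - η (t + 1)) • (dir + v))

/-- The iterate `θ_t` of N-VR-PG. -/
def iterate (γ : ℝ) {H : ℕ} (α η : ℕ → ℝ) (θ₀ : E d) (τ : ℕ → Traj p q H) (t : ℕ) : E d :=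
  (M.nvrpg γ α η θ₀ τ t).1

/-- `τ₀, …, τ_{T-1}` are the trajectories sampled by N-VR-PG: given `τ₀, …, τ_{t-1}`, the
trajectory `τ_t` is drawn from the law of a trajectory of length `H` under `π_{θ_t}`. -/
structure IsRun {Ω : Type*} [MeasurableSpace Ω] (P : Measure Ω) (γ : ℝ) {H : ℕ} (T : ℕ)
    (α η : ℕ → ℝ) (θ₀ : E d) (τ : ℕ → Ω → Traj p q H) : Prop where
  measurable : ∀ t < T, Measurable (τ t)
  law : ∀ t < T, ∀ (B : Set (Fin t → Traj p q H)) (C : Set (Traj p q H)),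
    MeasurableSet B → MeasurableSet C →
    P {ω | (fun i : Fin t => τ i ω) ∈ B ∧ τ t ω ∈ C} =
      ∫⁻ ω in {ω | (fun i : Fin t => τ i ω) ∈ B},
        M.trajLaw H (M.iterate γ α η θ₀ (fun n => τ n ω) t) C ∂P

end Problem

/-- The horizon `H = (1-γ)⁻¹ log (T+1)`, rounded up to an integer. -/
def horizon (γ : ℝ) (T : ℕ) : ℕ := ⌈(1 - γ)⁻¹ * Real.log (T + 1)⌉₊

/-- The constant stepsize `α_t = α₀ / T^(2/3)`. -/
def stepsize (α₀ : ℝ) (T : ℕ) : ℝ := α₀ / (T : ℝ) ^ ((2 : ℝ) / 3)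

/-- The momentum parameter `η_t = (2 / (t+1))^(2/3)`. -/
def momentum (t : ℕ) : ℝ := (2 / ((t : ℝ) + 1)) ^ ((2 : ℝ) / 3)

/-- The iterates of N-VR-PG with horizon, stepsizes and momentum as above. -/
def Problem.θ {p q d : ℕ} (M : Problem p q d) (γ α₀ : ℝ) (T : ℕ) (θ₀ : E d) {Ω : Type*}
    (τ : ℕ → Ω → Traj p q (horizon γ T)) (t : ℕ) (ω : Ω) : E d :=
  M.iterate γ (fun _ => stepsize α₀ T) momentum θ₀ (fun n => τ n ω) t

/-- `τ₀, …, τ_{T-1}` are sampled by N-VR-PG with horizon, stepsizes and momentum as above. -/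
def Problem.IsStandardRun {p q d : ℕ} (M : Problem p q d) (γ α₀ : ℝ) (T : ℕ) (θ₀ : E d)
    {Ω : Type*} [MeasurableSpace Ω] (P : Measure Ω)
    (τ : ℕ → Ω → Traj p q (horizon γ T)) : Prop :=
  M.IsRun P γ T (fun _ => stepsize α₀ T) momentum θ₀ τ

/-- The joint law of the run and of an independent index, uniform on `{1, …, T}`. -/
def outputLaw {Ω : Type*} [MeasurableSpace Ω] (P : Measure Ω) (T : ℕ) : Measure (Ω × ℕ) :=
  P.prod (uniformOn (Set.Icc 1 T))

/-- `𝔼 ‖∇J(θ̄_T)‖`, for `θ̄_T` drawn uniformly at random from the iterates `θ₁, …, θ_T`. -/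
def Problem.outputGradNorm {p q d : ℕ} (M : Problem p q d) (γ α₀ : ℝ) (T : ℕ) (θ₀ : E d)
    {Ω : Type*} [MeasurableSpace Ω] (P : Measure Ω)
    (τ : ℕ → Ω → Traj p q (horizon γ T)) : ℝ :=
  ∫ x, ‖gradient (M.J γ) (M.θ γ α₀ T θ₀ τ x.2 x.1)‖ ∂(outputLaw P T)

/-- `V = Mg R / (1-γ)^(3/2)`. -/
def constV (γ R Mg : ℝ) : ℝ := Mg * R / (1 - γ) ^ ((3 : ℝ) / 2)

/-- `L_g = 2 Mg² R / (1-γ)³ + Mh R / (1-γ)²`. -/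
def constLg (γ R Mg Mh : ℝ) : ℝ := 2 * Mg ^ 2 * R / (1 - γ) ^ 3 + Mh * R / (1 - γ) ^ 2

/-- `G = Mg R / (1-γ)²`. -/
def constG (γ R Mg : ℝ) : ℝ := Mg * R / (1 - γ) ^ 2

/-- `W = exp (H Mg² α²)`, which bounds the second moment of the weights for stepsize `α`. -/
def constW (H : ℕ) (Mg α : ℝ) : ℝ := Real.exp (H * Mg ^ 2 * α ^ 2)

/-- `C_w = (2 H² Mg² + H Mh) (W + 1)`. -/
def constCw (H : ℕ) (Mg Mh α : ℝ) : ℝ :=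
  (2 * (H : ℝ) ^ 2 * Mg ^ 2 + H * Mh) * (constW H Mg α + 1)

end GaussianPG

end

open MeasureTheory ProbabilityTheory
open scoped ENNReal

namespace GaussianPG

namespace Problem

/-! ### Regularity of the policy -/

section Policy

variable {p q d : ℕ} {M : Problem p q d} {lμ Mg Mh : ℝ}

-- The bounds in `Regular` make `log π_θ(a|s)` `Mg`-Lipschitz and the score `Mh`-Lipschitz in θ for
-- admissible actions. The initial law and the transitions do not involve θ, so `isWeight` is the
-- density of one trajectory law with respect to another (`lintegral_trajLaw_change`). One policy
-- ratio has mean 1 and lies in [e^(-x), e^x] with x = Mg ‖θ - θ'‖; this alone forces its second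
-- moment below e^(x²) (`lintegral_sq_ratio_le`). Conditioning step by step gives exp(H Mg² ‖θ -
-- θ'‖²) for a trajectory. A normalized step has length at most α, so the variance of the weights is
-- of order α² without any assumption on the weights themselves.
--
-- Moving all expectations to the law of one fixed parameter allows differentiation under the
-- integral sign. This yields the policy gradient formula and the smoothness of J
-- (`hasGradientAt_expectation`, `norm_gradJ_sub_le`). Comparing the formula for n and for n + 1
-- steps shows that the scores along a path are uncorrelated, so a sum of n scores has second moment
-- at most n Mg² instead of n² Mg². This is the source of the exponent 3/2 in V, which bounds both
-- ‖∇J‖ and the root mean square of the gradient estimate.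
--
-- The core is the error e_t = d_t - ∇J_H(θ_t) against the truncated return J_H. The
-- importance-weighted difference has mean exactly ∇J_H(θ_t) - ∇J_H(θ_{t-1}), so e_t is (1 - η_t)
-- e_{t-1} plus centred noise (`nextDir_sub_eq`), and the mean squares satisfy m_t ≤ (1 - η_t)
-- m_{t-1} + 2 η_t² V² + O(α²). For η_t of order t^(-2/3) this recursion is solved by 8 V² η_t + S²
-- with S of order α₀ T^(-1/3). A normalized step raises J by at least α (‖∇J‖ - 2 ‖d_t - ∇J‖) -
-- O(L_g α²). Telescoping over t = 1, …, T - 1 and dividing by α T makes every term of order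
-- T^(-1/3); the horizon is long enough for the truncation bias to be of this order as well.
--
-- For α₀ = 1 - γ the product H α² is bounded, hence W is bounded and C_w is of order H². Since (1 -
-- γ) H is at most log(T + 1) + 1, the explicit rate has a single logarithm, and T is then chosen to
-- bring it below ε.

lemma weight_pos (M : Problem p q d) (θ : E d) (s : E p) (a : E q) : 0 < M.weight θ s a :=
  Real.exp_pos _

lemma policy_pos (M : Problem p q d) (θ : E d) (s : E p) (a : E q) : 0 < M.policy θ s a :=
  div_pos (M.weight_pos θ s a) (M.norma_pos θ s)

lemma measurable_mean_joint (hM : M.Regular lμ Mg Mh) :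
    Measurable (fun x : E d × E p => M.mean x.1 x.2) :=
  measurable_uncurry_of_continuous_of_measurable (u := M.mean)
    (fun s => (hM.contDiff_mean s).continuous) M.measurable_mean

lemma measurable_weight_joint (hM : M.Regular lμ Mg Mh) :
    Measurable (fun x : (E d × E p) × E q => M.weight x.1.1 x.1.2 x.2) := by
  have h : Measurable (fun x : (E d × E p) × E q => M.mean x.1.1 x.1.2) :=
    (measurable_mean_joint hM).comp measurable_fst
  unfold weight
  exact (((h.sub measurable_snd).norm.pow_const 2).neg.div_const _).exp

lemma measurable_norma_joint (hM : M.Regular lμ Mg Mh) :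
    Measurable (fun x : E d × E p => M.norma x.1 x.2) :=
  ((measurable_weight_joint hM).stronglyMeasurable.integral_prod_right
    (ν := volume.restrict M.actions)).measurable

lemma measurable_policy_joint (hM : M.Regular lμ Mg Mh) :
    Measurable (fun x : E d × E p × E q => M.policy x.1 x.2.1 x.2.2) := by
  have h1 := (measurable_weight_joint hM).comp
    (g := fun x : (E d × E p) × E q => M.weight x.1.1 x.1.2 x.2)
    (f := fun x : E d × E p × E q => ((x.1, x.2.1), x.2.2)) (by fun_prop)
  have h2 := (measurable_norma_joint hM).comp
    (g := fun x : E d × E p => M.norma x.1 x.2)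
    (f := fun x : E d × E p × E q => (x.1, x.2.1)) (by fun_prop)
  exact h1.div h2

lemma hasFDerivAt_weight (hM : M.Regular lμ Mg Mh) (s : E p) (a : E q) (θ : E d) :
    HasFDerivAt (fun θ' => M.weight θ' s a)
      (M.weight θ s a • ((-(2 * M.σ ^ 2)⁻¹) • (2 • (innerSL ℝ (M.mean θ s - a)).comp
        (fderiv ℝ (fun θ' => M.mean θ' s) θ)))) θ := by
  have h0 : HasFDerivAt (fun θ' => M.mean θ' s) (fderiv ℝ (fun θ' => M.mean θ' s) θ) θ :=
    ((hM.contDiff_mean s).differentiable one_ne_zero θ).hasFDerivAt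
  have h := ((h0.sub_const a).norm_sq.const_mul (-(2 * M.σ ^ 2)⁻¹)).exp
  have e : ∀ θ', Real.exp (-(2 * M.σ ^ 2)⁻¹ * ‖M.mean θ' s - a‖ ^ 2) = M.weight θ' s a := by
    intro θ'
    unfold weight
    congr 1
    ring
  simp only [e] at h
  exact h

lemma norm_fderiv_mean_le (hM : M.Regular lμ Mg Mh) (s : E p) (θ : E d) :
    ‖fderiv ℝ (fun θ' => M.mean θ' s) θ‖ ≤ |lμ| := by
  refine (((hM.contDiff_mean s).differentiable one_ne_zero θ).hasFDerivAt).le_of_lip'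
    (abs_nonneg _) (Filter.Eventually.of_forall fun θ' => ?_)
  exact (hM.lipschitz_mean s θ' θ).trans
    (mul_le_mul_of_nonneg_right (le_abs_self _) (norm_nonneg _))

/-- Since u ≤ 1 + u²/4 ≤ e^(u²/4), the linear factor from differentiating a Gaussian is absorbed by
halving the exponent. -/
lemma mul_exp_neg_sq_half_le (u : ℝ) : u * Real.exp (-(u ^ 2 / 2)) ≤ Real.exp (-(u ^ 2 / 4)) := by
  have h1 : u ≤ Real.exp (u ^ 2 / 4) := by
    nlinarith [Real.add_one_le_exp (u ^ 2 / 4), sq_nonneg (u / 2 - 1)]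
  have h2 : Real.exp (-(u ^ 2 / 4)) = Real.exp (u ^ 2 / 4) * Real.exp (-(u ^ 2 / 2)) := by
    rw [← Real.exp_add]; congr 1; ring
  rw [h2]
  exact mul_le_mul_of_nonneg_right h1 (Real.exp_pos _).le

/-- Domination uniform over the unit ball around `θ₀`: the mean moves by at most `|lμ|` there, so
the distance y from `a` to the mean at `θ₀` satisfies y² ≤ 2x² + 2lμ², with x the distance to the
mean at `θ`. A Gaussian centred at the fixed mean, with doubled standard deviation, then dominates.
-/
lemma norm_fderiv_weight_le (hM : M.Regular lμ Mg Mh) (s : E p) (a : E q) (θ θ₀ : E d)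
    (hθ : ‖θ - θ₀‖ ≤ 1) :
    ‖M.weight θ s a • ((-(2 * M.σ ^ 2)⁻¹) • (2 • (innerSL ℝ (M.mean θ s - a)).comp
        (fderiv ℝ (fun θ' => M.mean θ' s) θ)))‖ ≤
      |lμ| / M.σ * Real.exp (|lμ| ^ 2 / (4 * M.σ ^ 2)) *
        Real.exp (-‖M.mean θ₀ s - a‖ ^ 2 / (2 * (2 * M.σ) ^ 2)) := by
  have hσ := M.σ_pos
  set x := ‖M.mean θ s - a‖ with hx
  set y := ‖M.mean θ₀ s - a‖ with hy
  have hd : ‖M.mean θ s - M.mean θ₀ s‖ ≤ |lμ| :=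
    (hM.lipschitz_mean s θ θ₀).trans ((mul_le_mul_of_nonneg_right (le_abs_self _)
      (norm_nonneg _)).trans (mul_le_of_le_one_right (abs_nonneg _) hθ))
  have hyx : y ≤ x + |lμ| := by
    have : M.mean θ₀ s - a = (M.mean θ s - a) - (M.mean θ s - M.mean θ₀ s) := by abel
    rw [hy, this]
    exact (norm_sub_le _ _).trans (add_le_add_right hd _)
  have hy0 : 0 ≤ y := norm_nonneg _
  have hx0 : 0 ≤ x := norm_nonneg _
  have hsq : y ^ 2 ≤ 2 * x ^ 2 + 2 * |lμ| ^ 2 := by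
    nlinarith [sq_nonneg (x - |lμ|), pow_le_pow_left₀ hy0 hyx 2]
  have hop : ‖(innerSL ℝ (M.mean θ s - a)).comp (fderiv ℝ (fun θ' => M.mean θ' s) θ)‖
      ≤ x * |lμ| := by
    refine (ContinuousLinearMap.opNorm_comp_le _ _).trans ?_
    rw [innerSL_apply_norm]
    exact mul_le_mul_of_nonneg_left (norm_fderiv_mean_le hM s θ) hx0
  have h2 : ‖(-(2 * M.σ ^ 2)⁻¹) • (2 • (innerSL ℝ (M.mean θ s - a)).comp
        (fderiv ℝ (fun θ' => M.mean θ' s) θ))‖ ≤ (x / M.σ) * (|lμ| / M.σ) := by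
    rw [← Nat.cast_smul_eq_nsmul ℝ, smul_smul, norm_smul, Real.norm_eq_abs]
    have : |-(2 * M.σ ^ 2)⁻¹ * ((2 : ℕ) : ℝ)| = (M.σ ^ 2)⁻¹ := by
      have e : -(2 * M.σ ^ 2)⁻¹ * ((2 : ℕ) : ℝ) = -(M.σ ^ 2)⁻¹ := by
        push_cast; field_simp
      rw [e, abs_neg, abs_of_pos (by positivity)]
    rw [this]
    calc (M.σ ^ 2)⁻¹ * _ ≤ (M.σ ^ 2)⁻¹ * (x * |lμ|) :=
          mul_le_mul_of_nonneg_left hop (by positivity)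
      _ = _ := by field_simp
  rw [norm_smul, Real.norm_of_nonneg (M.weight_pos θ s a).le]
  have h3 := mul_exp_neg_sq_half_le (x / M.σ)
  have h4 : M.weight θ s a = Real.exp (-((x / M.σ) ^ 2 / 2)) := by
    unfold weight; congr 1; rw [← hx]; field_simp
  have h5 : Real.exp (-((x / M.σ) ^ 2 / 4)) ≤ Real.exp (|lμ| ^ 2 / (4 * M.σ ^ 2)) *
        Real.exp (-y ^ 2 / (2 * (2 * M.σ) ^ 2)) := by
    rw [← Real.exp_add]
    apply Real.exp_le_exp.2
    have : |lμ| ^ 2 / (4 * M.σ ^ 2) + -y ^ 2 / (2 * (2 * M.σ) ^ 2) - -((x / M.σ) ^ 2 / 4) =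
      (2 * x ^ 2 + 2 * |lμ| ^ 2 - y ^ 2) / (8 * M.σ ^ 2) := by
      field_simp; ring
    have h6 : 0 ≤ (2 * x ^ 2 + 2 * |lμ| ^ 2 - y ^ 2) / (8 * M.σ ^ 2) :=
      div_nonneg (by linarith) (by positivity)
    linarith
  calc M.weight θ s a * _ ≤ M.weight θ s a * ((x / M.σ) * (|lμ| / M.σ)) :=
        mul_le_mul_of_nonneg_left h2 (M.weight_pos θ s a).le
    _ = (|lμ| / M.σ) * (x / M.σ * Real.exp (-((x / M.σ) ^ 2 / 2))) := by rw [h4]; ring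
    _ ≤ (|lμ| / M.σ) * (Real.exp (|lμ| ^ 2 / (4 * M.σ ^ 2)) *
        Real.exp (-y ^ 2 / (2 * (2 * M.σ) ^ 2))) :=
      mul_le_mul_of_nonneg_left (h3.trans h5) (by positivity)
    _ = _ := by ring

lemma differentiable_norma (hM : M.Regular lμ Mg Mh) (s : E p) :
    Differentiable ℝ (fun θ => M.norma θ s) := by
  intro θ₀
  have hint : Integrable
      (fun a : E q => Real.exp (-‖M.mean θ₀ s - a‖ ^ 2 / (2 * (2 * M.σ) ^ 2))) :=
    -- The dominating Gaussian is the weight of the same problem with standard deviation `2σ`.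
    integrable_weight { M with σ := 2 * M.σ, σ_pos := by have := M.σ_pos; positivity } θ₀ s
  have key := hasFDerivAt_integral_of_dominated_of_fderiv_le (𝕜 := ℝ)
    (μ := volume.restrict M.actions) (s := Metric.ball θ₀ 1)
    (F := fun θ a => M.weight θ s a) (x₀ := θ₀)
    (F' := fun θ a => M.weight θ s a • ((-(2 * M.σ ^ 2)⁻¹) •
      (2 • (innerSL ℝ (M.mean θ s - a)).comp (fderiv ℝ (fun θ' => M.mean θ' s) θ))))
    (bound := fun a => |lμ| / M.σ * Real.exp (|lμ| ^ 2 / (4 * M.σ ^ 2)) *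
        Real.exp (-‖M.mean θ₀ s - a‖ ^ 2 / (2 * (2 * M.σ) ^ 2)))
    (Metric.ball_mem_nhds _ one_pos)
    (Filter.Eventually.of_forall fun θ => (M.integrable_weight θ s).integrableOn.1)
    (M.integrable_weight θ₀ s).integrableOn ?_
    (Filter.Eventually.of_forall fun a θ hθ => norm_fderiv_weight_le hM s a θ θ₀ ?_)
    (hint.integrableOn.const_mul _)
    (Filter.Eventually.of_forall fun a θ _ => hasFDerivAt_weight hM s a θ)
  · exact key.differentiableAt
  · have hc : Continuous (fun a : E q => (innerSL ℝ (M.mean θ₀ s - a)).comp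
        (fderiv ℝ (fun θ' => M.mean θ' s) θ₀)) :=
      ((innerSL ℝ).continuous.comp (continuous_const.sub continuous_id)).clm_comp
        continuous_const
    have hw : Continuous (fun a : E q => M.weight θ₀ s a) := by unfold weight; fun_prop
    have h2 := (hc.const_smul (2 : ℕ)).const_smul (-(2 * M.σ ^ 2)⁻¹)
    exact (hw.smul h2).aestronglyMeasurable
  · rw [← dist_eq_norm]; exact (Metric.mem_ball.1 hθ).le

lemma differentiable_policy (hM : M.Regular lμ Mg Mh) (s : E p) (a : E q) :
    Differentiable ℝ (fun θ => M.policy θ s a) := by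
  have h1 : Differentiable ℝ (fun θ => M.weight θ s a) :=
    fun θ => (hasFDerivAt_weight hM s a θ).differentiableAt
  simp only [policy, div_eq_mul_inv]
  exact h1.mul ((differentiable_norma hM s).inv fun θ => (M.norma_pos θ s).ne')

lemma differentiable_log_policy (hM : M.Regular lμ Mg Mh) (s : E p) (a : E q) :
    Differentiable ℝ (fun θ => Real.log (M.policy θ s a)) := fun θ =>
  (differentiable_policy hM s a θ).log (M.policy_pos θ s a).ne'

lemma hasGradientAt_log_policy (hM : M.Regular lμ Mg Mh) (s : E p) (a : E q) (θ : E d) :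
    HasGradientAt (fun θ => Real.log (M.policy θ s a)) (M.score θ s a) θ :=
  (differentiable_log_policy hM s a θ).hasGradientAt

/-- Each coordinate of the score is a pointwise limit of difference quotients of `log π` with
increments 1/n, and these are jointly measurable. -/
lemma measurable_score_joint (hM : M.Regular lμ Mg Mh) :
    Measurable (fun x : E d × E p × E q => M.score x.1 x.2.1 x.2.2) := by
  have hcoord : ∀ i : Fin d,
      Measurable (fun x : E d × E p × E q => M.score x.1 x.2.1 x.2.2 i) := by
    intro i
    refine measurable_of_tendsto_metrizable (f := fun (n : ℕ) (x : E d × E p × E q) =>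
      (n : ℝ) * (Real.log (M.policy (x.1 + (n : ℝ)⁻¹ • EuclideanSpace.single i 1) x.2.1 x.2.2) -
        Real.log (M.policy x.1 x.2.1 x.2.2))) (fun n => ?_) (tendsto_pi_nhds.2 fun x => ?_)
    · have h1 := (measurable_policy_joint hM).log
      have h2 := h1.comp (g := fun x : E d × E p × E q => Real.log (M.policy x.1 x.2.1 x.2.2))
        (f := fun x : E d × E p × E q =>
          (x.1 + (n : ℝ)⁻¹ • EuclideanSpace.single i (1 : ℝ), x.2)) (by fun_prop)
      exact (h2.sub h1).const_mul _
    · have h := (hasGradientAt_log_policy hM x.2.1 x.2.2 x.1).hasFDerivAt.lim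
        (EuclideanSpace.single i (1 : ℝ)) (c := fun n : ℕ => (n : ℝ)) (l := Filter.atTop)
        (by simpa using tendsto_natCast_atTop_atTop)
      simpa [InnerProductSpace.toDual_apply_apply, EuclideanSpace.inner_single_right] using h
  have : Measurable (fun x : E d × E p × E q => (M.score x.1 x.2.1 x.2.2).ofLp) :=
    measurable_pi_iff.2 hcoord
  exact (WithLp.measurable_toLp 2 (Fin d → ℝ)).comp this

lemma measurable_score (hM : M.Regular lμ Mg Mh) (θ : E d) :
    Measurable (fun x : E p × E q => M.score θ x.1 x.2) :=
  (measurable_score_joint hM).comp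
    (g := fun x : E d × E p × E q => M.score x.1 x.2.1 x.2.2)
    (f := fun x : E p × E q => (θ, x)) (by fun_prop)

lemma abs_log_policy_sub_le (hM : M.Regular lμ Mg Mh) (s : E p) {a : E q} (ha : a ∈ M.actions)
    (θ θ' : E d) :
    |Real.log (M.policy θ' s a) - Real.log (M.policy θ s a)| ≤ Mg * ‖θ' - θ‖ := by
  refine convex_univ.norm_image_sub_le_of_norm_hasFDerivWithin_le
    (fun x _ => (hasGradientAt_log_policy hM s a x).hasFDerivAt.hasFDerivWithinAt)
    (fun x _ => ?_) (Set.mem_univ θ) (Set.mem_univ θ')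
  rw [LinearIsometryEquiv.norm_map]
  exact hM.norm_score_le x s a ha

lemma norm_score_sub_le (hM : M.Regular lμ Mg Mh) (s : E p) {a : E q} (ha : a ∈ M.actions)
    (θ θ' : E d) : ‖M.score θ' s a - M.score θ s a‖ ≤ Mh * ‖θ' - θ‖ :=
  convex_univ.norm_image_sub_le_of_norm_fderiv_le
    (fun x _ => hM.differentiable_score s a ha x) (fun x _ => hM.norm_hessian_le x s a ha)
    (Set.mem_univ θ) (Set.mem_univ θ')

lemma policy_div_policy_eq_exp (M : Problem p q d) (s : E p) (a : E q) (θ θ' : E d) :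
    M.policy θ s a / M.policy θ' s a =
      Real.exp (Real.log (M.policy θ s a) - Real.log (M.policy θ' s a)) := by
  rw [Real.exp_sub, Real.exp_log (M.policy_pos _ _ _), Real.exp_log (M.policy_pos _ _ _)]

end Policy

end Problem

namespace Problem

/-! ### Laws of trajectories and change of measure -/

section Law

variable {p q d : ℕ} (M : Problem p q d) {lμ Mg Mh : ℝ}

lemma lintegral_policyKernel (θ : E d) (s : E p) {g : E q → ℝ≥0∞} (hg : Measurable g) :
    ∫⁻ a, g a ∂M.policyKernel θ s = ∫⁻ a in M.actions, ENNReal.ofReal (M.policy θ s a) * g a := by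
  rw [policyKernel, Kernel.lintegral_withDensity _ (M.measurable_policy θ).ennreal_ofReal _ hg,
    Kernel.const_apply]

lemma measurable_policy_right (θ : E d) (s : E p) : Measurable (M.policy θ s) :=
  (M.measurable_policy θ).comp (g := Function.uncurry (M.policy θ)) (f := fun a => (s, a))
    (by fun_prop)

lemma ae_policyKernel_mem (θ : E d) (s : E p) : ∀ᵐ a ∂M.policyKernel θ s, a ∈ M.actions := by
  have hA := M.measurableSet_actions
  change M.policyKernel θ s M.actionsᶜ = 0
  rw [← lintegral_indicator_one hA.compl,
    M.lintegral_policyKernel θ s (measurable_one.indicator hA.compl),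
    setLIntegral_congr_fun hA (g := fun _ => 0), lintegral_zero]
  intro a ha
  simp [ha]

lemma lintegral_policyKernel_change (θ θ' : E d) (s : E p) {g : E q → ℝ≥0∞} (hg : Measurable g) :
    ∫⁻ a, g a ∂M.policyKernel θ s =
      ∫⁻ a, ENNReal.ofReal (M.policy θ s a / M.policy θ' s a) * g a ∂M.policyKernel θ' s := by
  have hm := M.measurable_policy_right
  rw [M.lintegral_policyKernel θ s hg, M.lintegral_policyKernel θ' s
    (((hm θ s).fun_div (hm θ' s)).ennreal_ofReal.fun_mul hg)]
  refine lintegral_congr fun a => ?_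
  rw [← mul_assoc, ← ENNReal.ofReal_mul (M.policy_pos _ _ _).le,
    mul_div_cancel₀ _ (M.policy_pos _ _ _).ne']

/-- With y = e^(x²/2): 2 cosh x ≤ 2y ≤ y² + 1. -/
lemma two_cosh_le (x : ℝ) : Real.exp x + Real.exp (-x) ≤ Real.exp (x ^ 2) + 1 := by
  have h1 := Real.cosh_le_exp_half_sq x
  have h2 : Real.exp (x ^ 2) = Real.exp (x ^ 2 / 2) ^ 2 := by
    rw [← Real.exp_nat_mul]; congr 1; push_cast; ring
  rw [Real.cosh_eq] at h1
  nlinarith [sq_nonneg (Real.exp (x ^ 2 / 2) - 1)]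

variable {M} in
-- The ratio r lies between e^(-x) and e^x, so (e^x - r)(r - e^(-x)) ≥ 0, that is r² + 1 ≤ 2 cosh(x)
-- r. Integrating with E r = 1 gives E r² ≤ 2 cosh x - 1 ≤ e^(x²); the first-order term in x
-- disappears because the mean is exactly 1.
lemma lintegral_sq_ratio_le (hM : M.Regular lμ Mg Mh) (θ θ' : E d) (s : E p) :
    ∫⁻ a, ENNReal.ofReal ((M.policy θ s a / M.policy θ' s a) ^ 2) ∂M.policyKernel θ' s ≤
      ENNReal.ofReal (Real.exp (Mg ^ 2 * ‖θ - θ'‖ ^ 2)) := by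
  have hm := M.measurable_policy_right
  set x := Mg * ‖θ - θ'‖ with hx
  have hr : Measurable fun a => M.policy θ s a / M.policy θ' s a := (hm θ s).div (hm θ' s)
  have hone : ∫⁻ a, ENNReal.ofReal (M.policy θ s a / M.policy θ' s a) ∂M.policyKernel θ' s = 1 := by
    have := M.lintegral_policyKernel_change θ θ' s (g := 1) measurable_one
    simpa using this.symm
  have hpt : ∀ᵐ a ∂M.policyKernel θ' s,
      ENNReal.ofReal ((M.policy θ s a / M.policy θ' s a) ^ 2) + 1 ≤
        ENNReal.ofReal (Real.exp x + Real.exp (-x)) *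
          ENNReal.ofReal (M.policy θ s a / M.policy θ' s a) := by
    filter_upwards [M.ae_policyKernel_mem θ' s] with a ha
    have hb := abs_le.1 (abs_log_policy_sub_le hM s ha θ' θ)
    rw [← ENNReal.ofReal_one, ← ENNReal.ofReal_add (sq_nonneg _) zero_le_one,
      ← ENNReal.ofReal_mul (by positivity)]
    apply ENNReal.ofReal_le_ofReal
    rw [M.policy_div_policy_eq_exp]
    have h1 := Real.exp_le_exp.2 hb.1
    have h2 := Real.exp_le_exp.2 hb.2
    rw [← hx] at h1 h2
    have h3 : Real.exp x * Real.exp (-x) = 1 := by rw [← Real.exp_add]; simp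
    nlinarith [mul_nonneg (sub_nonneg.2 h1) (sub_nonneg.2 h2)]
  have hI := lintegral_mono_ae hpt
  rw [lintegral_add_right _ measurable_const, lintegral_const_mul _ hr.ennreal_ofReal, hone] at hI
  simp only [lintegral_const, measure_univ, mul_one] at hI
  have h4 : ENNReal.ofReal (Real.exp x + Real.exp (-x)) ≤
      ENNReal.ofReal (Real.exp (Mg ^ 2 * ‖θ - θ'‖ ^ 2)) + 1 := by
    rw [← ENNReal.ofReal_one, ← ENNReal.ofReal_add (Real.exp_pos _).le zero_le_one, ← mul_pow]
    exact ENNReal.ofReal_le_ofReal (two_cosh_le x)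
  exact (ENNReal.add_le_add_iff_right ENNReal.one_ne_top).1 (hI.trans h4)

/-- The conditional law of the state-action pair which continues a trajectory of length `n`. -/
noncomputable def nextKernel (θ : E d) : (n : ℕ) → Kernel (Traj p q n) (E p × E q)
  | 0 => Kernel.const _ (M.initLaw θ)
  | n + 1 => (M.stepKernel θ).comap (fun τ => τ (Fin.last n)) (measurable_pi_apply _)

instance isMarkov_nextKernel (θ : E d) (n : ℕ) : IsMarkovKernel (M.nextKernel θ n) := by
  cases n <;> unfold nextKernel <;> infer_instance

/-- The next state has a law `ν` that is the same for all `θ`; only the action drawn afterwards sees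
the parameter. This reduces statements about the next pair to statements about `policyKernel`. -/
lemma exists_lintegral_nextKernel (n : ℕ) (τ : Traj p q n) :
    ∃ ν : Measure (E p), IsProbabilityMeasure ν ∧ ∀ (θ : E d) (g : E p × E q → ℝ≥0∞),
      Measurable g →
      ∫⁻ x, g x ∂M.nextKernel θ n τ = ∫⁻ s, ∫⁻ a, g (s, a) ∂M.policyKernel θ s ∂ν := by
  cases n with
  | zero =>
    refine ⟨M.init, inferInstance, fun θ g hg => ?_⟩
    rw [nextKernel, Kernel.const_apply, initLaw, Measure.lintegral_compProd hg]
  | succ n =>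
    refine ⟨M.trans (τ (Fin.last n)), inferInstance, fun θ g hg => ?_⟩
    rw [nextKernel, Kernel.comap_apply, stepKernel, Kernel.lintegral_compProd _ _ _ hg]
    rfl

lemma ae_nextKernel_mem (θ : E d) (n : ℕ) (τ : Traj p q n) :
    ∀ᵐ x ∂M.nextKernel θ n τ, x.2 ∈ M.actions := by
  obtain ⟨ν, hν, h⟩ := M.exists_lintegral_nextKernel n τ
  have hA : MeasurableSet {x : E p × E q | ¬ x.2 ∈ M.actions} :=
    (measurable_snd M.measurableSet_actions).compl
  rw [ae_iff, ← lintegral_indicator_one hA, h θ _ (measurable_one.indicator hA)]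
  refine (lintegral_congr fun s => ?_).trans lintegral_zero
  have := M.ae_policyKernel_mem θ s
  refine (lintegral_congr_ae (g := fun _ => 0) ?_).trans lintegral_zero
  filter_upwards [this] with a ha
  simp [ha]

lemma lintegral_nextKernel_change (θ θ' : E d) (n : ℕ) (τ : Traj p q n)
    {g : E p × E q → ℝ≥0∞} (hg : Measurable g) :
    ∫⁻ x, g x ∂M.nextKernel θ n τ =
      ∫⁻ x, ENNReal.ofReal (M.policy θ x.1 x.2 / M.policy θ' x.1 x.2) * g x
        ∂M.nextKernel θ' n τ := by
  obtain ⟨ν, hν, h⟩ := M.exists_lintegral_nextKernel n τ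
  have hr : Measurable fun x : E p × E q => M.policy θ x.1 x.2 / M.policy θ' x.1 x.2 :=
    (M.measurable_policy θ).div (M.measurable_policy θ')
  rw [h θ g hg, h θ' _ (hr.ennreal_ofReal.fun_mul hg)]
  exact lintegral_congr fun s =>
    M.lintegral_policyKernel_change θ θ' s (hg.comp measurable_prodMk_left)

variable {M} in
lemma lintegral_nextKernel_sq_ratio_le (hM : M.Regular lμ Mg Mh) (θ θ' : E d) (n : ℕ)
    (τ : Traj p q n) :
    ∫⁻ x, ENNReal.ofReal ((M.policy θ x.1 x.2 / M.policy θ' x.1 x.2) ^ 2) ∂M.nextKernel θ' n τ ≤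
      ENNReal.ofReal (Real.exp (Mg ^ 2 * ‖θ - θ'‖ ^ 2)) := by
  obtain ⟨ν, hν, h⟩ := M.exists_lintegral_nextKernel n τ
  have hr : Measurable fun x : E p × E q => M.policy θ x.1 x.2 / M.policy θ' x.1 x.2 :=
    (M.measurable_policy θ).div (M.measurable_policy θ')
  rw [h θ' _ (hr.pow_const 2).ennreal_ofReal]
  refine (lintegral_mono fun s => lintegral_sq_ratio_le hM θ θ' s).trans ?_
  simp

instance isProbability_pathLaw (θ : E d) : IsProbabilityMeasure (M.pathLaw θ) := by
  unfold pathLaw; infer_instance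

lemma measurable_restrict_path (n : ℕ) :
    Measurable (fun (z : ℕ → E p × E q) (h : Fin n) => z h) :=
  measurable_pi_lambda _ fun _ => measurable_pi_apply _

instance isProbability_trajLaw (n : ℕ) (θ : E d) : IsProbabilityMeasure (M.trajLaw n θ) :=
  Measure.isProbabilityMeasure_map (measurable_restrict_path n).aemeasurable

/-- A trajectory continued by a state-action pair. -/
def extend {n : ℕ} (τ : Traj p q n) (x : E p × E q) : Traj p q (n + 1) :=
  Fin.snoc (α := fun _ => E p × E q) τ x

@[simp] lemma extend_castSucc {n : ℕ} (τ : Traj p q n) (x : E p × E q) (i : Fin n) :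
    extend τ x i.castSucc = τ i := Fin.snoc_castSucc ..

@[simp] lemma extend_last {n : ℕ} (τ : Traj p q n) (x : E p × E q) :
    extend τ x (Fin.last n) = x := Fin.snoc_last ..

lemma measurable_extend (n : ℕ) :
    Measurable (fun y : Traj p q n × (E p × E q) => extend y.1 y.2) := by
  refine measurable_pi_lambda _ fun i => ?_
  refine Fin.lastCases ?_ (fun i => ?_) i
  · simp only [extend_last]; exact measurable_snd
  · simp only [extend_castSucc]; exact (measurable_pi_apply i).comp measurable_fst

lemma restrict_succ_eq_extend (n : ℕ) (z : ℕ → E p × E q) :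
    (fun h : Fin (n + 1) => z h) = extend (fun h : Fin n => z h) (z n) := by
  funext i
  refine Fin.lastCases ?_ (fun i => ?_) i <;> simp

lemma pathLaw_map_zero (θ : E d) : (M.pathLaw θ).map (fun z => z 0) = M.initLaw θ := by
  rw [pathLaw, Kernel.trajMeasure]
  have h : (fun z : ℕ → E p × E q => z 0) =
      (fun y : (i : Finset.Iic 0) → E p × E q => y ⟨0, by simp⟩) ∘
        Preorder.frestrictLe (π := fun _ => E p × E q) 0 := rfl
  rw [h, ← Measure.map_map (measurable_pi_apply _) (by fun_prop),
    Measure.map_comp _ _ (by fun_prop), Kernel.traj_map_frestrictLe, Kernel.partialTraj_self,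
    Measure.id_comp, Measure.map_map (measurable_pi_apply _) (by fun_prop)]
  exact Measure.map_id

lemma lintegral_trajLaw (n : ℕ) (θ : E d) {F : Traj p q n → ℝ≥0∞} (hF : Measurable F) :
    ∫⁻ τ, F τ ∂M.trajLaw n θ = ∫⁻ z, F (fun h => z h) ∂M.pathLaw θ :=
  lintegral_map hF (measurable_restrict_path n)

/-- Disintegration along the last step, which opens the trajectory law to induction on its length.
-/
lemma lintegral_trajLaw_succ (n : ℕ) (θ : E d) {F : Traj p q (n + 1) → ℝ≥0∞}
    (hF : Measurable F) :
    ∫⁻ τ, F τ ∂M.trajLaw (n + 1) θ =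
      ∫⁻ τ, ∫⁻ x, F (extend τ x) ∂M.nextKernel θ n τ ∂M.trajLaw n θ := by
  have hF' : Measurable fun y : Traj p q n × (E p × E q) => F (extend y.1 y.2) :=
    hF.comp (measurable_extend n)
  rw [M.lintegral_trajLaw _ θ hF,
    M.lintegral_trajLaw _ θ (Measurable.lintegral_kernel_prod_right' hF')]
  simp only [restrict_succ_eq_extend]
  cases n with
  | zero =>
    have e : ∀ z : ℕ → E p × E q, (fun h : Fin 0 => z h) = Fin.elim0 :=
      fun z => Subsingleton.elim _ _
    simp only [e, lintegral_const, measure_univ, mul_one, nextKernel, Kernel.const_apply]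
    have hg : Measurable fun x => F (extend (Fin.elim0 : Traj p q 0) x) :=
      hF'.comp measurable_prodMk_left
    rw [← M.pathLaw_map_zero θ, lintegral_map hg (measurable_pi_apply 0)]
  | succ n =>
    -- `R` only reindexes: histories indexed by `Iic n` become trajectories of length `n + 1`.
    let R : ((i : Finset.Iic n) → E p × E q) → Traj p q (n + 1) :=
      fun y i => y ⟨i, Finset.mem_Iic.2 (Nat.lt_succ_iff.1 i.2)⟩
    have hR : Measurable R := measurable_pi_lambda _ fun _ => measurable_pi_apply _
    have key := Kernel.map_frestrictLe_trajMeasure_compProd_eq_map_trajMeasure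
      (X := fun _ => E p × E q) (μ₀ := M.initLaw θ) (κ := M.stepKernelPast θ) (a := n)
    have hG : Measurable fun y : ((i : Finset.Iic n) → E p × E q) × (E p × E q) =>
        F (extend (R y.1) y.2) :=
      hF'.comp ((hR.comp measurable_fst).prodMk measurable_snd)
    have h1 : ∫⁻ z, F (extend (fun h : Fin (n + 1) => z h) (z (n + 1))) ∂M.pathLaw θ =
        ∫⁻ y, F (extend (R y.1) y.2) ∂((M.pathLaw θ).map
          (fun x => (Preorder.frestrictLe (π := fun _ => E p × E q) n x, x (n + 1)))) := by
      rw [lintegral_map hG (by fun_prop)]; rfl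
    rw [h1]
    unfold pathLaw
    rw [← key, Measure.lintegral_compProd hG,
      lintegral_map (Measurable.lintegral_kernel_prod_right' hG) (by fun_prop)]
    rfl

lemma integral_trajLaw {F : Type*} [NormedAddCommGroup F] [NormedSpace ℝ F] {n : ℕ} (θ : E d)
    {f : Traj p q n → F} (hf : AEStronglyMeasurable f (M.trajLaw n θ)) :
    ∫ τ, f τ ∂M.trajLaw n θ = ∫ z, f (fun h => z h) ∂M.pathLaw θ :=
  integral_map (measurable_restrict_path n).aemeasurable hf

lemma ae_pathLaw_mem (θ : E d) : ∀ᵐ z ∂M.pathLaw θ, ∀ t, (z t).2 ∈ M.actions := by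
  rw [ae_all_iff]
  intro t
  have hA : MeasurableSet {τ : Traj p q (t + 1) | ¬ (τ (Fin.last t)).2 ∈ M.actions} :=
    ((measurable_pi_apply (Fin.last t)).snd M.measurableSet_actions).compl
  have h : M.trajLaw (t + 1) θ {τ | ¬ (τ (Fin.last t)).2 ∈ M.actions} = 0 := by
    rw [← lintegral_indicator_one hA, M.lintegral_trajLaw_succ t θ (measurable_one.indicator hA)]
    refine (lintegral_congr fun τ => ?_).trans lintegral_zero
    refine (lintegral_congr_ae (g := fun _ => 0) ?_).trans lintegral_zero
    filter_upwards [M.ae_nextKernel_mem θ t τ] with x hx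
    simp [hx]
  have h2 := ae_of_ae_map (measurable_restrict_path (t + 1)).aemeasurable (ae_iff.2 h)
  simpa using h2

lemma ae_trajLaw_mem (n : ℕ) (θ : E d) :
    ∀ᵐ τ ∂M.trajLaw n θ, ∀ h, (τ h).2 ∈ M.actions := by
  have hA : MeasurableSet {τ : Traj p q n | ∀ h, (τ h).2 ∈ M.actions} := by
    simp only [Set.ofPred_forall]
    exact MeasurableSet.iInter fun h => (measurable_pi_apply h).snd M.measurableSet_actions
  rw [trajLaw, ae_map_iff (measurable_restrict_path n).aemeasurable hA]
  filter_upwards [M.ae_pathLaw_mem θ] with z hz h using hz h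

lemma isWeight_extend {n : ℕ} (τ : Traj p q n) (x : E p × E q) (θ' θ : E d) :
    M.isWeight (extend τ x) θ' θ =
      M.isWeight τ θ' θ * (M.policy θ' x.1 x.2 / M.policy θ x.1 x.2) := by
  simp only [isWeight, Fin.prod_univ_castSucc, extend_castSucc, extend_last]

lemma isWeight_pos {n : ℕ} (τ : Traj p q n) (θ' θ : E d) : 0 < M.isWeight τ θ' θ :=
  Finset.prod_pos fun _ _ => div_pos (M.policy_pos _ _ _) (M.policy_pos _ _ _)

lemma isWeight_self {n : ℕ} (τ : Traj p q n) (θ : E d) : M.isWeight τ θ θ = 1 :=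
  Finset.prod_eq_one fun _ _ => div_self (M.policy_pos _ _ _).ne'

lemma measurable_isWeight {n : ℕ} (θ' θ : E d) :
    Measurable (fun τ : Traj p q n => M.isWeight τ θ' θ) := by
  refine Finset.measurable_prod _ fun i _ => ?_
  exact ((M.measurable_policy θ').comp (measurable_pi_apply i)).div
    ((M.measurable_policy θ).comp (measurable_pi_apply i))

variable {M} in
lemma measurable_isWeight_joint (hM : M.Regular lμ Mg Mh) {n : ℕ} :
    Measurable (fun y : Traj p q n × E d × E d => M.isWeight y.1 y.2.1 y.2.2) := by
  refine Finset.measurable_prod _ fun i _ => ?_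
  have h := measurable_policy_joint hM
  have h1 := h.comp (g := fun x : E d × E p × E q => M.policy x.1 x.2.1 x.2.2)
    (f := fun y : Traj p q n × E d × E d => (y.2.1, y.1 i)) (by fun_prop)
  have h2 := h.comp (g := fun x : E d × E p × E q => M.policy x.1 x.2.1 x.2.2)
    (f := fun y : Traj p q n × E d × E d => (y.2.2, y.1 i)) (by fun_prop)
  exact h1.div h2

/-- Induction on the length: peel off the last pair, change its action law, and then change the law
of the shorter trajectory. Initial and transition laws contribute no factor. -/
lemma lintegral_trajLaw_change (n : ℕ) (θ θ' : E d) {F : Traj p q n → ℝ≥0∞} (hF : Measurable F) :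
    ∫⁻ τ, F τ ∂M.trajLaw n θ =
      ∫⁻ τ, ENNReal.ofReal (M.isWeight τ θ θ') * F τ ∂M.trajLaw n θ' := by
  induction n with
  | zero =>
    have e : ∀ z : ℕ → E p × E q, (fun h : Fin 0 => z h) = Fin.elim0 :=
      fun z => Subsingleton.elim _ _
    rw [M.lintegral_trajLaw _ _ hF,
      M.lintegral_trajLaw _ _ ((M.measurable_isWeight θ θ').ennreal_ofReal.fun_mul hF)]
    simp [e, isWeight]
  | succ n ih =>
    have hF' : Measurable fun y : Traj p q n × (E p × E q) => F (extend y.1 y.2) :=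
      hF.comp (measurable_extend n)
    rw [M.lintegral_trajLaw_succ _ _ hF, M.lintegral_trajLaw_succ _ _
      ((M.measurable_isWeight θ θ').ennreal_ofReal.fun_mul hF),
      ih (Measurable.lintegral_kernel_prod_right' hF')]
    refine lintegral_congr fun τ => ?_
    have hr : Measurable fun x : E p × E q => M.policy θ x.1 x.2 / M.policy θ' x.1 x.2 :=
      (M.measurable_policy θ).div (M.measurable_policy θ')
    have hg : Measurable fun x => F (extend τ x) := hF'.comp measurable_prodMk_left
    rw [M.lintegral_nextKernel_change θ θ' n τ hg,
      ← lintegral_const_mul _ (hr.ennreal_ofReal.fun_mul hg)]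
    refine lintegral_congr fun x => ?_
    rw [isWeight_extend, ENNReal.ofReal_mul (M.isWeight_pos _ _ _).le, mul_assoc]

lemma trajLaw_eq_withDensity (n : ℕ) (θ θ' : E d) :
    M.trajLaw n θ = (M.trajLaw n θ').withDensity (fun τ => ENNReal.ofReal (M.isWeight τ θ θ')) := by
  ext s hs
  rw [withDensity_apply _ hs, ← lintegral_indicator_one hs,
    M.lintegral_trajLaw_change n θ θ' (measurable_one.indicator hs), ← lintegral_indicator hs]
  refine lintegral_congr fun τ => ?_
  by_cases h : τ ∈ s <;> simp [h]

lemma integral_trajLaw_change {F : Type*} [NormedAddCommGroup F] [NormedSpace ℝ F] (n : ℕ)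
    (θ θ' : E d) (f : Traj p q n → F) :
    ∫ τ, f τ ∂M.trajLaw n θ = ∫ τ, M.isWeight τ θ θ' • f τ ∂M.trajLaw n θ' := by
  rw [M.trajLaw_eq_withDensity n θ θ', integral_withDensity_eq_integral_toReal_smul
    (M.measurable_isWeight θ θ').ennreal_ofReal
    (Filter.Eventually.of_forall fun _ => ENNReal.ofReal_lt_top)]
  simp only [ENNReal.toReal_ofReal (M.isWeight_pos _ _ _).le]

variable {M} in
-- Given any past, the last factor has conditional second moment at most exp(Mg² ‖θ - θ'‖²), so the
-- bounds multiply over the steps.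
lemma lintegral_sq_isWeight_le (hM : M.Regular lμ Mg Mh) (n : ℕ) (θ θ' : E d) :
    ∫⁻ τ, ENNReal.ofReal (M.isWeight τ θ θ' ^ 2) ∂M.trajLaw n θ' ≤
      ENNReal.ofReal (Real.exp (n * Mg ^ 2 * ‖θ - θ'‖ ^ 2)) := by
  have hw : ∀ n, Measurable fun τ : Traj p q n => ENNReal.ofReal (M.isWeight τ θ θ' ^ 2) :=
    fun n => ((M.measurable_isWeight θ θ').pow_const 2).ennreal_ofReal
  induction n with
  | zero => simp [isWeight]
  | succ n ih =>
    rw [M.lintegral_trajLaw_succ _ _ (hw _)]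
    calc ∫⁻ τ, ∫⁻ x, ENNReal.ofReal (M.isWeight (extend τ x) θ θ' ^ 2) ∂M.nextKernel θ' n τ
          ∂M.trajLaw n θ'
        ≤ ∫⁻ τ, ENNReal.ofReal (M.isWeight τ θ θ' ^ 2) *
            ENNReal.ofReal (Real.exp (Mg ^ 2 * ‖θ - θ'‖ ^ 2)) ∂M.trajLaw n θ' := by
          refine lintegral_mono fun τ => ?_
          have hr : Measurable fun x : E p × E q => M.policy θ x.1 x.2 / M.policy θ' x.1 x.2 :=
            (M.measurable_policy θ).div (M.measurable_policy θ')
          simp only [isWeight_extend, mul_pow, ENNReal.ofReal_mul (sq_nonneg (M.isWeight τ θ θ'))]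
          rw [lintegral_const_mul _ (hr.pow_const 2).ennreal_ofReal]
          exact mul_le_mul_right (lintegral_nextKernel_sq_ratio_le hM θ θ' n τ) _
      _ ≤ ENNReal.ofReal (Real.exp (n * Mg ^ 2 * ‖θ - θ'‖ ^ 2)) *
            ENNReal.ofReal (Real.exp (Mg ^ 2 * ‖θ - θ'‖ ^ 2)) := by
          rw [lintegral_mul_const _ (hw n)]
          exact mul_le_mul_left ih _
      _ = _ := by
          rw [← ENNReal.ofReal_mul (Real.exp_pos _).le, ← Real.exp_add]
          congr 2; push_cast; ring

lemma integral_isWeight (n : ℕ) (θ θ' : E d) :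
    ∫ τ, M.isWeight τ θ θ' ∂M.trajLaw n θ' = 1 := by
  have h := M.integral_trajLaw_change n θ θ' (fun _ => (1 : ℝ))
  simpa using h.symm

/-- The preceding identity needs no integrability, and a non-integrable function would have Bochner
integral 0 instead of 1. -/
lemma integrable_isWeight (n : ℕ) (θ θ' : E d) :
    Integrable (fun τ => M.isWeight τ θ θ') (M.trajLaw n θ') := by
  by_contra h
  have := M.integral_isWeight n θ θ'
  rw [integral_undef h] at this
  exact zero_ne_one this

end Law

/-! ### Variance of importance weights -/

section Variance

/-- From e^x - 1 ≤ x e^x and H ≤ H²; the constant is far from sharp. -/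
lemma exp_sub_one_le_constCw {H : ℕ} {Mg Mh : ℝ} (hMh : 0 ≤ Mh) (α : ℝ) :
    Real.exp (H * Mg ^ 2 * α ^ 2) - 1 ≤ constCw H Mg Mh α * α ^ 2 := by
  unfold constCw constW
  set x := (H : ℝ) * Mg ^ 2 * α ^ 2 with hx
  have hx0 : 0 ≤ x := by positivity
  have h1 : Real.exp x - 1 ≤ x * Real.exp x := by
    have := Real.add_one_le_exp (-x)
    have h2 : Real.exp (-x) * Real.exp x = 1 := by rw [← Real.exp_add]; simp
    nlinarith [Real.exp_pos x]
  have hH : (H : ℝ) ≤ (H : ℝ) ^ 2 := by exact_mod_cast Nat.le_self_pow two_ne_zero H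
  have h3 : x ≤ (2 * (H : ℝ) ^ 2 * Mg ^ 2 + H * Mh) * α ^ 2 := by
    have h4 : x ≤ (H : ℝ) ^ 2 * Mg ^ 2 * α ^ 2 := by rw [hx]; gcongr
    have h5 : 0 ≤ H * Mh * α ^ 2 := by positivity
    nlinarith
  calc Real.exp x - 1 ≤ x * Real.exp x := h1
    _ ≤ ((2 * (H : ℝ) ^ 2 * Mg ^ 2 + H * Mh) * α ^ 2) * (Real.exp x + 1) := by
        apply mul_le_mul h3 (by linarith) (Real.exp_pos _).le
        positivity
    _ = _ := by ring

lemma constCw_nonneg (H : ℕ) {Mg Mh : ℝ} (hMh : 0 ≤ Mh) (α : ℝ) : 0 ≤ constCw H Mg Mh α := by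
  unfold constCw constW; positivity

variable {Ω : Type*} [MeasurableSpace Ω] {P : Measure Ω}

lemma memLp_two_of_lintegral_sq_le {w : Ω → ℝ} (hw : AEMeasurable w P) {c : ℝ}
    (h : ∫⁻ ω, ENNReal.ofReal (w ω ^ 2) ∂P ≤ ENNReal.ofReal c) : MemLp w 2 P := by
  rw [memLp_two_iff_integrable_sq hw.aestronglyMeasurable]
  refine ⟨(hw.pow_const 2).aestronglyMeasurable, ?_⟩
  rw [hasFiniteIntegral_iff_ofReal (Filter.Eventually.of_forall fun _ => sq_nonneg _)]
  exact h.trans_lt ENNReal.ofReal_lt_top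

lemma integral_sq_le_of_lintegral_sq_le {w : Ω → ℝ} (hw : AEMeasurable w P) {c : ℝ} (hc : 0 ≤ c)
    (h : ∫⁻ ω, ENNReal.ofReal (w ω ^ 2) ∂P ≤ ENNReal.ofReal c) : ∫ ω, w ω ^ 2 ∂P ≤ c := by
  rw [integral_eq_lintegral_of_nonneg_ae (Filter.Eventually.of_forall fun _ => sq_nonneg _)
    (hw.pow_const 2).aestronglyMeasurable]
  exact ENNReal.toReal_le_of_le_ofReal hc h

lemma variance_le_of_lintegral_sq_le [IsProbabilityMeasure P] {w : Ω → ℝ} (hw : AEMeasurable w P)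
    {c : ℝ} (hc : 0 ≤ c) (h : ∫⁻ ω, ENNReal.ofReal (w ω ^ 2) ∂P ≤ ENNReal.ofReal c)
    (h1 : ∫ ω, w ω ∂P = 1) : variance w P ≤ c - 1 := by
  rw [variance_eq_sub (memLp_two_of_lintegral_sq_le hw h), h1]
  have := integral_sq_le_of_lintegral_sq_le hw hc h
  simp only [Pi.pow_apply]
  linarith

end Variance

variable {p q d : ℕ} {M : Problem p q d} {lμ Mg Mh : ℝ}

/-- An inequality for the step length suffices, because the second moment bound increases with the
distance. This also covers an update that leaves the parameter unchanged. -/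
lemma isWeight_moments (hM : M.Regular lμ Mg Mh) (hMh : 0 ≤ Mh) (H : ℕ) {θ θ' : E d} {α : ℝ}
    (hα : ‖θ - θ'‖ ≤ α) :
    MemLp (fun τ => M.isWeight τ θ θ') 2 (M.trajLaw H θ') ∧
      ∫ τ, M.isWeight τ θ θ' ∂(M.trajLaw H θ') = 1 ∧
      variance (fun τ => M.isWeight τ θ θ') (M.trajLaw H θ') ≤ constCw H Mg Mh α * α ^ 2 := by
  have hm := (M.measurable_isWeight (n := H) θ θ').aemeasurable (μ := M.trajLaw H θ')
  have h := lintegral_sq_isWeight_le hM H θ θ'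
  refine ⟨memLp_two_of_lintegral_sq_le hm h, M.integral_isWeight H θ θ', ?_⟩
  have h' : Real.exp (H * Mg ^ 2 * ‖θ - θ'‖ ^ 2) ≤ Real.exp (H * Mg ^ 2 * α ^ 2) := by gcongr
  replace h := h.trans (ENNReal.ofReal_le_ofReal h')
  exact (variance_le_of_lintegral_sq_le hm (Real.exp_pos _).le h
    (M.integral_isWeight H θ θ')).trans (exp_sub_one_le_constCw hMh α)

end Problem

namespace Problem

/-! ### Derivatives of expectations with respect to the policy parameter -/

section Score

variable {p q d : ℕ} {M : Problem p q d} {lμ Mg Mh : ℝ}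

/-- All actions of the trajectory are admissible. -/
def Admissible (M : Problem p q d) {n : ℕ} (τ : Traj p q n) : Prop := ∀ h, (τ h).2 ∈ M.actions

/-- The score of a trajectory. -/
noncomputable def scoreSum (M : Problem p q d) {n : ℕ} (τ : Traj p q n) (θ : E d) : E d :=
  ∑ h, M.score θ (τ h).1 (τ h).2

lemma ae_admissible (M : Problem p q d) (n : ℕ) (θ : E d) :
    ∀ᵐ τ ∂M.trajLaw n θ, M.Admissible τ := M.ae_trajLaw_mem n θ

lemma measurable_scoreSum (hM : M.Regular lμ Mg Mh) {n : ℕ} (θ : E d) :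
    Measurable (fun τ : Traj p q n => M.scoreSum τ θ) :=
  Finset.measurable_fun_sum _ fun i _ =>
    (measurable_score hM θ).comp (g := fun x : E p × E q => M.score θ x.1 x.2)
      (measurable_pi_apply i)

lemma norm_scoreSum_le (hM : M.Regular lμ Mg Mh) {n : ℕ} {τ : Traj p q n} (hτ : M.Admissible τ)
    (θ : E d) : ‖M.scoreSum τ θ‖ ≤ n * Mg := by
  refine (norm_sum_le _ _).trans ((Finset.sum_le_sum fun h _ =>
    hM.norm_score_le θ _ _ (hτ h)).trans ?_)
  simp

lemma norm_scoreSum_sub_le (hM : M.Regular lμ Mg Mh) {n : ℕ} {τ : Traj p q n}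
    (hτ : M.Admissible τ) (θ θ' : E d) :
    ‖M.scoreSum τ θ - M.scoreSum τ θ'‖ ≤ n * (Mh * ‖θ - θ'‖) := by
  unfold scoreSum
  rw [← Finset.sum_sub_distrib]
  refine (norm_sum_le _ _).trans ((Finset.sum_le_sum fun h _ =>
    norm_score_sub_le hM _ (hτ h) θ' θ).trans ?_)
  simp

lemma isWeight_eq_exp (M : Problem p q d) {n : ℕ} (τ : Traj p q n) (θ θ₀ : E d) :
    M.isWeight τ θ θ₀ = Real.exp (∑ h, (Real.log (M.policy θ (τ h).1 (τ h).2) -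
      Real.log (M.policy θ₀ (τ h).1 (τ h).2))) := by
  rw [Real.exp_sum]
  exact Finset.prod_congr rfl fun h _ => M.policy_div_policy_eq_exp _ _ _ _

lemma abs_sum_log_le (hM : M.Regular lμ Mg Mh) {n : ℕ} {τ : Traj p q n} (hτ : M.Admissible τ)
    (θ θ₀ : E d) :
    |∑ h, (Real.log (M.policy θ (τ h).1 (τ h).2) - Real.log (M.policy θ₀ (τ h).1 (τ h).2))| ≤
      n * (Mg * ‖θ - θ₀‖) := by
  refine (Finset.abs_sum_le_sum_abs _ _).trans ((Finset.sum_le_sum fun h _ =>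
    abs_log_policy_sub_le hM _ (hτ h) θ₀ θ).trans ?_)
  simp

lemma isWeight_le (hM : M.Regular lμ Mg Mh) {n : ℕ} {τ : Traj p q n} (hτ : M.Admissible τ)
    (θ θ₀ : E d) : M.isWeight τ θ θ₀ ≤ Real.exp (n * (Mg * ‖θ - θ₀‖)) := by
  rw [isWeight_eq_exp]
  exact Real.exp_le_exp.2 ((le_abs_self _).trans (abs_sum_log_le hM hτ θ θ₀))

/-- The factor 1 + e^x, rather than an exponential of |x|, is chosen because for e^x = w its
expectation is exactly 2; Lipschitz constants then stay polynomial in the horizon. -/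
lemma abs_exp_sub_one_le_mul (x : ℝ) : |Real.exp x - 1| ≤ |x| * (1 + Real.exp x) := by
  have h1 := Real.add_one_le_exp x
  have h2 := Real.add_one_le_exp (-x)
  have h3 : Real.exp (-x) * Real.exp x = 1 := by rw [← Real.exp_add]; simp
  have h4 := Real.exp_pos x
  rcases le_total 0 x with h | h
  · rw [abs_of_nonneg h, abs_of_nonneg (by linarith)]
    nlinarith
  · rw [abs_of_nonpos h, abs_of_nonpos (by rw [sub_nonpos]; exact Real.exp_le_one_iff.2 h)]
    nlinarith

lemma abs_isWeight_sub_one_le (hM : M.Regular lμ Mg Mh) {n : ℕ} {τ : Traj p q n}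
    (hτ : M.Admissible τ) (θ θ₀ : E d) :
    |M.isWeight τ θ θ₀ - 1| ≤ n * (Mg * ‖θ - θ₀‖) * (1 + M.isWeight τ θ θ₀) := by
  rw [isWeight_eq_exp]
  exact (abs_exp_sub_one_le_mul _).trans
    (mul_le_mul_of_nonneg_right (abs_sum_log_le hM hτ θ θ₀) (by positivity))

lemma hasGradientAt_isWeight (hM : M.Regular lμ Mg Mh) {n : ℕ} (τ : Traj p q n) (θ θ₀ : E d) :
    HasGradientAt (fun θ => M.isWeight τ θ θ₀) (M.isWeight τ θ θ₀ • M.scoreSum τ θ) θ := by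
  rw [hasGradientAt_iff_hasFDerivAt]
  have h := (HasFDerivAt.fun_sum (u := Finset.univ) fun h _ =>
    ((hasGradientAt_log_policy hM (τ h).1 (τ h).2 θ).hasFDerivAt).sub_const
      (Real.log (M.policy θ₀ (τ h).1 (τ h).2))).exp
  simp only [← isWeight_eq_exp] at h
  rw [map_smul, scoreSum, map_sum]
  exact h

lemma integrable_of_admissible_bound (M : Problem p q d) {F : Type*} [NormedAddCommGroup F]
    {n : ℕ} {θ : E d} {f : Traj p q n → F} (hf : AEStronglyMeasurable f (M.trajLaw n θ)) {B : ℝ}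
    (hB : ∀ τ, M.Admissible τ → ‖f τ‖ ≤ B) : Integrable f (M.trajLaw n θ) :=
  Integrable.of_bound hf B ((M.ae_admissible n θ).mono hB)

/-- Differentiation of the expectation of a bounded functional of the trajectory. -/
lemma hasGradientAt_expectation (hM : M.Regular lμ Mg Mh) {n : ℕ} {Y : Traj p q n → ℝ}
    (hY : Measurable Y) {B : ℝ} (hB : ∀ τ, M.Admissible τ → |Y τ| ≤ B) (θ₀ : E d) :
    HasGradientAt (fun θ => ∫ τ, Y τ ∂M.trajLaw n θ)
      (∫ τ, Y τ • M.scoreSum τ θ₀ ∂M.trajLaw n θ₀) θ₀ := by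
  have hw : ∀ θ, Measurable fun τ : Traj p q n => M.isWeight τ θ θ₀ :=
    fun θ => M.measurable_isWeight θ θ₀
  have hm : AEStronglyMeasurable (fun τ => Y τ • InnerProductSpace.toDual ℝ (E d)
      (M.isWeight τ θ₀ θ₀ • M.scoreSum τ θ₀)) (M.trajLaw n θ₀) := by
    have h1 : Measurable fun τ : Traj p q n => M.isWeight τ θ₀ θ₀ • M.scoreSum τ θ₀ :=
      (hw θ₀).smul (measurable_scoreSum hM θ₀)
    exact hY.aestronglyMeasurable.smul
      ((InnerProductSpace.toDual ℝ (E d)).continuous.comp_aestronglyMeasurable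
        h1.aestronglyMeasurable)
  rw [hasGradientAt_iff_hasFDerivAt]
  -- Under the fixed law at `θ₀` the parameter enters only through the weight, so it can be
  -- differentiated inside the integral.
  simp only [fun θ => M.integral_trajLaw_change n θ θ₀ Y, smul_eq_mul]
  have key := hasFDerivAt_integral_of_dominated_of_fderiv_le (𝕜 := ℝ)
    (μ := M.trajLaw n θ₀) (s := Metric.ball θ₀ 1)
    (F := fun θ τ => M.isWeight τ θ θ₀ * Y τ) (x₀ := θ₀)
    (F' := fun θ τ => Y τ • InnerProductSpace.toDual ℝ (E d)
      (M.isWeight τ θ θ₀ • M.scoreSum τ θ))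
    (bound := fun _ => B * (Real.exp (n * Mg) * (n * Mg)))
    (Metric.ball_mem_nhds _ one_pos)
    (Filter.Eventually.of_forall fun θ => ((hw θ).mul hY).aestronglyMeasurable)
    ?_ ?_ ?_ (integrable_const _) ?_
  · have hi : Integrable (fun τ => Y τ • M.scoreSum τ θ₀) (M.trajLaw n θ₀) := by
      refine M.integrable_of_admissible_bound (B := B * (n * Mg))
        (hY.smul (measurable_scoreSum hM θ₀)).aestronglyMeasurable fun τ hτ => ?_
      rw [norm_smul]
      exact mul_le_mul (hB τ hτ) (norm_scoreSum_le hM hτ θ₀) (norm_nonneg _)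
        ((abs_nonneg _).trans (hB τ hτ))
    have hi' : Integrable (fun τ => Y τ • InnerProductSpace.toDual ℝ (E d)
        (M.isWeight τ θ₀ θ₀ • M.scoreSum τ θ₀)) (M.trajLaw n θ₀) := by
      refine hi.norm.mono' hm ?_
      filter_upwards with τ
      rw [norm_smul, LinearIsometryEquiv.norm_map, isWeight_self, one_smul, norm_smul]
    have e : InnerProductSpace.toDual ℝ (E d)
        (∫ τ, Y τ • M.scoreSum τ θ₀ ∂M.trajLaw n θ₀) =
        ∫ τ, Y τ • InnerProductSpace.toDual ℝ (E d)
          (M.isWeight τ θ₀ θ₀ • M.scoreSum τ θ₀) ∂M.trajLaw n θ₀ := by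
      ext v
      rw [ContinuousLinearMap.integral_apply hi', InnerProductSpace.toDual_apply_apply,
        real_inner_comm, ← integral_inner hi]
      refine integral_congr_ae (Filter.Eventually.of_forall fun τ => ?_)
      simp [isWeight_self, real_inner_smul_right, real_inner_comm]
    rw [e]
    exact key
  · refine M.integrable_of_admissible_bound (B := B)
      ((hw θ₀).mul hY).aestronglyMeasurable fun τ hτ => ?_
    simpa [isWeight_self] using hB τ hτ
  · exact hm
  · filter_upwards [M.ae_admissible n θ₀] with τ hτ θ hθ
    have hd : ‖θ - θ₀‖ ≤ 1 := by rw [← dist_eq_norm]; exact (Metric.mem_ball.1 hθ).le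
    rw [norm_smul, LinearIsometryEquiv.norm_map, norm_smul,
      Real.norm_of_nonneg (M.isWeight_pos τ θ θ₀).le]
    have h1 := norm_scoreSum_le hM hτ θ
    have hn : 0 ≤ (n : ℝ) * Mg := (norm_nonneg _).trans h1
    -- On the unit ball the weight is at most e^(n Mg), which makes the dominating function a
    -- constant.
    have h2 : M.isWeight τ θ θ₀ ≤ Real.exp (n * Mg) := by
      refine (isWeight_le hM hτ θ θ₀).trans (Real.exp_le_exp.2 ?_)
      rw [← mul_assoc]
      exact mul_le_of_le_one_right hn hd
    exact mul_le_mul (hB τ hτ) (mul_le_mul h2 h1 (norm_nonneg _) (Real.exp_pos _).le)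
      (mul_nonneg (M.isWeight_pos _ _ _).le (norm_nonneg _)) ((abs_nonneg _).trans (hB τ hτ))
  · filter_upwards with τ θ _
    exact (hasGradientAt_isWeight hM τ θ θ₀).hasFDerivAt.mul_const (Y τ)

/-- The gradient of an expectation is Lipschitz in the policy parameter. -/
lemma norm_gradient_expectation_sub_le (hM : M.Regular lμ Mg Mh) (_hMg : 0 ≤ Mg) {n : ℕ}
    {Y : Traj p q n → ℝ} (hY : Measurable Y) {B : ℝ} (hB0 : 0 ≤ B)
    (hB : ∀ τ, M.Admissible τ → |Y τ| ≤ B) (θ θ' : E d) :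
    ‖∫ τ, Y τ • M.scoreSum τ θ ∂M.trajLaw n θ - ∫ τ, Y τ • M.scoreSum τ θ' ∂M.trajLaw n θ'‖ ≤
      B * (2 * n ^ 2 * Mg ^ 2 + n * Mh) * ‖θ - θ'‖ := by
  have hS := fun θ => measurable_scoreSum hM (n := n) θ
  have hw := M.measurable_isWeight (n := n) θ' θ
  -- Both expectations are put under the law at `θ`. The integrand splits into a change of score and
  -- the term (w - 1) times a score; E(1 + w) = 2 produces the factor 2 in front of n² Mg².
  rw [M.integral_trajLaw_change n θ' θ, ← integral_sub]
  · have hbound : ∀ᵐ τ ∂M.trajLaw n θ,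
        ‖Y τ • M.scoreSum τ θ - M.isWeight τ θ' θ • Y τ • M.scoreSum τ θ'‖ ≤
          B * (n * (Mh * ‖θ - θ'‖)) +
            B * (n * Mg * (n * (Mg * ‖θ - θ'‖))) * (1 + M.isWeight τ θ' θ) := by
      filter_upwards [M.ae_admissible n θ] with τ hτ
      have e : Y τ • M.scoreSum τ θ - M.isWeight τ θ' θ • Y τ • M.scoreSum τ θ' =
          Y τ • (M.scoreSum τ θ - M.scoreSum τ θ') -
            Y τ • (M.isWeight τ θ' θ - 1) • M.scoreSum τ θ' := by
        module
      rw [e]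
      refine (norm_sub_le _ _).trans (add_le_add ?_ ?_)
      · rw [norm_smul]
        exact mul_le_mul (hB τ hτ) (norm_scoreSum_sub_le hM hτ θ θ') (norm_nonneg _) hB0
      · rw [norm_smul, norm_smul, mul_assoc]
        refine mul_le_mul (hB τ hτ) ?_ (by positivity) hB0
        have h1 := abs_isWeight_sub_one_le hM hτ θ' θ
        rw [norm_sub_rev] at h1
        have h2 := norm_scoreSum_le hM hτ θ'
        calc _ ≤ (n * (Mg * ‖θ - θ'‖) * (1 + M.isWeight τ θ' θ)) * (n * Mg) :=
              mul_le_mul h1 h2 (norm_nonneg _) ((abs_nonneg _).trans h1)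
          _ = _ := by ring
    have hi := (integrable_const (1 : ℝ)).fun_add (M.integrable_isWeight n θ' θ)
    refine (norm_integral_le_of_norm_le
      ((integrable_const _).fun_add (hi.const_mul _)) hbound).trans ?_
    rw [integral_add (integrable_const _) (hi.const_mul _),
      integral_const_mul (B * (n * Mg * (n * (Mg * ‖θ - θ'‖)))),
      integral_add (integrable_const _) (M.integrable_isWeight n θ' θ), M.integral_isWeight]
    simp only [integral_const, probReal_univ, smul_eq_mul, one_mul]
    apply le_of_eq; ring
  · refine M.integrable_of_admissible_bound (B := B * (n * Mg))
      (hY.smul (hS θ)).aestronglyMeasurable fun τ hτ => ?_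
    rw [norm_smul]
    exact mul_le_mul (hB τ hτ) (norm_scoreSum_le hM hτ θ) (norm_nonneg _) hB0
  · refine M.integrable_of_admissible_bound
      (B := Real.exp (n * (Mg * ‖θ' - θ‖)) * (B * (n * Mg)))
      (hw.smul (hY.smul (hS θ'))).aestronglyMeasurable fun τ hτ => ?_
    rw [norm_smul, norm_smul, Real.norm_of_nonneg (M.isWeight_pos _ _ _).le]
    exact mul_le_mul (isWeight_le hM hτ θ' θ)
      (mul_le_mul (hB τ hτ) (norm_scoreSum_le hM hτ θ') (norm_nonneg _) hB0)
      (by positivity) (Real.exp_pos _).le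

/-- The score of the first `n` steps of a path. -/
noncomputable def pathScore (M : Problem p q d) (n : ℕ) (z : ℕ → E p × E q) (θ : E d) : E d :=
  ∑ t ∈ Finset.range n, M.score θ (z t).1 (z t).2

lemma scoreSum_restrict (M : Problem p q d) (n : ℕ) (z : ℕ → E p × E q) (θ : E d) :
    M.scoreSum (fun h : Fin n => z h) θ = M.pathScore n z θ :=
  (Finset.sum_range fun t => M.score θ (z t).1 (z t).2).symm

lemma measurable_score_path (hM : M.Regular lμ Mg Mh) (t : ℕ) (θ : E d) :
    Measurable (fun z : ℕ → E p × E q => M.score θ (z t).1 (z t).2) :=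
  (measurable_score hM θ).comp (g := fun x : E p × E q => M.score θ x.1 x.2)
    (measurable_pi_apply t)

lemma measurable_pathScore (hM : M.Regular lμ Mg Mh) (n : ℕ) (θ : E d) :
    Measurable (fun z => M.pathScore n z θ) :=
  Finset.measurable_fun_sum _ fun t _ => measurable_score_path hM t θ

lemma norm_pathScore_le (hM : M.Regular lμ Mg Mh) (n : ℕ) {z : ℕ → E p × E q}
    (hz : ∀ t, (z t).2 ∈ M.actions) (θ : E d) : ‖M.pathScore n z θ‖ ≤ n * Mg := by
  rw [← scoreSum_restrict]
  exact norm_scoreSum_le hM (fun h => hz h) θ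

lemma integrable_path_of_bound (M : Problem p q d) {F : Type*} [NormedAddCommGroup F] {θ : E d}
    {f : (ℕ → E p × E q) → F} (hf : AEStronglyMeasurable f (M.pathLaw θ)) {B : ℝ}
    (hB : ∀ z : ℕ → E p × E q, (∀ t, (z t).2 ∈ M.actions) → ‖f z‖ ≤ B) :
    Integrable f (M.pathLaw θ) :=
  Integrable.of_bound hf B ((M.ae_pathLaw_mem θ).mono hB)

/-- Scores of later steps are orthogonal to functionals of the earlier steps. -/
lemma integral_smul_score_eq_zero (hM : M.Regular lμ Mg Mh) {n : ℕ} {Y : Traj p q n → ℝ}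
    (hY : Measurable Y) {B : ℝ} (hB : ∀ τ, M.Admissible τ → |Y τ| ≤ B) (θ₀ : E d) :
    ∫ z, Y (fun h => z h) • M.score θ₀ (z n).1 (z n).2 ∂M.pathLaw θ₀ = 0 := by
  have hr : Measurable (fun (τ : Traj p q (n + 1)) (h : Fin n) => τ h.castSucc) :=
    measurable_pi_lambda _ fun _ => measurable_pi_apply _
  have hYc : Measurable fun τ : Traj p q (n + 1) => Y fun h => τ h.castSucc := hY.comp hr
  have hYr : Measurable fun z : ℕ → E p × E q => Y (fun h => z h) :=
    hY.comp (measurable_restrict_path n)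
  have h1 := hasGradientAt_expectation hM hY hB θ₀
  have h2 := hasGradientAt_expectation hM (n := n + 1) (Y := fun τ => Y fun h => τ h.castSucc)
    hYc (fun τ hτ => hB _ fun h => hτ h.castSucc) θ₀
  -- The same function of `θ` is an expectation over n steps and over n + 1 steps. By uniqueness of
  -- the gradient its two score formulas agree, and they differ by exactly the claimed integral.
  have e : (fun θ => ∫ τ, Y τ ∂M.trajLaw n θ) =
      fun θ => ∫ τ, Y (fun h => τ h.castSucc) ∂M.trajLaw (n + 1) θ := by
    funext θ
    rw [M.integral_trajLaw θ hY.aestronglyMeasurable,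
      M.integral_trajLaw θ hYc.aestronglyMeasurable]
    rfl
  rw [e] at h1
  have h3 := h1.unique h2
  rw [M.integral_trajLaw θ₀ (hY.fun_smul (measurable_scoreSum hM θ₀)).aestronglyMeasurable,
    M.integral_trajLaw θ₀ (hYc.fun_smul (measurable_scoreSum hM θ₀)).aestronglyMeasurable]
    at h3
  simp only [scoreSum_restrict, Fin.val_castSucc] at h3
  have hsplit : ∀ z : ℕ → E p × E q, Y (fun h => z h) • M.pathScore (n + 1) z θ₀ =
      Y (fun h => z h) • M.pathScore n z θ₀ + Y (fun h => z h) • M.score θ₀ (z n).1 (z n).2 := by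
    intro z
    rw [pathScore, Finset.sum_range_succ, smul_add]; rfl
  simp only [hsplit] at h3
  rw [integral_add] at h3
  · exact left_eq_add.1 h3
  · refine M.integrable_path_of_bound (B := B * (n * Mg))
      (hYr.smul (measurable_pathScore hM n θ₀)).aestronglyMeasurable fun z hz => ?_
    rw [norm_smul]
    exact mul_le_mul (hB _ fun h => hz h) (norm_pathScore_le hM n hz θ₀) (norm_nonneg _)
        ((abs_nonneg _).trans (hB (fun h => z h) fun h => hz h))
  · refine M.integrable_path_of_bound (B := B * Mg)
      (hYr.smul (measurable_score_path hM n θ₀)).aestronglyMeasurable fun z hz => ?_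
    rw [norm_smul]
    exact mul_le_mul (hB _ fun h => hz h) (hM.norm_score_le _ _ _ (hz n)) (norm_nonneg _)
        ((abs_nonneg _).trans (hB (fun h => z h) fun h => hz h))

/-- Orthogonality applied in each coordinate, with the coordinate of the earlier score sum as the
functional `Y`. -/
lemma integral_inner_pathScore_score (hM : M.Regular lμ Mg Mh) (n : ℕ) (θ : E d) :
    ∫ z, inner ℝ (M.pathScore n z θ) (M.score θ (z n).1 (z n).2) ∂M.pathLaw θ = 0 := by
  have hint : ∀ i : Fin d, Integrable
      (fun z => (M.pathScore n z θ) i • M.score θ (z n).1 (z n).2) (M.pathLaw θ) := by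
    intro i
    refine M.integrable_path_of_bound (B := n * Mg * Mg) ?_ fun z hz => ?_
    · exact (((PiLp.continuous_apply 2 _ i).measurable.comp
        (measurable_pathScore hM n θ)).smul (measurable_score_path hM n θ)).aestronglyMeasurable
    · rw [norm_smul]
      have h1 := norm_pathScore_le hM n hz θ
      exact mul_le_mul ((PiLp.norm_apply_le _ i).trans h1) (hM.norm_score_le _ _ _ (hz n))
        (norm_nonneg _) ((norm_nonneg _).trans h1)
  have hz : ∀ i : Fin d,
      ∫ z, (M.pathScore n z θ) i • M.score θ (z n).1 (z n).2 ∂M.pathLaw θ = 0 := by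
    intro i
    have h := integral_smul_score_eq_zero hM (n := n) (Y := fun τ => (M.scoreSum τ θ) i)
      ((PiLp.continuous_apply 2 _ i).measurable.comp (measurable_scoreSum hM θ))
      (B := n * Mg) (fun τ hτ => (PiLp.norm_apply_le _ i).trans (norm_scoreSum_le hM hτ θ)) θ
    simpa only [scoreSum_restrict] using h
  have e : ∀ z : ℕ → E p × E q, inner ℝ (M.pathScore n z θ) (M.score θ (z n).1 (z n).2) =
      ∑ i, EuclideanSpace.proj (𝕜 := ℝ) i
        ((M.pathScore n z θ) i • M.score θ (z n).1 (z n).2) := by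
    intro z
    simp [PiLp.inner_apply, mul_comm]
  simp only [e]
  rw [integral_finsetSum _ fun i _ => (EuclideanSpace.proj (𝕜 := ℝ) i).integrable_comp (hint i)]
  refine Finset.sum_eq_zero fun i _ => ?_
  rw [ContinuousLinearMap.integral_comp_comm _ (hint i), hz i, map_zero]

/-- The cross terms vanish, so the second moments add up linearly in n. -/
lemma integral_norm_sq_pathScore_le (hM : M.Regular lμ Mg Mh) (n : ℕ) (θ : E d) :
    ∫ z, ‖M.pathScore n z θ‖ ^ 2 ∂M.pathLaw θ ≤ n * Mg ^ 2 := by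
  induction n with
  | zero => simp [pathScore]
  | succ n ih =>
    have hS := measurable_pathScore hM n θ
    have hs := measurable_score_path hM n θ
    have i1 : Integrable (fun z => ‖M.pathScore n z θ‖ ^ 2) (M.pathLaw θ) := by
      refine M.integrable_path_of_bound (B := (n * Mg) ^ 2)
        (hS.norm.pow_const 2).aestronglyMeasurable fun z hz => ?_
      rw [Real.norm_of_nonneg (by positivity)]
      exact pow_le_pow_left₀ (norm_nonneg _) (norm_pathScore_le hM n hz θ) 2
    have i2 : Integrable (fun z => 2 * inner ℝ (M.pathScore n z θ) (M.score θ (z n).1 (z n).2))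
        (M.pathLaw θ) := by
      refine Integrable.const_mul (M.integrable_path_of_bound (B := n * Mg * Mg)
        (hS.inner hs).aestronglyMeasurable fun z hz => ?_) 2
      have h1 := norm_pathScore_le hM n hz θ
      exact (norm_inner_le_norm _ _).trans (mul_le_mul h1 (hM.norm_score_le _ _ _ (hz n))
        (norm_nonneg _) ((norm_nonneg _).trans h1))
    have hb : ∀ z : ℕ → E p × E q, (∀ t, (z t).2 ∈ M.actions) →
        ‖M.score θ (z n).1 (z n).2‖ ^ 2 ≤ Mg ^ 2 := fun z hz =>
      pow_le_pow_left₀ (norm_nonneg _) (hM.norm_score_le _ _ _ (hz n)) 2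
    have i3 : Integrable (fun z => ‖M.score θ (z n).1 (z n).2‖ ^ 2) (M.pathLaw θ) := by
      refine M.integrable_path_of_bound (B := Mg ^ 2)
        (hs.norm.pow_const 2).aestronglyMeasurable fun z hz => ?_
      rw [Real.norm_of_nonneg (by positivity)]
      exact hb z hz
    have e : ∀ z : ℕ → E p × E q, ‖M.pathScore (n + 1) z θ‖ ^ 2 = (‖M.pathScore n z θ‖ ^ 2 +
        2 * inner ℝ (M.pathScore n z θ) (M.score θ (z n).1 (z n).2)) +
          ‖M.score θ (z n).1 (z n).2‖ ^ 2 := by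
      intro z
      rw [pathScore, Finset.sum_range_succ, norm_add_sq_real]; rfl
    simp only [e]
    rw [integral_add (i1.fun_add i2) i3, integral_add i1 i2, integral_const_mul,
      integral_inner_pathScore_score hM n θ]
    have h3 : ∫ z, ‖M.score θ (z n).1 (z n).2‖ ^ 2 ∂M.pathLaw θ ≤ Mg ^ 2 := by
      refine (integral_mono_ae i3 (integrable_const (Mg ^ 2))
        ((M.ae_pathLaw_mem θ).mono hb)).trans ?_
      simp
    push_cast
    linarith

end Score

end Problem

/-! ### Geometric sums -/

section Geometric

variable {γ : ℝ}

lemma hasSum_of_eq {f g : ℕ → ℝ} {a b : ℝ} (h : HasSum f a) (hf : ∀ n, g n = f n) (ha : b = a) :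
    HasSum g b := by
  rw [ha, funext hf]
  exact h

lemma hasSum_geometric_mul_succ (h0 : 0 ≤ γ) (h1 : γ < 1) :
    HasSum (fun h : ℕ => γ ^ h * ((h : ℝ) + 1)) (1 / (1 - γ) ^ 2) := by
  refine hasSum_of_eq (hasSum_choose_mul_geometric_of_norm_lt_one 1
    (r := γ) (by rwa [Real.norm_of_nonneg h0])) (fun n => ?_) rfl
  simp [mul_comm]

lemma hasSum_geometric_mul_succ_mul (h0 : 0 ≤ γ) (h1 : γ < 1) :
    HasSum (fun h : ℕ => γ ^ h * (((h : ℝ) + 1) * (h + 2))) (2 / (1 - γ) ^ 3) := by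
  refine hasSum_of_eq ((hasSum_choose_mul_geometric_of_norm_lt_one 2
    (r := γ) (by rwa [Real.norm_of_nonneg h0])).mul_left 2) (fun n => ?_) (by ring)
  · rw [Nat.cast_choose_two]
    push_cast
    ring

lemma sum_geometric_mul_succ_le (h0 : 0 ≤ γ) (h1 : γ < 1) (s : Finset ℕ) :
    ∑ h ∈ s, γ ^ h * ((h : ℝ) + 1) ≤ 1 / (1 - γ) ^ 2 :=
  sum_le_hasSum s (fun _ _ => by positivity) (hasSum_geometric_mul_succ h0 h1)

lemma sum_geometric_le (h0 : 0 ≤ γ) (h1 : γ < 1) (s : Finset ℕ) :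
    ∑ h ∈ s, γ ^ h ≤ (1 - γ)⁻¹ :=
  sum_le_hasSum s (fun _ _ => by positivity) (hasSum_geometric_of_lt_one h0 h1)

lemma sqrt_add_le {a b : ℝ} (ha : 0 ≤ a) (hb : 0 ≤ b) :
    Real.sqrt (a + b) ≤ Real.sqrt a + Real.sqrt b := by
  refine Real.sqrt_le_iff.2 ⟨by positivity, ?_⟩
  nlinarith [Real.sq_sqrt ha, Real.sq_sqrt hb, Real.sqrt_nonneg a, Real.sqrt_nonneg b,
    mul_nonneg (Real.sqrt_nonneg a) (Real.sqrt_nonneg b)]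

/-- Arithmetic-geometric mean inequality with a free parameter. Taking c = √(1 - γ) replaces the
series of γ^h √(h + 1) by summable closed forms of the right order (1 - γ)^(-3/2). -/
lemma sqrt_le_half_add {a c : ℝ} (hc : 0 < c) (ha : 0 ≤ a) :
    Real.sqrt a ≤ (c * a + 1 / c) / 2 := by
  have h := Real.sq_sqrt ha
  have h2 : c * a + 1 / c - 2 * Real.sqrt a = (c * Real.sqrt a - 1) ^ 2 / c := by
    field_simp
    nlinarith
  have h3 : 0 ≤ (c * Real.sqrt a - 1) ^ 2 / c := by positivity
  linarith

/-- An upper bound, with sum `1 / s ^ 3`, for the series `∑ γ ^ h * √(h + 1)`; here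
`1 - γ = s ^ 2`. -/
lemma hasSum_geometric_sqrt_bound {s : ℝ} (hs : 0 < s) (h0 : 0 ≤ γ) (h1 : 1 - γ = s ^ 2) :
    HasSum (fun h : ℕ => γ ^ h * ((s * ((h : ℝ) + 1) + 1 / s) / 2)) (1 / s ^ 3) := by
  have hγ : γ < 1 := by nlinarith [pow_pos hs 2]
  have h := ((hasSum_geometric_mul_succ h0 hγ).mul_left (s / 2)).add
    ((hasSum_geometric_of_lt_one h0 hγ).mul_left (1 / (2 * s)))
  rw [h1] at h
  refine hasSum_of_eq h (fun n => ?_) ?_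
  · field_simp
  · field_simp; norm_num

lemma constV_eq {R Mg s : ℝ} (hs : 0 < s) (h1 : 1 - γ = s ^ 2) :
    constV γ R Mg = Mg * R / s ^ 3 := by
  unfold constV
  rw [h1, ← Real.rpow_natCast s 2, ← Real.rpow_mul hs.le]
  norm_num

end Geometric

lemma integral_le_sqrt_integral_sq {Ω : Type*} [MeasurableSpace Ω] {P : Measure Ω}
    [IsProbabilityMeasure P] {X : Ω → ℝ} (hX : MemLp X 2 P) :
    ∫ ω, X ω ∂P ≤ Real.sqrt (∫ ω, X ω ^ 2 ∂P) := by
  have h := variance_nonneg X P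
  rw [variance_eq_sub hX] at h
  exact Real.le_sqrt_of_sq_le (by simpa using h)

namespace Problem

/-! ### The expected return and its gradient -/

section Return

variable {p q d : ℕ} {M : Problem p q d} {lμ Mg Mh R γ : ℝ}

lemma rewardBound_nonneg (hR : M.RewardBound R) : 0 ≤ R := by
  obtain ⟨a, ha⟩ := nonempty_of_measure_ne_zero M.volume_actions_pos.ne'
  exact (abs_nonneg _).trans (hR 0 a ha)

/-- The expected reward in step `h`. -/
noncomputable def stepReward (M : Problem p q d) (h : ℕ) (θ : E d) : ℝ :=
  ∫ z, M.reward (z h) ∂M.pathLaw θ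

/-- The gradient of the expected reward in step `h`. -/
noncomputable def stepGrad (M : Problem p q d) (h : ℕ) (θ : E d) : E d :=
  ∫ z, M.reward (z h) • M.pathScore (h + 1) z θ ∂M.pathLaw θ

lemma measurable_reward_path (M : Problem p q d) (h : ℕ) :
    Measurable (fun z : ℕ → E p × E q => M.reward (z h)) :=
  M.measurable_reward.comp (measurable_pi_apply h)

lemma measurable_reward_last (M : Problem p q d) (h : ℕ) :
    Measurable (fun τ : Traj p q (h + 1) => M.reward (τ (Fin.last h))) :=
  M.measurable_reward.comp (measurable_pi_apply _)

lemma abs_reward_le (hR : M.RewardBound R) {x : E p × E q} (hx : x.2 ∈ M.actions) :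
    |M.reward x| ≤ R := hR x.1 x.2 hx

lemma stepReward_eq (M : Problem p q d) (h : ℕ) (θ : E d) :
    M.stepReward h θ = ∫ τ, M.reward (τ (Fin.last h)) ∂M.trajLaw (h + 1) θ := by
  rw [M.integral_trajLaw θ (M.measurable_reward_last h).aestronglyMeasurable]
  rfl

lemma stepGrad_eq (hM : M.Regular lμ Mg Mh) (h : ℕ) (θ : E d) :
    M.stepGrad h θ =
      ∫ τ, M.reward (τ (Fin.last h)) • M.scoreSum τ θ ∂M.trajLaw (h + 1) θ := by
  rw [M.integral_trajLaw θ ((M.measurable_reward_last h).fun_smul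
    (measurable_scoreSum hM θ)).aestronglyMeasurable]
  simp only [scoreSum_restrict]
  rfl

lemma hasGradientAt_stepReward (hM : M.Regular lμ Mg Mh) (hR : M.RewardBound R) (h : ℕ)
    (θ : E d) : HasGradientAt (M.stepReward h) (M.stepGrad h θ) θ := by
  have e : M.stepReward h =
      fun θ => ∫ τ, M.reward (τ (Fin.last h)) ∂M.trajLaw (h + 1) θ :=
    funext fun θ => M.stepReward_eq h θ
  rw [e, stepGrad_eq hM]
  exact hasGradientAt_expectation hM (M.measurable_reward_last h)
    (fun τ hτ => abs_reward_le hR (hτ _)) θ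

lemma norm_stepGrad_sub_le (hM : M.Regular lμ Mg Mh) (hMg : 0 ≤ Mg) (hR : M.RewardBound R) (h : ℕ)
    (θ θ' : E d) :
    ‖M.stepGrad h θ - M.stepGrad h θ'‖ ≤
      R * (2 * ((h : ℝ) + 1) ^ 2 * Mg ^ 2 + ((h : ℝ) + 1) * Mh) * ‖θ - θ'‖ := by
  rw [stepGrad_eq hM, stepGrad_eq hM]
  have := norm_gradient_expectation_sub_le hM hMg (M.measurable_reward_last h)
    (rewardBound_nonneg hR) (fun τ hτ => abs_reward_le hR (hτ _)) θ θ'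
  push_cast at this
  exact this

lemma integrable_norm_sq_pathScore (hM : M.Regular lμ Mg Mh) (n : ℕ) (θ : E d) :
    Integrable (fun z => ‖M.pathScore n z θ‖ ^ 2) (M.pathLaw θ) := by
  refine M.integrable_path_of_bound (B := (n * Mg) ^ 2)
    ((measurable_pathScore hM n θ).norm.pow_const 2).aestronglyMeasurable fun z hz => ?_
  rw [Real.norm_of_nonneg (by positivity)]
  exact pow_le_pow_left₀ (norm_nonneg _) (norm_pathScore_le hM n hz θ) 2

lemma integral_norm_pathScore_le (hM : M.Regular lμ Mg Mh) (hMg : 0 ≤ Mg) (n : ℕ) (θ : E d) :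
    ∫ z, ‖M.pathScore n z θ‖ ∂M.pathLaw θ ≤ Mg * Real.sqrt n := by
  have hm : MemLp (fun z => ‖M.pathScore n z θ‖) 2 (M.pathLaw θ) :=
    (memLp_two_iff_integrable_sq (measurable_pathScore hM n θ).norm.aestronglyMeasurable).2
      (integrable_norm_sq_pathScore hM n θ)
  refine (integral_le_sqrt_integral_sq hm).trans ?_
  refine (Real.sqrt_le_sqrt (integral_norm_sq_pathScore_le hM n θ)).trans ?_
  rw [Real.sqrt_mul (Nat.cast_nonneg _), Real.sqrt_sq hMg, mul_comm]

lemma integrable_norm_pathScore (hM : M.Regular lμ Mg Mh) (n : ℕ) (θ : E d) :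
    Integrable (fun z => ‖M.pathScore n z θ‖) (M.pathLaw θ) :=
  M.integrable_path_of_bound (B := n * Mg)
    (measurable_pathScore hM n θ).norm.aestronglyMeasurable fun z hz => by
      rw [norm_norm]; exact norm_pathScore_le hM n hz θ

lemma integrable_reward_smul_pathScore (hM : M.Regular lμ Mg Mh) (hR : M.RewardBound R)
    (h : ℕ) (θ : E d) :
    Integrable (fun z => M.reward (z h) • M.pathScore (h + 1) z θ) (M.pathLaw θ) :=
  M.integrable_path_of_bound (B := R * ((h + 1 : ℕ) * Mg))
    ((M.measurable_reward_path h).smul (measurable_pathScore hM _ θ)).aestronglyMeasurable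
    fun z hz => by
      rw [norm_smul]
      exact mul_le_mul (abs_reward_le hR (hz h)) (norm_pathScore_le hM _ hz θ) (norm_nonneg _)
        (rewardBound_nonneg hR)

lemma norm_stepGrad_le (hM : M.Regular lμ Mg Mh) (hMg : 0 ≤ Mg) (hR : M.RewardBound R) (h : ℕ)
    (θ : E d) : ‖M.stepGrad h θ‖ ≤ R * (Mg * Real.sqrt ((h : ℝ) + 1)) := by
  have hb : ∀ᵐ z ∂M.pathLaw θ, ‖M.reward (z h) • M.pathScore (h + 1) z θ‖ ≤
      R * ‖M.pathScore (h + 1) z θ‖ := by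
    filter_upwards [M.ae_pathLaw_mem θ] with z hz
    rw [norm_smul]
    exact mul_le_mul_of_nonneg_right (abs_reward_le hR (hz h)) (norm_nonneg _)
  refine (norm_integral_le_of_norm_le ((integrable_norm_pathScore hM _ θ).const_mul R) hb).trans ?_
  rw [integral_const_mul]
  refine mul_le_mul_of_nonneg_left ?_ (rewardBound_nonneg hR)
  have := integral_norm_pathScore_le hM hMg (h + 1) θ
  push_cast at this
  exact this

lemma integrable_reward_path (hR : M.RewardBound R) (h : ℕ) (θ : E d) :
    Integrable (fun z => M.reward (z h)) (M.pathLaw θ) :=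
  M.integrable_path_of_bound (M.measurable_reward_path h).aestronglyMeasurable
    fun _ hz => abs_reward_le hR (hz h)

lemma integral_abs_reward_le (hR : M.RewardBound R) (h : ℕ) (θ : E d) :
    ∫ z, |M.reward (z h)| ∂M.pathLaw θ ≤ R := by
  refine (integral_mono_ae (integrable_reward_path hR h θ).abs (integrable_const R)
    ((M.ae_pathLaw_mem θ).mono fun z hz => abs_reward_le hR (hz h))).trans ?_
  simp

lemma abs_stepReward_le (hR : M.RewardBound R) (h : ℕ) (θ : E d) : |M.stepReward h θ| ≤ R :=
  (abs_integral_le_integral_abs).trans (integral_abs_reward_le hR h θ)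

lemma hasSum_J (hR : M.RewardBound R) (h0 : 0 ≤ γ) (h1 : γ < 1) (θ : E d) :
    HasSum (fun h => γ ^ h * M.stepReward h θ) (M.J γ θ) := by
  have h := hasSum_integral_of_summable_integral_norm (μ := M.pathLaw θ)
    (F := fun (t : ℕ) (z : ℕ → E p × E q) => γ ^ t * M.reward (z t))
    (fun t => (integrable_reward_path hR t θ).const_mul _) ?_
  · simp only [integral_const_mul] at h
    exact h
  · refine Summable.of_nonneg_of_le (fun t => integral_nonneg fun z => norm_nonneg _) (fun t => ?_)
      ((summable_geometric_of_lt_one h0 h1).mul_right R)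
    simp only [norm_mul, integral_const_mul, Real.norm_eq_abs]
    rw [abs_of_nonneg (pow_nonneg h0 t)]
    exact mul_le_mul_of_nonneg_left (integral_abs_reward_le hR t θ) (pow_nonneg h0 t)

lemma abs_J_le (hR : M.RewardBound R) (h0 : 0 ≤ γ) (h1 : γ < 1) (θ : E d) :
    |M.J γ θ| ≤ R / (1 - γ) := by
  rw [← (hasSum_J hR h0 h1 θ).tsum_eq, div_eq_inv_mul, ← Real.norm_eq_abs]
  refine tsum_of_norm_bounded ((hasSum_geometric_of_lt_one h0 h1).mul_right R) fun h => ?_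
  rw [norm_mul, Real.norm_of_nonneg (pow_nonneg h0 h)]
  exact mul_le_mul_of_nonneg_left (abs_stepReward_le hR h θ) (pow_nonneg h0 h)

lemma bddAbove_range_J (hR : M.RewardBound R) (h0 : 0 ≤ γ) (h1 : γ < 1) :
    BddAbove (Set.range (M.J γ)) :=
  ⟨R / (1 - γ), by rintro _ ⟨θ, rfl⟩; exact (le_abs_self _).trans (abs_J_le hR h0 h1 θ)⟩

/-- The gradient of the expected return. -/
noncomputable def gradJ (M : Problem p q d) (γ : ℝ) (θ : E d) : E d :=
  ∑' h : ℕ, γ ^ h • M.stepGrad h θ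

/-- The gradient of the expected return truncated after `H` steps. -/
noncomputable def gradJTrunc (M : Problem p q d) (γ : ℝ) (H : ℕ) (θ : E d) : E d :=
  ∑ h ∈ Finset.range H, γ ^ h • M.stepGrad h θ

lemma norm_pow_smul_stepGrad_le (hM : M.Regular lμ Mg Mh) (hMg : 0 ≤ Mg) (hR : M.RewardBound R)
    (h0 : 0 ≤ γ) {s : ℝ} (hs : 0 < s) (h : ℕ) (θ : E d) :
    ‖γ ^ h • M.stepGrad h θ‖ ≤ R * Mg * (γ ^ h * ((s * ((h : ℝ) + 1) + 1 / s) / 2)) := by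
  rw [norm_smul, Real.norm_of_nonneg (pow_nonneg h0 h)]
  have h2 := sqrt_le_half_add (a := (h : ℝ) + 1) hs (by positivity)
  have hR0 := rewardBound_nonneg hR
  calc γ ^ h * ‖M.stepGrad h θ‖ ≤ γ ^ h * (R * (Mg * ((s * ((h : ℝ) + 1) + 1 / s) / 2))) := by
        have := norm_stepGrad_le hM hMg hR h θ
        gcongr
        exact this.trans (by gcongr)
    _ = _ := by ring

lemma summable_stepGrad (hM : M.Regular lμ Mg Mh) (hMg : 0 ≤ Mg) (hR : M.RewardBound R)
    (h0 : 0 ≤ γ) {s : ℝ} (hs : 0 < s) (h1 : 1 - γ = s ^ 2) (θ : E d) :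
    Summable (fun h => γ ^ h • M.stepGrad h θ) :=
  Summable.of_norm_bounded ((hasSum_geometric_sqrt_bound hs h0 h1).summable.mul_left (R * Mg))
    fun h => norm_pow_smul_stepGrad_le hM hMg hR h0 hs h θ

lemma exists_sq_eq_one_sub (h1 : γ < 1) : ∃ s : ℝ, 0 < s ∧ 1 - γ = s ^ 2 :=
  ⟨Real.sqrt (1 - γ), Real.sqrt_pos.2 (by linarith), (Real.sq_sqrt (by linarith)).symm⟩

/-- The gradients of the expected step rewards have a bound uniform in θ and summable against γ^h,
so the series may be differentiated termwise. -/
lemma hasGradientAt_J (hM : M.Regular lμ Mg Mh) (hMg : 0 ≤ Mg) (hR : M.RewardBound R)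
    (h0 : 0 ≤ γ) (h1 : γ < 1) (θ : E d) : HasGradientAt (M.J γ) (M.gradJ γ θ) θ := by
  obtain ⟨s, hs, hγs⟩ := exists_sq_eq_one_sub h1
  rw [hasGradientAt_iff_hasFDerivAt]
  have e : M.J γ = fun θ => ∑' h : ℕ, γ ^ h * M.stepReward h θ :=
    funext fun θ => (hasSum_J hR h0 h1 θ).tsum_eq.symm
  have key := hasFDerivAt_tsum (𝕜 := ℝ)
    (f := fun (h : ℕ) θ => γ ^ h * M.stepReward h θ)
    (f' := fun (h : ℕ) θ => InnerProductSpace.toDual ℝ (E d) (γ ^ h • M.stepGrad h θ))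
    ((hasSum_geometric_sqrt_bound hs h0 hγs).summable.mul_left (R * Mg))
    (fun h θ => ?_) (fun h θ => ?_) (hasSum_J hR h0 h1 θ).summable θ
  · rw [e, gradJ, ((summable_stepGrad hM hMg hR h0 hs hγs θ).hasSum.map
      (InnerProductSpace.toDual ℝ (E d)) (LinearIsometryEquiv.continuous _)).tsum_eq.symm]
    exact key
  · rw [map_smul]
    exact (hasGradientAt_stepReward hM hR h θ).hasFDerivAt.const_mul (γ ^ h)
  · rw [LinearIsometryEquiv.norm_map]
    exact norm_pow_smul_stepGrad_le hM hMg hR h0 hs h θ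

lemma gradient_J (hM : M.Regular lμ Mg Mh) (hMg : 0 ≤ Mg) (hR : M.RewardBound R)
    (h0 : 0 ≤ γ) (h1 : γ < 1) (θ : E d) : gradient (M.J γ) θ = M.gradJ γ θ :=
  (hasGradientAt_J hM hMg hR h0 h1 θ).gradient

lemma norm_gradJ_le (hM : M.Regular lμ Mg Mh) (hMg : 0 ≤ Mg) (hR : M.RewardBound R)
    (h0 : 0 ≤ γ) (h1 : γ < 1) (θ : E d) : ‖M.gradJ γ θ‖ ≤ constV γ R Mg := by
  obtain ⟨s, hs, hγs⟩ := exists_sq_eq_one_sub h1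
  refine (tsum_of_norm_bounded ((hasSum_geometric_sqrt_bound hs h0 hγs).mul_left (R * Mg))
    fun h => norm_pow_smul_stepGrad_le hM hMg hR h0 hs h θ).trans ?_
  rw [constV_eq hs hγs]
  apply le_of_eq; ring

/-- The Lipschitz constant of step h grows like (h + 1)², which is enlarged to (h + 1)(h + 2) for a
closed sum. This gives 4 Mg² R/(1-γ)³ + Mh R/(1-γ)², at most twice `constLg`. -/
lemma norm_gradJ_sub_le (hM : M.Regular lμ Mg Mh) (hMg : 0 ≤ Mg) (hR : M.RewardBound R)
    (hMh : 0 ≤ Mh) (h0 : 0 ≤ γ) (h1 : γ < 1) (θ θ' : E d) :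
    ‖M.gradJ γ θ - M.gradJ γ θ'‖ ≤ 2 * constLg γ R Mg Mh * ‖θ - θ'‖ := by
  obtain ⟨s, hs, hγs⟩ := exists_sq_eq_one_sub h1
  have hR0 := rewardBound_nonneg hR
  have hsum := fun θ => summable_stepGrad hM hMg hR h0 hs hγs θ
  rw [gradJ, gradJ, ← (hsum θ).tsum_sub (hsum θ')]
  have hS := (((hasSum_geometric_mul_succ_mul h0 h1).mul_left (2 * R * Mg ^ 2)).add
    ((hasSum_geometric_mul_succ h0 h1).mul_left (R * Mh))).mul_right ‖θ - θ'‖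
  refine (tsum_of_norm_bounded hS fun h => ?_).trans ?_
  · rw [← smul_sub, norm_smul, Real.norm_of_nonneg (pow_nonneg h0 h)]
    calc γ ^ h * ‖M.stepGrad h θ - M.stepGrad h θ'‖
        ≤ γ ^ h * (R * (2 * ((h : ℝ) + 1) ^ 2 * Mg ^ 2 + ((h : ℝ) + 1) * Mh) * ‖θ - θ'‖) :=
          mul_le_mul_of_nonneg_left (norm_stepGrad_sub_le hM hMg hR h θ θ') (pow_nonneg h0 h)
      _ ≤ γ ^ h * (R * (2 * (((h : ℝ) + 1) * (h + 2)) * Mg ^ 2 + ((h : ℝ) + 1) * Mh) *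
            ‖θ - θ'‖) := by
          gcongr
          nlinarith [(Nat.cast_nonneg h : (0 : ℝ) ≤ h)]
      _ = _ := by ring
  · refine mul_le_mul_of_nonneg_right ?_ (norm_nonneg _)
    unfold constLg
    have h2 : 0 ≤ Mh * R / (1 - γ) ^ 2 := by positivity
    have e1 : 2 * R * Mg ^ 2 * (2 / (1 - γ) ^ 3) = 2 * (2 * Mg ^ 2 * R / (1 - γ) ^ 3) := by ring
    have e2 : R * Mh * (1 / (1 - γ) ^ 2) = Mh * R / (1 - γ) ^ 2 := by ring
    rw [e1, e2]
    linarith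

lemma constLg_nonneg (hR : 0 ≤ R) (hMh : 0 ≤ Mh) (h1 : γ < 1) : 0 ≤ constLg γ R Mg Mh := by
  have : 0 < 1 - γ := by linarith
  unfold constLg; positivity

lemma constG_nonneg (hR : 0 ≤ R) (hMg : 0 ≤ Mg) : 0 ≤ constG γ R Mg := by
  unfold constG; positivity

lemma constV_nonneg (hR : 0 ≤ R) (hMg : 0 ≤ Mg) (h1 : γ < 1) : 0 ≤ constV γ R Mg := by
  have : 0 < 1 - γ := by linarith
  unfold constV; positivity

/-- Quadratic lower bound for the expected return. -/
lemma J_lower_bound (hM : M.Regular lμ Mg Mh) (hMg : 0 ≤ Mg) (hR : M.RewardBound R)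
    (hMh : 0 ≤ Mh) (h0 : 0 ≤ γ) (h1 : γ < 1) (θ θ' : E d) :
    M.J γ θ + inner ℝ (M.gradJ γ θ) (θ' - θ) - 2 * constLg γ R Mg Mh * ‖θ' - θ‖ ^ 2 ≤
      M.J γ θ' := by
  have hL := constLg_nonneg (Mg := Mg) (rewardBound_nonneg hR) hMh h1
  -- The mean value inequality on the segment replaces the integral form of Taylor's theorem and
  -- gives up its factor 1/2.
  have key := Convex.norm_image_sub_le_of_norm_hasFDerivWithin_le' (𝕜 := ℝ) (f := M.J γ)
    (f' := fun x => InnerProductSpace.toDual ℝ (E d) (M.gradJ γ x))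
    (φ := InnerProductSpace.toDual ℝ (E d) (M.gradJ γ θ)) (s := segment ℝ θ θ')
    (C := 2 * constLg γ R Mg Mh * ‖θ' - θ‖)
    (fun x _ => (hasGradientAt_J hM hMg hR h0 h1 x).hasFDerivAt.hasFDerivWithinAt)
    (fun x hx => ?_) (convex_segment _ _) (left_mem_segment ℝ θ θ') (right_mem_segment ℝ θ θ')
  · have h2 := (abs_le.1 key).1
    rw [InnerProductSpace.toDual_apply_apply] at h2
    nlinarith
  · rw [← map_sub, LinearIsometryEquiv.norm_map]
    refine (norm_gradJ_sub_le hM hMg hR hMh h0 h1 x θ).trans ?_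
    have : ‖x - θ‖ ≤ ‖θ' - θ‖ := by
      rw [segment_eq_image'] at hx
      obtain ⟨t, ht, rfl⟩ := hx
      rw [add_sub_cancel_left, norm_smul, Real.norm_of_nonneg ht.1]
      exact mul_le_of_le_one_left (norm_nonneg _) ht.2
    gcongr

/-- In the tail, √(k + H + 1) ≤ √H + √(k + 1) separates the offset H from the series that already
gave V. -/
lemma norm_gradJ_sub_gradJTrunc_le (hM : M.Regular lμ Mg Mh) (hMg : 0 ≤ Mg)
    (hR : M.RewardBound R) (h0 : 0 ≤ γ) (h1 : γ < 1) (H : ℕ) (θ : E d) :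
    ‖M.gradJ γ θ - M.gradJTrunc γ H θ‖ ≤
      constV γ R Mg * (γ ^ H * (Real.sqrt ((1 - γ) * H) + 1)) := by
  obtain ⟨s, hs, hγs⟩ := exists_sq_eq_one_sub h1
  have hR0 := rewardBound_nonneg hR
  have hsum := summable_stepGrad hM hMg hR h0 hs hγs θ
  rw [gradJ, ← hsum.sum_add_tsum_nat_add H, gradJTrunc, add_sub_cancel_left]
  have hS := (((hasSum_geometric_of_lt_one h0 h1).mul_left (Real.sqrt H)).add
    (hasSum_geometric_sqrt_bound hs h0 hγs)).mul_left (R * Mg * γ ^ H)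
  refine (tsum_of_norm_bounded hS fun k => ?_).trans ?_
  · rw [norm_smul, Real.norm_of_nonneg (pow_nonneg h0 _)]
    have h2 := norm_stepGrad_le hM hMg hR (k + H) θ
    have h3 : Real.sqrt (((k + H : ℕ) : ℝ) + 1) ≤
        Real.sqrt H + (s * ((k : ℝ) + 1) + 1 / s) / 2 := by
      have h4 := sqrt_le_half_add (a := (k : ℝ) + 1) hs (by positivity)
      have e : ((k + H : ℕ) : ℝ) + 1 = (H : ℝ) + ((k : ℝ) + 1) := by push_cast; ring
      rw [e]
      exact (sqrt_add_le (Nat.cast_nonneg _) (by positivity)).trans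
        (add_le_add_right h4 _)
    calc γ ^ (k + H) * ‖M.stepGrad (k + H) θ‖
        ≤ γ ^ (k + H) * (R * (Mg * (Real.sqrt H + (s * ((k : ℝ) + 1) + 1 / s) / 2))) := by
          refine mul_le_mul_of_nonneg_left (h2.trans ?_) (pow_nonneg h0 _)
          gcongr
      _ = _ := by rw [pow_add]; ring
  · rw [constV_eq hs hγs, hγs, Real.sqrt_mul (by positivity), Real.sqrt_sq hs.le]
    apply le_of_eq
    field_simp

/-! ### The gradient estimate -/

/-- Summing by reward instead of by score: the reward of step h meets the scores of steps 0, …, h,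
which is the form of `stepGrad`. Unbiasedness for the truncated gradient and all bounds on the
estimate start from here. -/
lemma gradEst_eq (M : Problem p q d) {H : ℕ} (τ : Traj p q H) (θ : E d) :
    M.gradEst γ τ θ = ∑ h : Fin H, (γ ^ (h : ℕ) * M.reward (τ h)) •
      ∑ t ∈ Finset.Iic h, M.score θ (τ t).1 (τ t).2 := by
  simp only [gradEst, Finset.sum_smul, Finset.smul_sum]
  exact Finset.sum_comm' fun x y => by simp

lemma gradEst_restrict (M : Problem p q d) (H : ℕ) (z : ℕ → E p × E q) (θ : E d) :
    M.gradEst γ (fun h : Fin H => z h) θ =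
      ∑ h ∈ Finset.range H, γ ^ h • M.reward (z h) • M.pathScore (h + 1) z θ := by
  rw [gradEst_eq, Finset.sum_range]
  refine Finset.sum_congr rfl fun h _ => ?_
  rw [pathScore, Nat.range_succ_eq_Iic, ← Fin.map_valEmbedding_Iic, Finset.sum_map, smul_smul]
  rfl

lemma measurable_gradEst_joint (hM : M.Regular lμ Mg Mh) {H : ℕ} :
    Measurable (fun y : Traj p q H × E d => M.gradEst γ y.1 y.2) := by
  refine Finset.measurable_fun_sum _ fun t _ => Measurable.fun_smul ?_ ?_
  · refine Finset.measurable_fun_sum _ fun h _ => Measurable.const_mul ?_ _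
    exact M.measurable_reward.comp ((measurable_pi_apply h).comp measurable_fst)
  · exact (measurable_score_joint hM).comp
      (g := fun x : E d × E p × E q => M.score x.1 x.2.1 x.2.2)
      (f := fun y : Traj p q H × E d => (y.2, y.1 t)) (by fun_prop)

lemma measurable_gradEst (hM : M.Regular lμ Mg Mh) {H : ℕ} (θ : E d) :
    Measurable (fun τ : Traj p q H => M.gradEst γ τ θ) :=
  (measurable_gradEst_joint hM).comp (g := fun y : Traj p q H × E d => M.gradEst γ y.1 y.2)
    (f := fun τ => (τ, θ)) (by fun_prop)

/-- Stated for arbitrary vectors `v` so that it serves both the scores (size of the estimate) and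
their differences (Lipschitz bound). -/
lemma norm_discounted_sum_le (hR : M.RewardBound R) (h0 : 0 ≤ γ) (h1 : γ < 1) {H : ℕ}
    {τ : Traj p q H} (hτ : M.Admissible τ) {v : Fin H → E d} {B : ℝ} (hB : ∀ t, ‖v t‖ ≤ B)
    (hB0 : 0 ≤ B) :
    ‖∑ h : Fin H, (γ ^ (h : ℕ) * M.reward (τ h)) • ∑ t ∈ Finset.Iic h, v t‖ ≤
      B * R / (1 - γ) ^ 2 := by
  have hR0 := rewardBound_nonneg hR
  have hterm : ∀ h : Fin H, ‖(γ ^ (h : ℕ) * M.reward (τ h)) • ∑ t ∈ Finset.Iic h, v t‖ ≤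
      B * R * (γ ^ (h : ℕ) * ((h : ℝ) + 1)) := by
    intro h
    have h2 : ‖∑ t ∈ Finset.Iic h, v t‖ ≤ ((h : ℝ) + 1) * B := by
      refine (norm_sum_le _ _).trans ((Finset.sum_le_sum fun t _ => hB t).trans ?_)
      simp
    rw [norm_smul, norm_mul, Real.norm_of_nonneg (pow_nonneg h0 _)]
    calc γ ^ (h : ℕ) * ‖M.reward (τ h)‖ * ‖∑ t ∈ Finset.Iic h, v t‖
        ≤ γ ^ (h : ℕ) * R * (((h : ℝ) + 1) * B) := by
          have := abs_reward_le hR (hτ h)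
          rw [Real.norm_eq_abs]
          gcongr
      _ = _ := by ring
  refine (norm_sum_le _ _).trans ((Finset.sum_le_sum fun h _ => hterm h).trans ?_)
  rw [← Finset.mul_sum, ← Finset.sum_range fun h : ℕ => γ ^ h * ((h : ℝ) + 1), ← mul_one_div]
  exact mul_le_mul_of_nonneg_left (sum_geometric_mul_succ_le h0 h1 _) (by positivity)

lemma norm_gradEst_le (hM : M.Regular lμ Mg Mh) (hMg : 0 ≤ Mg) (hR : M.RewardBound R)
    (h0 : 0 ≤ γ) (h1 : γ < 1) {H : ℕ} {τ : Traj p q H} (hτ : M.Admissible τ) (θ : E d) :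
    ‖M.gradEst γ τ θ‖ ≤ constG γ R Mg := by
  rw [gradEst_eq]
  exact norm_discounted_sum_le hR h0 h1 hτ (fun t => hM.norm_score_le _ _ _ (hτ t)) hMg

lemma norm_gradEst_sub_le (hM : M.Regular lμ Mg Mh) (hMh : 0 ≤ Mh) (hR : M.RewardBound R)
    (h0 : 0 ≤ γ) (h1 : γ < 1) {H : ℕ} {τ : Traj p q H} (hτ : M.Admissible τ) (θ θ' : E d) :
    ‖M.gradEst γ τ θ - M.gradEst γ τ θ'‖ ≤ Mh * R / (1 - γ) ^ 2 * ‖θ - θ'‖ := by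
  rw [gradEst_eq, gradEst_eq, ← Finset.sum_sub_distrib]
  simp only [← smul_sub, ← Finset.sum_sub_distrib]
  refine (norm_discounted_sum_le hR h0 h1 hτ
    (fun t => norm_score_sub_le hM _ (hτ t) θ' θ) (by positivity)).trans (le_of_eq ?_)
  ring

lemma integral_gradEst (hM : M.Regular lμ Mg Mh) (hR : M.RewardBound R) (H : ℕ) (θ : E d) :
    ∫ τ, M.gradEst γ τ θ ∂M.trajLaw H θ = M.gradJTrunc γ H θ := by
  rw [M.integral_trajLaw θ (measurable_gradEst hM θ).aestronglyMeasurable]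
  simp only [gradEst_restrict]
  rw [integral_finsetSum _ fun h _ => (integrable_reward_smul_pathScore hM hR h θ).fun_smul (γ ^ h)]
  simp only [integral_smul]
  rfl

/-- Cauchy–Schwarz with weights γ^h costs 1/(1-γ), and the linear growth of the score moments costs
1/(1-γ)². Their product gives V², whereas the pointwise bound would only give G². -/
lemma integral_norm_sq_gradEst_le (hM : M.Regular lμ Mg Mh) (hR : M.RewardBound R)
    (h0 : 0 ≤ γ) (h1 : γ < 1) (H : ℕ) (θ : E d) :
    ∫ τ, ‖M.gradEst γ τ θ‖ ^ 2 ∂M.trajLaw H θ ≤ constV γ R Mg ^ 2 := by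
  have hR0 := rewardBound_nonneg hR
  have hγ : 0 < 1 - γ := by linarith
  rw [M.integral_trajLaw θ ((measurable_gradEst hM θ).norm.pow_const 2).aestronglyMeasurable]
  simp only [gradEst_restrict]
  have hi : Integrable (fun z => R ^ 2 * (1 - γ)⁻¹ *
      ∑ h ∈ Finset.range H, γ ^ h * ‖M.pathScore (h + 1) z θ‖ ^ 2) (M.pathLaw θ) :=
    (integrable_finsetSum _ fun h _ =>
      (integrable_norm_sq_pathScore hM (h + 1) θ).const_mul _).const_mul _
  have hb : ∀ᵐ z ∂M.pathLaw θ,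
      ‖∑ h ∈ Finset.range H, γ ^ h • M.reward (z h) • M.pathScore (h + 1) z θ‖ ^ 2 ≤
        R ^ 2 * (1 - γ)⁻¹ *
          ∑ h ∈ Finset.range H, γ ^ h * ‖M.pathScore (h + 1) z θ‖ ^ 2 := by
    filter_upwards [M.ae_pathLaw_mem θ] with z hz
    have h2 : ‖∑ h ∈ Finset.range H, γ ^ h • M.reward (z h) • M.pathScore (h + 1) z θ‖ ≤
        R * ∑ h ∈ Finset.range H, γ ^ h * ‖M.pathScore (h + 1) z θ‖ := by
      rw [Finset.mul_sum]
      refine (norm_sum_le _ _).trans (Finset.sum_le_sum fun h _ => ?_)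
      rw [norm_smul, norm_smul, Real.norm_of_nonneg (pow_nonneg h0 _), Real.norm_eq_abs]
      have := abs_reward_le hR (hz h)
      calc _ ≤ γ ^ h * (R * ‖M.pathScore (h + 1) z θ‖) := by gcongr
        _ = _ := by ring
    have h3 : (∑ h ∈ Finset.range H, γ ^ h * ‖M.pathScore (h + 1) z θ‖) ^ 2 ≤
        (∑ h ∈ Finset.range H, γ ^ h) *
          ∑ h ∈ Finset.range H, γ ^ h * ‖M.pathScore (h + 1) z θ‖ ^ 2 :=
      Finset.sum_sq_le_sum_mul_sum_of_sq_le_mul _ (fun h _ => pow_nonneg h0 h)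
        (fun h _ => by positivity) fun h _ => le_of_eq (by ring)
    calc _ ≤ (R * ∑ h ∈ Finset.range H, γ ^ h * ‖M.pathScore (h + 1) z θ‖) ^ 2 :=
          pow_le_pow_left₀ (norm_nonneg _) h2 2
      _ ≤ R ^ 2 * ((∑ h ∈ Finset.range H, γ ^ h) *
          ∑ h ∈ Finset.range H, γ ^ h * ‖M.pathScore (h + 1) z θ‖ ^ 2) := by
          rw [mul_pow]; gcongr
      _ ≤ R ^ 2 * ((1 - γ)⁻¹ *
          ∑ h ∈ Finset.range H, γ ^ h * ‖M.pathScore (h + 1) z θ‖ ^ 2) := by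
          gcongr
          exact sum_geometric_le h0 h1 _
      _ = _ := by ring
  refine (integral_mono_of_nonneg (Filter.Eventually.of_forall fun _ => by positivity) hi hb).trans
    ?_
  rw [integral_const_mul, integral_finsetSum _ fun h _ =>
    (integrable_norm_sq_pathScore hM (h + 1) θ).const_mul _]
  have h4 : ∑ h ∈ Finset.range H, ∫ z, γ ^ h * ‖M.pathScore (h + 1) z θ‖ ^ 2 ∂M.pathLaw θ ≤
      Mg ^ 2 * (1 / (1 - γ) ^ 2) := by
    calc _ ≤ ∑ h ∈ Finset.range H, Mg ^ 2 * (γ ^ h * ((h : ℝ) + 1)) := by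
          refine Finset.sum_le_sum fun h _ => ?_
          rw [integral_const_mul]
          have := integral_norm_sq_pathScore_le hM (h + 1) θ
          push_cast at this
          calc _ ≤ γ ^ h * (((h : ℝ) + 1) * Mg ^ 2) := by gcongr
            _ = _ := by ring
      _ ≤ _ := by
          rw [← Finset.mul_sum]
          exact mul_le_mul_of_nonneg_left (sum_geometric_mul_succ_le h0 h1 _) (sq_nonneg _)
  obtain ⟨s, hs, hγs⟩ := exists_sq_eq_one_sub h1
  calc _ ≤ R ^ 2 * (1 - γ)⁻¹ * (Mg ^ 2 * (1 / (1 - γ) ^ 2)) := by gcongr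
    _ = _ := by
      rw [constV_eq hs hγs, hγs]
      field_simp

end Return

end Problem

/-! ### One step of the gradient estimator -/

/-- Bias-variance decomposition: the centred part is orthogonal to the constant, and a variance is
at most the second moment. -/
lemma integral_norm_sq_add_sub_integral_le {Ω F : Type*} [MeasurableSpace Ω] {P : Measure Ω}
    [IsProbabilityMeasure P] [NormedAddCommGroup F] [InnerProductSpace ℝ F] [CompleteSpace F]
    {X : Ω → F} (hX : Integrable X P) (hX2 : Integrable (fun ω => ‖X ω‖ ^ 2) P) (c : F) :
    ∫ ω, ‖c + (X ω - ∫ ω', X ω' ∂P)‖ ^ 2 ∂P ≤ ‖c‖ ^ 2 + ∫ ω, ‖X ω‖ ^ 2 ∂P := by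
  set m := ∫ ω', X ω' ∂P with hm
  have e : ∀ ω, ‖c + (X ω - m)‖ ^ 2 = (‖c - m‖ ^ 2 + 2 * inner ℝ (c - m) (X ω)) + ‖X ω‖ ^ 2 := by
    intro ω
    rw [← norm_add_sq_real]
    congr 2; abel
  have hi : Integrable (fun ω => 2 * inner ℝ (c - m) (X ω)) P := (hX.const_inner _).const_mul 2
  simp only [e]
  rw [integral_add ((integrable_const _).fun_add hi) hX2, integral_add (integrable_const _) hi,
    integral_const_mul, integral_inner hX, ← hm]
  have h1 : ‖c - m + m‖ ^ 2 = ‖c - m‖ ^ 2 + 2 * inner ℝ (c - m) m + ‖m‖ ^ 2 :=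
    norm_add_sq_real _ _
  rw [sub_add_cancel] at h1
  simp only [integral_const, probReal_univ, smul_eq_mul, one_mul]
  nlinarith [sq_nonneg ‖m‖]

lemma norm_add_sq_le_two_mul {F : Type*} [SeminormedAddCommGroup F] (x y : F) :
    ‖x + y‖ ^ 2 ≤ 2 * ‖x‖ ^ 2 + 2 * ‖y‖ ^ 2 := by
  have h := pow_le_pow_left₀ (norm_nonneg _) (norm_add_le x y) 2
  nlinarith [sq_nonneg (‖x‖ - ‖y‖)]

namespace Problem

section Step

variable {p q d : ℕ} {M : Problem p q d} {lμ Mg Mh R γ : ℝ}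

/-- The second moment of the importance-weighted gradient difference is at most
`diffConst * α ^ 2`. -/
noncomputable def diffConst (γ R Mg Mh Cw : ℝ) : ℝ :=
  2 * (Mh * R / (1 - γ) ^ 2) ^ 2 + 2 * (constG γ R Mg ^ 2 * Cw)

/-- The importance-weighted difference of gradient estimates. -/
noncomputable def gradDiff (M : Problem p q d) (γ : ℝ) {H : ℕ} (τ : Traj p q H) (θ θ' : E d) :
    E d :=
  M.gradEst γ τ θ' - M.isWeight τ θ θ' • M.gradEst γ τ θ

lemma measurable_gradDiff (hM : M.Regular lμ Mg Mh) {H : ℕ} (θ θ' : E d) :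
    Measurable (fun τ : Traj p q H => M.gradDiff γ τ θ θ') :=
  (measurable_gradEst hM θ').sub ((M.measurable_isWeight θ θ').smul (measurable_gradEst hM θ))

lemma norm_gradDiff_le (hM : M.Regular lμ Mg Mh) (hMg : 0 ≤ Mg) (hR : M.RewardBound R)
    (h0 : 0 ≤ γ) (h1 : γ < 1) {H : ℕ} {τ : Traj p q H} (hτ : M.Admissible τ) (θ θ' : E d) :
    ‖M.gradDiff γ τ θ θ'‖ ≤
      constG γ R Mg + Real.exp (H * (Mg * ‖θ - θ'‖)) * constG γ R Mg := by
  refine (norm_sub_le _ _).trans (add_le_add (norm_gradEst_le hM hMg hR h0 h1 hτ θ') ?_)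
  rw [norm_smul, Real.norm_of_nonneg (M.isWeight_pos _ _ _).le]
  exact mul_le_mul (isWeight_le hM hτ θ θ') (norm_gradEst_le hM hMg hR h0 h1 hτ θ) (norm_nonneg _)
    (Real.exp_pos _).le

lemma integrable_gradEst (hM : M.Regular lμ Mg Mh) (hMg : 0 ≤ Mg) (hR : M.RewardBound R)
    (h0 : 0 ≤ γ) (h1 : γ < 1) (H : ℕ) (θ θ' : E d) :
    Integrable (fun τ : Traj p q H => M.gradEst γ τ θ) (M.trajLaw H θ') :=
  M.integrable_of_admissible_bound (measurable_gradEst hM θ).aestronglyMeasurable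
    fun _ hτ => norm_gradEst_le hM hMg hR h0 h1 hτ θ

lemma integrable_norm_sq_gradEst (hM : M.Regular lμ Mg Mh) (hMg : 0 ≤ Mg) (hR : M.RewardBound R)
    (h0 : 0 ≤ γ) (h1 : γ < 1) (H : ℕ) (θ θ' : E d) :
    Integrable (fun τ : Traj p q H => ‖M.gradEst γ τ θ‖ ^ 2) (M.trajLaw H θ') :=
  M.integrable_of_admissible_bound ((measurable_gradEst hM θ).norm.pow_const 2).aestronglyMeasurable
    fun _ hτ => by
      rw [norm_pow, norm_norm]
      exact pow_le_pow_left₀ (norm_nonneg _) (norm_gradEst_le hM hMg hR h0 h1 hτ θ) 2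

lemma integrable_gradDiff (hM : M.Regular lμ Mg Mh) (hMg : 0 ≤ Mg) (hR : M.RewardBound R)
    (h0 : 0 ≤ γ) (h1 : γ < 1) (H : ℕ) (θ θ' : E d) :
    Integrable (fun τ : Traj p q H => M.gradDiff γ τ θ θ') (M.trajLaw H θ') :=
  M.integrable_of_admissible_bound (measurable_gradDiff hM θ θ').aestronglyMeasurable
    fun _ hτ => norm_gradDiff_le hM hMg hR h0 h1 hτ θ θ'

lemma integrable_norm_sq_gradDiff (hM : M.Regular lμ Mg Mh) (hMg : 0 ≤ Mg) (hR : M.RewardBound R)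
    (h0 : 0 ≤ γ) (h1 : γ < 1) (H : ℕ) (θ θ' : E d) :
    Integrable (fun τ : Traj p q H => ‖M.gradDiff γ τ θ θ'‖ ^ 2) (M.trajLaw H θ') :=
  M.integrable_of_admissible_bound
    ((measurable_gradDiff hM θ θ').norm.pow_const 2).aestronglyMeasurable
    fun _ hτ => by
      rw [norm_pow, norm_norm]
      exact pow_le_pow_left₀ (norm_nonneg _) (norm_gradDiff_le hM hMg hR h0 h1 hτ θ θ') 2

/-- The trajectory comes from `θ'`; the importance weight makes the estimate at the old parameter
`θ` unbiased all the same. -/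
lemma integral_gradDiff (hM : M.Regular lμ Mg Mh) (hMg : 0 ≤ Mg) (hR : M.RewardBound R)
    (h0 : 0 ≤ γ) (h1 : γ < 1) (H : ℕ) (θ θ' : E d) :
    ∫ τ : Traj p q H, M.gradDiff γ τ θ θ' ∂M.trajLaw H θ' =
      M.gradJTrunc γ H θ' - M.gradJTrunc γ H θ := by
  have hi : Integrable (fun τ : Traj p q H => M.isWeight τ θ θ' • M.gradEst γ τ θ)
      (M.trajLaw H θ') := by
    have := (integrable_gradEst hM hMg hR h0 h1 H θ' θ').sub
      (integrable_gradDiff hM hMg hR h0 h1 H θ θ')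
    refine this.congr (Filter.Eventually.of_forall fun τ => ?_)
    simp [gradDiff]
  unfold gradDiff
  rw [integral_sub (integrable_gradEst hM hMg hR h0 h1 H θ' θ') hi, integral_gradEst hM hR,
    ← M.integral_trajLaw_change H θ θ', integral_gradEst hM hR]

lemma integral_norm_sq_gradDiff_le (hM : M.Regular lμ Mg Mh) (hMg : 0 ≤ Mg) (hMh : 0 ≤ Mh)
    (hR : M.RewardBound R) (h0 : 0 ≤ γ) (h1 : γ < 1) (H : ℕ) {θ θ' : E d} {α : ℝ}
    (hα : ‖θ - θ'‖ ≤ α) :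
    ∫ τ : Traj p q H, ‖M.gradDiff γ τ θ θ'‖ ^ 2 ∂M.trajLaw H θ' ≤
      diffConst γ R Mg Mh (constCw H Mg Mh α) * α ^ 2 := by
  have hR0 := rewardBound_nonneg hR
  obtain ⟨hL, hE, hV⟩ := isWeight_moments hM hMh H hα
  rw [variance_eq_integral (M.measurable_isWeight θ θ').aemeasurable, hE] at hV
  have hwi : Integrable (fun τ : Traj p q H => (M.isWeight τ θ θ' - 1) ^ 2) (M.trajLaw H θ') :=
    (hL.sub (memLp_const 1)).integrable_sq
  set m := Mh * R / (1 - γ) ^ 2 with hm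
  have hm0 : 0 ≤ m := by positivity
  have hG0 := constG_nonneg (γ := γ) hR0 hMg
  have hb : ∀ᵐ τ ∂M.trajLaw H θ', ‖M.gradDiff γ τ θ θ'‖ ^ 2 ≤
      2 * (m * α) ^ 2 + 2 * constG γ R Mg ^ 2 * (M.isWeight τ θ θ' - 1) ^ 2 := by
    filter_upwards [M.ae_admissible H θ'] with τ hτ
    -- The first part is small pathwise, by the Lipschitz bound on the scores; the second is small
    -- in mean square, by the variance of the weight.
    have e : M.gradDiff γ τ θ θ' = (M.gradEst γ τ θ' - M.gradEst γ τ θ) +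
        (1 - M.isWeight τ θ θ') • M.gradEst γ τ θ := by
      unfold gradDiff; module
    rw [e]
    refine (norm_add_sq_le_two_mul _ _).trans ?_
    have h2 : ‖M.gradEst γ τ θ' - M.gradEst γ τ θ‖ ≤ m * α := by
      refine (norm_gradEst_sub_le hM hMh hR h0 h1 hτ θ' θ).trans ?_
      rw [norm_sub_rev]
      gcongr
    have h3 : ‖(1 - M.isWeight τ θ θ') • M.gradEst γ τ θ‖ ^ 2 ≤
        constG γ R Mg ^ 2 * (M.isWeight τ θ θ' - 1) ^ 2 := by
      rw [norm_smul, mul_pow, Real.norm_eq_abs, sq_abs, mul_comm]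
      have := norm_gradEst_le hM hMg hR h0 h1 hτ θ
      have e2 : (1 - M.isWeight τ θ θ') ^ 2 = (M.isWeight τ θ θ' - 1) ^ 2 := by ring
      rw [e2]
      gcongr
    have h4 := pow_le_pow_left₀ (norm_nonneg _) h2 2
    linarith
  refine (integral_mono_ae (integrable_norm_sq_gradDiff hM hMg hR h0 h1 H θ θ')
    ((integrable_const _).fun_add (hwi.const_mul _)) hb).trans ?_
  rw [integral_add (integrable_const _) (hwi.const_mul _),
    integral_const_mul (2 * constG γ R Mg ^ 2)]
  simp only [integral_const, probReal_univ, smul_eq_mul, one_mul]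
  unfold diffConst
  rw [← hm]
  calc _ ≤ 2 * (m * α) ^ 2 + 2 * constG γ R Mg ^ 2 * (constCw H Mg Mh α * α ^ 2) := by gcongr
    _ = _ := by ring

/-- The update of the direction. -/
noncomputable def nextDir (M : Problem p q d) (γ η : ℝ) {H : ℕ} (θ θ' dir : E d)
    (τ : Traj p q H) : E d :=
  η • M.gradEst γ τ θ' + (1 - η) • (dir + M.gradDiff γ τ θ θ')

/-- The mean of the weighted difference cancels the drift of the target from θ to θ' exactly. What
remains is the contracted old error plus noise of mean zero. -/
lemma nextDir_sub_eq (hM : M.Regular lμ Mg Mh) (hMg : 0 ≤ Mg) (hR : M.RewardBound R)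
    (h0 : 0 ≤ γ) (h1 : γ < 1) {H : ℕ} (η : ℝ) (θ θ' dir : E d) (τ : Traj p q H) :
    M.nextDir γ η θ θ' dir τ - M.gradJTrunc γ H θ' =
      (1 - η) • (dir - M.gradJTrunc γ H θ) +
        ((η • M.gradEst γ τ θ' + (1 - η) • M.gradDiff γ τ θ θ') -
          ∫ τ : Traj p q H, (η • M.gradEst γ τ θ' + (1 - η) • M.gradDiff γ τ θ θ')
            ∂M.trajLaw H θ') := by
  rw [integral_add ((integrable_gradEst hM hMg hR h0 h1 H θ' θ').fun_smul η)
    ((integrable_gradDiff hM hMg hR h0 h1 H θ θ').fun_smul (1 - η)), integral_smul, integral_smul,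
    integral_gradEst hM hR, integral_gradDiff hM hMg hR h0 h1, nextDir]
  module

lemma norm_sq_update_le {η : ℝ} (hη0 : 0 ≤ η) (hη1 : η ≤ 1) (x y : E d) :
    ‖η • x + (1 - η) • y‖ ^ 2 ≤ 2 * η ^ 2 * ‖x‖ ^ 2 + 2 * ‖y‖ ^ 2 := by
  refine (norm_add_sq_le_two_mul _ _).trans ?_
  rw [norm_smul, norm_smul, mul_pow, mul_pow, Real.norm_eq_abs, Real.norm_eq_abs, sq_abs, sq_abs]
  have : (1 - η) ^ 2 * ‖y‖ ^ 2 ≤ ‖y‖ ^ 2 :=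
    mul_le_of_le_one_left (sq_nonneg _) (by nlinarith)
  linarith

/-- One step of the recursion for the mean squared error of the gradient estimator. -/
lemma integral_norm_sq_nextDir_sub_le (hM : M.Regular lμ Mg Mh) (hMg : 0 ≤ Mg) (hMh : 0 ≤ Mh)
    (hR : M.RewardBound R) (h0 : 0 ≤ γ) (h1 : γ < 1) (H : ℕ) {θ θ' : E d} (dir : E d) {α η : ℝ}
    (hα : ‖θ - θ'‖ ≤ α) (hη0 : 0 ≤ η) (hη1 : η ≤ 1) :
    Integrable (fun τ : Traj p q H => ‖M.nextDir γ η θ θ' dir τ - M.gradJTrunc γ H θ'‖ ^ 2)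
        (M.trajLaw H θ') ∧
      ∫ τ : Traj p q H, ‖M.nextDir γ η θ θ' dir τ - M.gradJTrunc γ H θ'‖ ^ 2 ∂M.trajLaw H θ' ≤
        (1 - η) * ‖dir - M.gradJTrunc γ H θ‖ ^ 2 + (2 * η ^ 2 * constV γ R Mg ^ 2 +
          2 * (diffConst γ R Mg Mh (constCw H Mg Mh α) * α ^ 2)) := by
  set U : Traj p q H → E d := fun τ => η • M.gradEst γ τ θ' + (1 - η) • M.gradDiff γ τ θ θ' with hU
  have hUm : Measurable U :=
    ((measurable_gradEst hM θ').const_smul η).add ((measurable_gradDiff hM θ θ').const_smul (1 - η))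
  have hUi : Integrable U (M.trajLaw H θ') :=
    ((integrable_gradEst hM hMg hR h0 h1 H θ' θ').fun_smul η).add
      ((integrable_gradDiff hM hMg hR h0 h1 H θ θ').fun_smul (1 - η))
  have hbi := ((integrable_norm_sq_gradEst hM hMg hR h0 h1 H θ' θ').const_mul (2 * η ^ 2)).fun_add
    ((integrable_norm_sq_gradDiff hM hMg hR h0 h1 H θ θ').const_mul 2)
  have hU2 : Integrable (fun τ => ‖U τ‖ ^ 2) (M.trajLaw H θ') := by
    refine hbi.mono' (hUm.norm.pow_const 2).aestronglyMeasurable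
      (Filter.Eventually.of_forall fun τ => ?_)
    rw [norm_pow, norm_norm]
    exact norm_sq_update_le hη0 hη1 _ _
  simp only [nextDir_sub_eq hM hMg hR h0 h1 η θ θ' dir]
  constructor
  · have hL : MemLp U 2 (M.trajLaw H θ') :=
      (memLp_two_iff_integrable_sq_norm hUm.aestronglyMeasurable).2 hU2
    have hL2 := (memLp_const ((1 - η) • (dir - M.gradJTrunc γ H θ))).add
      (hL.sub (memLp_const (∫ τ, U τ ∂M.trajLaw H θ')))
    exact (memLp_two_iff_integrable_sq_norm hL2.1).1 hL2
  · refine (integral_norm_sq_add_sub_integral_le hUi hU2 _).trans (add_le_add ?_ ?_)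
    · rw [norm_smul, mul_pow, Real.norm_eq_abs, sq_abs]
      refine mul_le_mul_of_nonneg_right ?_ (sq_nonneg _)
      -- Squaring gives the factor (1 - η)², at most 1 - η for η in [0, 1].
      nlinarith
    · refine (integral_mono hU2 hbi fun τ => norm_sq_update_le hη0 hη1 _ _).trans ?_
      rw [integral_add ((integrable_norm_sq_gradEst hM hMg hR h0 h1 H θ' θ').const_mul _)
        ((integrable_norm_sq_gradDiff hM hMg hR h0 h1 H θ θ').const_mul 2), integral_const_mul,
        integral_const_mul]
      have e1 := integral_norm_sq_gradEst_le hM hR h0 h1 H θ'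
      have e2 := integral_norm_sq_gradDiff_le hM hMg hMh hR h0 h1 H hα
      gcongr

end Step

end Problem

namespace Problem

/-! ### The run of the algorithm as a Markov chain -/

section Run

variable {p q d : ℕ} {M : Problem p q d} {lμ Mg Mh R γ : ℝ}

/-- One step of the algorithm, as a map of the current pair `(θ, dir)` and a new trajectory. -/
noncomputable def nvrpgStep (M : Problem p q d) (γ α η : ℝ) {H : ℕ} (x : E d × E d)
    (τ : Traj p q H) : E d × E d :=
  (normalizedStep x.1 α x.2, M.nextDir γ η x.1 (normalizedStep x.1 α x.2) x.2 τ)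

lemma nvrpg_succ (M : Problem p q d) {H : ℕ} (α η : ℕ → ℝ) (θ₀ : E d) (τ : ℕ → Traj p q H)
    (t : ℕ) : M.nvrpg γ α η θ₀ τ (t + 1) =
      M.nvrpgStep γ (α t) (η (t + 1)) (M.nvrpg γ α η θ₀ τ t) (τ (t + 1)) := rfl

lemma measurable_normalizedStep (α : ℝ) :
    Measurable (fun x : E d × E d => normalizedStep x.1 α x.2) := by
  unfold normalizedStep
  fun_prop

lemma norm_sub_normalizedStep_le {α : ℝ} (hα : 0 ≤ α) (θ dir : E d) :
    ‖θ - normalizedStep θ α dir‖ ≤ α := by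
  unfold normalizedStep
  rw [sub_add_cancel_left, norm_neg, norm_smul, Real.norm_of_nonneg hα, norm_smul, norm_inv,
    norm_norm]
  exact mul_le_of_le_one_right hα (inv_mul_le_one)

lemma measurable_gradDiff_joint (hM : M.Regular lμ Mg Mh) {H : ℕ} :
    Measurable (fun y : Traj p q H × E d × E d => M.gradDiff γ y.1 y.2.1 y.2.2) := by
  have hg := measurable_gradEst_joint (γ := γ) hM (H := H)
  have h1 := hg.comp (g := fun y : Traj p q H × E d => M.gradEst γ y.1 y.2)
    (f := fun y : Traj p q H × E d × E d => (y.1, y.2.2)) (by fun_prop)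
  have h2 := hg.comp (g := fun y : Traj p q H × E d => M.gradEst γ y.1 y.2)
    (f := fun y : Traj p q H × E d × E d => (y.1, y.2.1)) (by fun_prop)
  exact h1.sub ((measurable_isWeight_joint hM).smul h2)

lemma measurable_nvrpgStep (hM : M.Regular lμ Mg Mh) {H : ℕ} (α η : ℝ) :
    Measurable (fun y : (E d × E d) × Traj p q H => M.nvrpgStep γ α η y.1 y.2) := by
  have hs : Measurable fun y : (E d × E d) × Traj p q H => normalizedStep y.1.1 α y.1.2 :=
    (measurable_normalizedStep α).comp measurable_fst
  have h1 := (measurable_gradEst_joint (γ := γ) hM (H := H)).comp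
    (g := fun y : Traj p q H × E d => M.gradEst γ y.1 y.2)
    (f := fun y : (E d × E d) × Traj p q H => (y.2, normalizedStep y.1.1 α y.1.2))
    (measurable_snd.prodMk hs)
  have h2 := (measurable_gradDiff_joint (γ := γ) hM (H := H)).comp
    (g := fun y : Traj p q H × E d × E d => M.gradDiff γ y.1 y.2.1 y.2.2)
    (f := fun y : (E d × E d) × Traj p q H => (y.2, y.1.1, normalizedStep y.1.1 α y.1.2))
    (measurable_snd.prodMk (measurable_fst.fst.prodMk hs))
  exact hs.prodMk ((h1.const_smul η).add ((measurable_fst.snd.add h2).const_smul (1 - η)))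

lemma measurable_nvrpg (hM : M.Regular lμ Mg Mh) {Ω : Type*} [MeasurableSpace Ω] {H : ℕ}
    (α η : ℕ → ℝ) (θ₀ : E d) {τ : ℕ → Ω → Traj p q H} {t : ℕ}
    (hτ : ∀ n ≤ t, Measurable (τ n)) :
    Measurable (fun ω => M.nvrpg γ α η θ₀ (fun n => τ n ω) t) := by
  induction t with
  | zero => exact measurable_const.prodMk ((measurable_gradEst hM θ₀).comp (hτ 0 le_rfl))
  | succ t ih =>
    exact (measurable_nvrpgStep hM (α t) (η (t + 1))).comp
      (g := fun y : (E d × E d) × Traj p q H => M.nvrpgStep γ (α t) (η (t + 1)) y.1 y.2)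
      ((ih fun n hn => hτ n (hn.trans t.le_succ)).prodMk (hτ (t + 1) le_rfl))

/-- Causality: the state at time t reads the trajectories up to index t only, as needed to condition
on the past in `IsRun.law`. -/
lemma nvrpg_congr (M : Problem p q d) {H : ℕ} (α η : ℕ → ℝ) (θ₀ : E d) {τ τ' : ℕ → Traj p q H}
    {t : ℕ} (h : ∀ n ≤ t, τ n = τ' n) : M.nvrpg γ α η θ₀ τ t = M.nvrpg γ α η θ₀ τ' t := by
  induction t with
  | zero => simp [nvrpg, h 0 le_rfl]
  | succ t ih =>
    rw [nvrpg_succ, nvrpg_succ, ih fun n hn => h n (hn.trans t.le_succ), h (t + 1) le_rfl]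

/-- The law of a trajectory as a kernel in the policy parameter. -/
noncomputable def trajKernel (hM : M.Regular lμ Mg Mh) (H : ℕ) : Kernel (E d) (Traj p q H) where
  toFun θ := M.trajLaw H θ
  measurable' := by
    refine Measure.measurable_of_measurable_coe _ fun s hs => ?_
    -- Against the law at the reference parameter 0, the dependence on θ sits in the jointly
    -- measurable weight.
    have e : ∀ θ, M.trajLaw H θ s =
        ∫⁻ τ, ENNReal.ofReal (M.isWeight τ θ 0) * s.indicator 1 τ ∂M.trajLaw H 0 := fun θ => by
      rw [← lintegral_indicator_one hs,
        M.lintegral_trajLaw_change H θ 0 (measurable_one.indicator hs)]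
    simp only [e]
    have h := (measurable_isWeight_joint hM (n := H)).comp
      (g := fun y : Traj p q H × E d × E d => M.isWeight y.1 y.2.1 y.2.2)
      (f := fun y : E d × Traj p q H => (y.2, y.1, 0)) (by fun_prop)
    exact Measurable.lintegral_prod_right' (f := fun y : E d × Traj p q H =>
      ENNReal.ofReal (M.isWeight y.2 y.1 0) * s.indicator 1 y.2)
      (h.ennreal_ofReal.mul ((measurable_one.indicator hs).comp measurable_snd))

instance (hM : M.Regular lμ Mg Mh) (H : ℕ) : IsMarkovKernel (trajKernel hM H) :=
  ⟨fun θ => M.isProbability_trajLaw H θ⟩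

/-- The law of the next trajectory as a kernel in the current pair `(θ, dir)`. -/
noncomputable def nextTrajKernel (hM : M.Regular lμ Mg Mh) (H : ℕ) (α : ℝ) :
    Kernel (E d × E d) (Traj p q H) :=
  (trajKernel hM H).comap (fun x => normalizedStep x.1 α x.2) (measurable_normalizedStep α)

lemma nextTrajKernel_apply (hM : M.Regular lμ Mg Mh) (H : ℕ) (α : ℝ) (x : E d × E d) :
    nextTrajKernel hM H α x = M.trajLaw H (normalizedStep x.1 α x.2) := rfl

instance (hM : M.Regular lμ Mg Mh) (H : ℕ) (α : ℝ) : IsMarkovKernel (nextTrajKernel hM H α) := by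
  unfold nextTrajKernel; infer_instance

variable {Ω : Type*} [MeasurableSpace Ω] {P : Measure Ω} {H T : ℕ}
  {α η : ℕ → ℝ} {θ₀ : E d} {τ : ℕ → Ω → Traj p q H}

lemma IsRun.measurable_state (hM : M.Regular lμ Mg Mh) (hτ : M.IsRun P γ T α η θ₀ τ) {t : ℕ}
    (ht : t < T) : Measurable (fun ω => M.nvrpg γ α η θ₀ (fun n => τ n ω) t) :=
  measurable_nvrpg hM α η θ₀ fun n hn => hτ.measurable n (hn.trans_lt ht)

variable [IsProbabilityMeasure P]

lemma IsRun.map_zero (hτ : M.IsRun P γ T α η θ₀ τ) (hT : 0 < T) :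
    P.map (τ 0) = M.trajLaw H θ₀ := by
  ext C hC
  have h := hτ.law 0 hT Set.univ C MeasurableSet.univ hC
  rw [Measure.map_apply (hτ.measurable 0 hT) hC]
  simp only [Set.mem_univ, true_and, Set.ofPred_true, Measure.restrict_univ] at h
  change P (τ 0 ⁻¹' C) = ∫⁻ _, M.trajLaw H θ₀ C ∂P at h
  rw [h]
  simp

/-- Given the past, the next trajectory is drawn from `nextTrajKernel`. -/
lemma IsRun.map_state_prod (hM : M.Regular lμ Mg Mh) (hτ : M.IsRun P γ T α η θ₀ τ) {t : ℕ}
    (ht : t + 1 < T) :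
    P.map (fun ω => (M.nvrpg γ α η θ₀ (fun n => τ n ω) t, τ (t + 1) ω)) =
      (P.map fun ω => M.nvrpg γ α η θ₀ (fun n => τ n ω) t) ⊗ₘ nextTrajKernel hM H (α t) := by
  have hX := hτ.measurable_state hM (t.lt_succ_self.trans ht)
  have hY := hτ.measurable (t + 1) ht
  have := Measure.isProbabilityMeasure_map (μ := P) (hX.prodMk hY).aemeasurable
  have := Measure.isProbabilityMeasure_map (μ := P) hX.aemeasurable
  refine Measure.ext_prod fun {B C} hB hC => ?_
  -- A finite history is padded to an infinite sequence; the padding is never read, by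
  -- `nvrpg_congr`.
  let τ' : ℕ → (Fin (t + 1) → Traj p q H) → Traj p q H :=
    fun n h => if hn : n < t + 1 then h ⟨n, hn⟩ else 0
  have hτ' : ∀ n, Measurable (τ' n) := by
    intro n
    by_cases hn : n < t + 1
    · simp only [τ', hn, dite_true]; exact measurable_pi_apply _
    · simp only [τ', hn, dite_false]; exact measurable_const
  let Φ : (Fin (t + 1) → Traj p q H) → E d × E d :=
    fun h => M.nvrpg γ α η θ₀ (fun n => τ' n h) t
  have hΦ : Measurable Φ := measurable_nvrpg hM α η θ₀ fun n _ => hτ' n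
  have hΦX : ∀ ω, Φ (fun i : Fin (t + 1) => τ i ω) = M.nvrpg γ α η θ₀ (fun n => τ n ω) t := by
    intro ω
    refine M.nvrpg_congr α η θ₀ fun n hn => ?_
    exact dif_pos (Nat.lt_succ_of_le hn)
  have h := hτ.law (t + 1) ht (Φ ⁻¹' B) C (hΦ hB) hC
  simp only [Set.mem_preimage, hΦX] at h
  rw [Measure.map_apply (hX.prodMk hY) (hB.prod hC), Measure.compProd_apply_prod hB hC,
    setLIntegral_map hB (Kernel.measurable_coe _ hC) hX]
  exact h

/-- Integration with respect to the current pair and the next trajectory. -/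
lemma IsRun.lintegral_state_prod (hM : M.Regular lμ Mg Mh) (hτ : M.IsRun P γ T α η θ₀ τ) {t : ℕ}
    (ht : t + 1 < T) {F : (E d × E d) × Traj p q H → ℝ≥0∞} (hF : Measurable F) :
    ∫⁻ ω, F (M.nvrpg γ α η θ₀ (fun n => τ n ω) t, τ (t + 1) ω) ∂P =
      ∫⁻ ω, ∫⁻ y, F (M.nvrpg γ α η θ₀ (fun n => τ n ω) t, y)
        ∂nextTrajKernel hM H (α t) (M.nvrpg γ α η θ₀ (fun n => τ n ω) t) ∂P := by
  have hX := hτ.measurable_state hM (t.lt_succ_self.trans ht)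
  have hY := hτ.measurable (t + 1) ht
  have := Measure.isProbabilityMeasure_map (μ := P) hX.aemeasurable
  rw [← lintegral_map hF (hX.prodMk hY), hτ.map_state_prod hM ht, Measure.lintegral_compProd hF,
    lintegral_map (Measurable.lintegral_kernel_prod_right' hF) hX]

lemma measurable_isWeight_state (hM : M.Regular lμ Mg Mh) (α : ℝ) :
    Measurable (fun y : (E d × E d) × Traj p q H =>
      M.isWeight y.2 y.1.1 (normalizedStep y.1.1 α y.1.2)) :=
  (measurable_isWeight_joint hM (n := H)).comp
    (g := fun y : Traj p q H × E d × E d => M.isWeight y.1 y.2.1 y.2.2)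
    (f := fun y : (E d × E d) × Traj p q H => (y.2, y.1.1, normalizedStep y.1.1 α y.1.2))
    (measurable_snd.prodMk (measurable_fst.fst.prodMk
      ((measurable_normalizedStep α).comp measurable_fst)))

/-- The importance weight of a trajectory with respect to the normalized step. -/
noncomputable def stateWeight (M : Problem p q d) (H : ℕ) (α : ℝ)
    (y : (E d × E d) × Traj p q H) : ℝ :=
  M.isWeight y.2 y.1.1 (normalizedStep y.1.1 α y.1.2)

lemma lintegral_sq_stateWeight_le (hM : M.Regular lμ Mg Mh) {α : ℝ} (hα : 0 ≤ α) (x : E d × E d) :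
    ∫⁻ y, ENNReal.ofReal (M.stateWeight H α (x, y) ^ 2) ∂nextTrajKernel hM H α x ≤
      ENNReal.ofReal (Real.exp (H * Mg ^ 2 * α ^ 2)) := by
  rw [nextTrajKernel_apply]
  refine (lintegral_sq_isWeight_le hM H x.1 (normalizedStep x.1 α x.2)).trans
    (ENNReal.ofReal_le_ofReal ?_)
  refine Real.exp_le_exp.2 (mul_le_mul_of_nonneg_left ?_ (by positivity))
  exact pow_le_pow_left₀ (norm_nonneg _) (norm_sub_normalizedStep_le hα _ _) 2

lemma lintegral_stateWeight (hM : M.Regular lμ Mg Mh) (α : ℝ) (x : E d × E d) :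
    ∫⁻ y, ENNReal.ofReal (M.stateWeight H α (x, y)) ∂nextTrajKernel hM H α x = 1 := by
  rw [nextTrajKernel_apply]
  have := M.lintegral_trajLaw_change H x.1 (normalizedStep x.1 α x.2) measurable_one
  simp only [Pi.one_apply, mul_one, lintegral_const, measure_univ] at this
  exact this.symm

/-- Moments of the importance weights along the algorithm. -/
lemma IsRun.stateWeight_moments (hM : M.Regular lμ Mg Mh) (hMh : 0 ≤ Mh)
    (hτ : M.IsRun P γ T α η θ₀ τ) {t : ℕ} (ht : t + 1 < T) (hα : 0 ≤ α t) {w : Ω → ℝ}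
    (hw : w = fun ω => M.stateWeight H (α t) (M.nvrpg γ α η θ₀ (fun n => τ n ω) t, τ (t + 1) ω)) :
    MemLp w 2 P ∧ ∫ ω, w ω ∂P = 1 ∧ variance w P ≤ constCw H Mg Mh (α t) * α t ^ 2 := by
  have hX := hτ.measurable_state hM (t.lt_succ_self.trans ht)
  have hY := hτ.measurable (t + 1) ht
  have hs : Measurable (M.stateWeight H (α t)) := measurable_isWeight_state (H := H) hM (α t)
  have hm : Measurable w := by rw [hw]; exact hs.comp (hX.prodMk hY)
  have hpos : ∀ ω, 0 ≤ w ω := fun ω => by rw [hw]; exact (M.isWeight_pos _ _ _).le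
  have hsq : ∫⁻ ω, ENNReal.ofReal (w ω ^ 2) ∂P ≤
      ENNReal.ofReal (Real.exp (H * Mg ^ 2 * α t ^ 2)) := by
    rw [hw]
    refine (hτ.lintegral_state_prod hM ht
      (F := fun y => ENNReal.ofReal (M.stateWeight H (α t) y ^ 2))
      (hs.pow_const 2).ennreal_ofReal).trans_le ?_
    exact (lintegral_mono fun ω => lintegral_sq_stateWeight_le hM hα _).trans (by simp)
  have hone : ∫⁻ ω, ENNReal.ofReal (w ω) ∂P = 1 := by
    rw [hw]
    refine (hτ.lintegral_state_prod hM ht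
      (F := fun y => ENNReal.ofReal (M.stateWeight H (α t) y)) hs.ennreal_ofReal).trans ?_
    simp only [lintegral_stateWeight, lintegral_one, measure_univ]
  have hE : ∫ ω, w ω ∂P = 1 := by
    rw [integral_eq_lintegral_of_nonneg_ae
      (Filter.Eventually.of_forall hpos) hm.aestronglyMeasurable, hone, ENNReal.toReal_one]
  exact ⟨memLp_two_of_lintegral_sq_le hm.aemeasurable hsq, hE,
    (variance_le_of_lintegral_sq_le hm.aemeasurable (Real.exp_pos _).le hsq hE).trans
      (exp_sub_one_le_constCw hMh _)⟩

end Run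

/-! ### Mean squared error of the gradient estimator along the run -/

section MeanSquare

variable {p q d : ℕ} {M : Problem p q d} {lμ Mg Mh R γ : ℝ}

lemma continuous_stepGrad (hM : M.Regular lμ Mg Mh) (hMg : 0 ≤ Mg) (hR : M.RewardBound R)
    (h : ℕ) : Continuous (M.stepGrad h) := by
  refine (LipschitzWith.of_dist_le' (K := R * (2 * ((h : ℝ) + 1) ^ 2 * Mg ^ 2 +
    ((h : ℝ) + 1) * Mh)) fun x y => ?_).continuous
  rw [dist_eq_norm, dist_eq_norm]
  exact norm_stepGrad_sub_le hM hMg hR h x y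

lemma measurable_gradJTrunc (hM : M.Regular lμ Mg Mh) (hMg : 0 ≤ Mg) (hR : M.RewardBound R)
    (H : ℕ) : Measurable (M.gradJTrunc γ H) := by
  have := continuous_stepGrad hM hMg hR
  unfold gradJTrunc
  fun_prop

lemma measurable_gradJ (hM : M.Regular lμ Mg Mh) (hMg : 0 ≤ Mg) (hMh : 0 ≤ Mh)
    (hR : M.RewardBound R) (h0 : 0 ≤ γ) (h1 : γ < 1) : Measurable (M.gradJ γ) := by
  refine (LipschitzWith.of_dist_le' (K := 2 * constLg γ R Mg Mh) fun x y => ?_).continuous.measurable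
  rw [dist_eq_norm, dist_eq_norm]
  exact norm_gradJ_sub_le hM hMg hR hMh h0 h1 x y

variable {Ω : Type*} [MeasurableSpace Ω] {P : Measure Ω} [IsProbabilityMeasure P] {H T : ℕ}
  {α η : ℕ → ℝ} {θ₀ : E d} {τ : ℕ → Ω → Traj p q H}

/-- The error `d_t - ∇J_H(θ_t)` of the gradient estimator. -/
noncomputable def estError (M : Problem p q d) (γ : ℝ) (H : ℕ) (x : E d × E d) : E d :=
  x.2 - M.gradJTrunc γ H x.1

lemma measurable_estError (hM : M.Regular lμ Mg Mh) (hMg : 0 ≤ Mg) (hR : M.RewardBound R)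
    (H : ℕ) : Measurable (M.estError γ H) :=
  measurable_snd.sub ((measurable_gradJTrunc hM hMg hR H).comp measurable_fst)

lemma IsRun.lintegral_estError_zero_le (hM : M.Regular lμ Mg Mh) (hMg : 0 ≤ Mg)
    (hR : M.RewardBound R) (h0 : 0 ≤ γ) (h1 : γ < 1) (hτ : M.IsRun P γ T α η θ₀ τ) (hT : 0 < T) :
    ∫⁻ ω, ENNReal.ofReal (‖M.estError γ H (M.nvrpg γ α η θ₀ (fun n => τ n ω) 0)‖ ^ 2) ∂P ≤
      ENNReal.ofReal (constV γ R Mg ^ 2) := by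
  have hm : Measurable fun y : Traj p q H => M.gradEst γ y θ₀ - M.gradJTrunc γ H θ₀ :=
    (measurable_gradEst hM θ₀).sub_const _
  have hX := integrable_gradEst hM hMg hR h0 h1 H θ₀ θ₀
  have hX2 := integrable_norm_sq_gradEst hM hMg hR h0 h1 H θ₀ θ₀
  change ∫⁻ ω, (fun y : Traj p q H =>
    ENNReal.ofReal (‖M.gradEst γ y θ₀ - M.gradJTrunc γ H θ₀‖ ^ 2)) (τ 0 ω) ∂P ≤ _
  rw [← lintegral_map (hm.norm.pow_const 2).ennreal_ofReal (hτ.measurable 0 hT), hτ.map_zero hT]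
  have hi : Integrable (fun y : Traj p q H => ‖M.gradEst γ y θ₀ - M.gradJTrunc γ H θ₀‖ ^ 2)
      (M.trajLaw H θ₀) := by
    have hL : MemLp (fun y : Traj p q H => M.gradEst γ y θ₀) 2 (M.trajLaw H θ₀) :=
      (memLp_two_iff_integrable_sq_norm (measurable_gradEst hM θ₀).aestronglyMeasurable).2 hX2
    have hL2 := hL.sub (memLp_const (M.gradJTrunc γ H θ₀))
    exact (memLp_two_iff_integrable_sq_norm hL2.1).1 hL2
  rw [← ofReal_integral_eq_lintegral_ofReal hi (Filter.Eventually.of_forall fun _ => sq_nonneg _)]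
  apply ENNReal.ofReal_le_ofReal
  have key := integral_norm_sq_add_sub_integral_le hX hX2 0
  simp only [zero_add, integral_gradEst hM hR] at key
  refine key.trans ?_
  simpa using integral_norm_sq_gradEst_le hM hR h0 h1 H θ₀

lemma IsRun.lintegral_estError_succ_le (hM : M.Regular lμ Mg Mh) (hMg : 0 ≤ Mg) (hMh : 0 ≤ Mh)
    (hR : M.RewardBound R) (h0 : 0 ≤ γ) (h1 : γ < 1) (hτ : M.IsRun P γ T α η θ₀ τ) {t : ℕ}
    (ht : t + 1 < T) (hα : 0 ≤ α t) (hη0 : 0 ≤ η (t + 1)) (hη1 : η (t + 1) ≤ 1) :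
    ∫⁻ ω, ENNReal.ofReal (‖M.estError γ H (M.nvrpg γ α η θ₀ (fun n => τ n ω) (t + 1))‖ ^ 2) ∂P ≤
      ENNReal.ofReal (1 - η (t + 1)) *
        ∫⁻ ω, ENNReal.ofReal (‖M.estError γ H (M.nvrpg γ α η θ₀ (fun n => τ n ω) t)‖ ^ 2) ∂P +
      ENNReal.ofReal (2 * η (t + 1) ^ 2 * constV γ R Mg ^ 2 +
        2 * (diffConst γ R Mg Mh (constCw H Mg Mh (α t)) * α t ^ 2)) := by
  set K := 2 * η (t + 1) ^ 2 * constV γ R Mg ^ 2 +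
        2 * (diffConst γ R Mg Mh (constCw H Mg Mh (α t)) * α t ^ 2) with hK
  have hK0 : 0 ≤ K := by
    have := constCw_nonneg H (Mg := Mg) hMh (α t)
    rw [hK]; unfold diffConst; positivity
  have hX := hτ.measurable_state hM (t.lt_succ_self.trans ht)
  have hE := measurable_estError (γ := γ) hM hMg hR H
  have hF : Measurable fun y : (E d × E d) × Traj p q H =>
      ENNReal.ofReal (‖M.estError γ H (M.nvrpgStep γ (α t) (η (t + 1)) y.1 y.2)‖ ^ 2) :=
    ((hE.comp (measurable_nvrpgStep hM _ _)).norm.pow_const 2).ennreal_ofReal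
  have hG : Measurable fun ω => ENNReal.ofReal
      (‖M.estError γ H (M.nvrpg γ α η θ₀ (fun n => τ n ω) t)‖ ^ 2) :=
    ((hE.comp hX).norm.pow_const 2).ennreal_ofReal
  refine (hτ.lintegral_state_prod hM ht hF).trans_le ?_
  have hKi : ENNReal.ofReal K = ∫⁻ _, ENNReal.ofReal K ∂P := by simp
  rw [hKi, ← lintegral_const_mul _ hG, ← lintegral_add_right _ measurable_const]
  refine lintegral_mono fun ω => ?_
  set x := M.nvrpg γ α η θ₀ (fun n => τ n ω) t
  obtain ⟨hi, hle⟩ := integral_norm_sq_nextDir_sub_le hM hMg hMh hR h0 h1 H x.2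
    (norm_sub_normalizedStep_le hα x.1 x.2) hη0 hη1
  calc _ = ENNReal.ofReal (∫ y : Traj p q H, ‖M.nextDir γ (η (t + 1)) x.1
        (normalizedStep x.1 (α t) x.2) x.2 y -
          M.gradJTrunc γ H (normalizedStep x.1 (α t) x.2)‖ ^ 2
            ∂M.trajLaw H (normalizedStep x.1 (α t) x.2)) := by
        rw [ofReal_integral_eq_lintegral_ofReal hi
          (Filter.Eventually.of_forall fun _ => sq_nonneg _)]
        rfl
    _ ≤ ENNReal.ofReal ((1 - η (t + 1)) * ‖M.estError γ H x‖ ^ 2 + K) :=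
        ENNReal.ofReal_le_ofReal hle
    _ = _ := by
        rw [ENNReal.ofReal_add (mul_nonneg (by linarith) (sq_nonneg _)) hK0,
          ENNReal.ofReal_mul (by linarith)]

end MeanSquare

end Problem

/-! ### Stepsizes, momentum and horizon -/

section Parameters

/-- The square root of the momentum parameter. -/
noncomputable def sqrtMomentum (t : ℕ) : ℝ := (2 / ((t : ℝ) + 1)) ^ ((1 : ℝ) / 3)

lemma sqrtMomentum_pos (t : ℕ) : 0 < sqrtMomentum t := by unfold sqrtMomentum; positivity

lemma momentum_eq_sq (t : ℕ) : momentum t = sqrtMomentum t ^ 2 := by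
  unfold momentum sqrtMomentum
  rw [← Real.rpow_natCast, ← Real.rpow_mul (by positivity)]
  norm_num

lemma momentum_pos (t : ℕ) : 0 < momentum t := by unfold momentum; positivity

lemma momentum_succ_le_one (t : ℕ) : momentum (t + 1) ≤ 1 := by
  unfold momentum
  refine Real.rpow_le_one (by positivity) ?_ (by norm_num)
  rw [div_le_one (by positivity)]
  push_cast
  linarith [(Nat.cast_nonneg t : (0 : ℝ) ≤ t)]

lemma momentum_anti {s t : ℕ} (h : s ≤ t) : momentum t ≤ momentum s := by
  unfold momentum
  have : (s : ℝ) ≤ t := Nat.cast_le.2 h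
  gcongr

/-- By subadditivity of u^(2/3), the reciprocal of the momentum grows by at most (1/2)^(2/3) ≤ 3/4
per step. Multiplying by both momenta gives the claim. -/
lemma momentum_sub_le (t : ℕ) :
    momentum t - momentum (t + 1) ≤ 3 / 4 * (momentum t * momentum (t + 1)) := by
  have hinv : ∀ s : ℕ, (momentum s)⁻¹ = (((s : ℝ) + 1) / 2) ^ ((2 : ℝ) / 3) := fun s => by
    unfold momentum
    rw [← Real.inv_rpow (by positivity), inv_div]
  have hhalf : ((1 : ℝ) / 2) ^ ((2 : ℝ) / 3) ≤ 3 / 4 := by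
    refine le_of_pow_le_pow_left₀ (n := 3) three_ne_zero (by norm_num) ?_
    rw [← Real.rpow_natCast, ← Real.rpow_mul (by norm_num)]
    norm_num
  have h : (momentum (t + 1))⁻¹ ≤ (momentum t)⁻¹ + 3 / 4 := by
    rw [hinv, hinv]
    have e : (((t + 1 : ℕ) : ℝ) + 1) / 2 = ((t : ℝ) + 1) / 2 + 1 / 2 := by push_cast; ring
    rw [e]
    refine (Real.rpow_add_le_add_rpow (by positivity) (by norm_num) (by norm_num)
      (by norm_num)).trans ?_
    linarith
  have ha := momentum_pos t
  have hb := momentum_pos (t + 1)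
  have h2 := mul_le_mul_of_nonneg_left h (mul_pos ha hb).le
  have e1 : momentum t * momentum (t + 1) * (momentum (t + 1))⁻¹ = momentum t := by field_simp
  have e2 : momentum t * momentum (t + 1) * ((momentum t)⁻¹ + 3 / 4) =
      momentum (t + 1) + 3 / 4 * (momentum t * momentum (t + 1)) := by field_simp
  linarith

/-- Discrete form of the integral of u^(-1/3), which is (3/2) u^(2/3); it amounts to (x - y)² (x +
2y) ≥ 0. -/
lemma cube_root_step {x y : ℝ} (hx : 0 < x) (hy : 0 ≤ y) (h : x ^ 3 = y ^ 3 + 1) :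
    1 / x ≤ 3 / 2 * (x ^ 2 - y ^ 2) := by
  rw [div_le_iff₀ hx]
  nlinarith [mul_nonneg (sq_nonneg (x - y)) (add_nonneg hx.le (mul_nonneg zero_le_two hy))]

lemma rpow_third_cube {a : ℝ} (ha : 0 ≤ a) : (a ^ ((1 : ℝ) / 3)) ^ 3 = a := by
  rw [← Real.rpow_natCast, ← Real.rpow_mul ha]
  norm_num

lemma rpow_third_sq {a : ℝ} (ha : 0 ≤ a) : (a ^ ((1 : ℝ) / 3)) ^ 2 = a ^ ((2 : ℝ) / 3) := by
  rw [← Real.rpow_natCast, ← Real.rpow_mul ha]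
  norm_num

/-- The constant is (4/3)(3/2), with 4/3 an upper bound for the cube root of 2. -/
lemma sum_sqrtMomentum_le (n : ℕ) :
    ∑ t ∈ Finset.range n, sqrtMomentum t ≤ 2 * ((n : ℝ) ^ ((1 : ℝ) / 3)) ^ 2 := by
  induction n with
  | zero => simp
  | succ n ih =>
    rw [Finset.sum_range_succ]
    have htwo : (2 : ℝ) ^ ((1 : ℝ) / 3) ≤ 4 / 3 := by
      refine le_of_pow_le_pow_left₀ (n := 3) three_ne_zero (by norm_num) ?_
      rw [rpow_third_cube (by norm_num)]
      norm_num
    have hx : 0 < ((n + 1 : ℕ) : ℝ) ^ ((1 : ℝ) / 3) := by positivity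
    have hstep := cube_root_step hx (y := (n : ℝ) ^ ((1 : ℝ) / 3)) (by positivity)
      (by rw [rpow_third_cube (by positivity), rpow_third_cube (by positivity)]; push_cast; ring)
    have e : sqrtMomentum n =
        (2 : ℝ) ^ ((1 : ℝ) / 3) * (1 / ((n + 1 : ℕ) : ℝ) ^ ((1 : ℝ) / 3)) := by
      unfold sqrtMomentum
      rw [Real.div_rpow (by norm_num) (by positivity)]
      push_cast
      ring
    have h2 : sqrtMomentum n ≤ 4 / 3 * (1 / ((n + 1 : ℕ) : ℝ) ^ ((1 : ℝ) / 3)) := by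
      rw [e]; gcongr
    linarith

variable {γ : ℝ}

lemma horizon_mul_ge (h1 : γ < 1) (T : ℕ) : Real.log (T + 1) ≤ (1 - γ) * horizon γ T := by
  have h : 0 < 1 - γ := by linarith
  have := Nat.le_ceil ((1 - γ)⁻¹ * Real.log (T + 1))
  rw [inv_mul_le_iff₀ h] at this
  exact this

lemma horizon_mul_le (h0 : 0 < γ) (h1 : γ < 1) (T : ℕ) :
    (1 - γ) * horizon γ T ≤ Real.log (T + 1) + 1 := by
  have h : 0 < 1 - γ := by linarith
  have hlog : 0 ≤ Real.log ((T : ℝ) + 1) :=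
    Real.log_nonneg (by linarith [(Nat.cast_nonneg T : (0 : ℝ) ≤ T)])
  have h2 := (Nat.ceil_lt_add_one (a := (1 - γ)⁻¹ * Real.log (T + 1)) (by positivity)).le
  calc (1 - γ) * horizon γ T ≤ (1 - γ) * ((1 - γ)⁻¹ * Real.log (T + 1) + 1) := by
        gcongr; exact h2
    _ = Real.log (T + 1) + (1 - γ) := by field_simp
    _ ≤ _ := by linarith

lemma pow_horizon_le (h0 : 0 < γ) (h1 : γ < 1) (T : ℕ) :
    γ ^ horizon γ T ≤ 1 / ((T : ℝ) + 1) := by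
  have hT : (0 : ℝ) < T + 1 := by positivity
  have h2 : γ ≤ Real.exp (-(1 - γ)) := by
    have := Real.add_one_le_exp (-(1 - γ)); linarith
  calc γ ^ horizon γ T ≤ Real.exp (-(1 - γ)) ^ horizon γ T := by gcongr
    _ = Real.exp (-((1 - γ) * horizon γ T)) := by rw [← Real.exp_nat_mul]; congr 1; ring
    _ ≤ Real.exp (-Real.log (T + 1)) := by
        apply Real.exp_le_exp.2
        linarith [horizon_mul_ge h1 T]
    _ = _ := by rw [Real.exp_neg, Real.exp_log hT, one_div]

/-- The power of γ is at most 1/(T+1), while (1-γ)H ≤ log(T+1) + 1 ≤ T + 1. The product is thus at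
most 2/√(T+1), which is already smaller than 2/T^(1/3). -/
lemma truncation_factor_le (h0 : 0 < γ) (h1 : γ < 1) {T : ℕ} {x : ℝ} (hx : 1 ≤ x)
    (hT : (T : ℝ) = x ^ 3) :
    γ ^ horizon γ T * (Real.sqrt ((1 - γ) * horizon γ T) + 1) ≤ 2 / x := by
  have hlog : Real.log ((T : ℝ) + 1) ≤ T := by
    have := Real.log_le_sub_one_of_pos (show (0 : ℝ) < T + 1 by positivity)
    linarith
  set s := Real.sqrt ((T : ℝ) + 1) with hs
  have hs2 : s ^ 2 = (T : ℝ) + 1 := Real.sq_sqrt (by positivity)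
  have hxs : x ≤ s := by
    refine Real.le_sqrt_of_sq_le ?_
    rw [hT]
    nlinarith [mul_nonneg (sub_nonneg.2 hx) (sq_nonneg x)]
  have h2 : Real.sqrt ((1 - γ) * horizon γ T) ≤ s :=
    Real.sqrt_le_sqrt ((horizon_mul_le h0 h1 T).trans (by linarith))
  have hs0 : 0 < s := by linarith
  calc _ ≤ 1 / ((T : ℝ) + 1) * (s + s) := by
        refine mul_le_mul (pow_horizon_le h0 h1 T) (by linarith) (by positivity) (by positivity)
    _ = 2 / s := by rw [← hs2]; field_simp; norm_num
    _ ≤ _ := by gcongr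

end Parameters

namespace Problem

/-! ### Mean squared error, descent and the output -/

section Rate

variable {p q d : ℕ} {M : Problem p q d} {lμ Mg Mh R γ α : ℝ}
  {Ω : Type*} [MeasurableSpace Ω] {P : Measure Ω} {H T : ℕ} {θ₀ : E d} {τ : ℕ → Ω → Traj p q H}

lemma diffConst_nonneg (hMh : 0 ≤ Mh) (H : ℕ) (α : ℝ) :
    0 ≤ diffConst γ R Mg Mh (constCw H Mg Mh α) := by
  have := constCw_nonneg H (Mg := Mg) hMh α
  unfold diffConst; positivity

/-- Induction step for the ansatz 8 V² η + B with consecutive momenta a ≥ b: 8(a - b) ≤ 6ab and 2b²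
≤ 2ab together fit into the contraction 8ab, and K fits into bB. -/
lemma mse_recursion {V K B a b : ℝ} (hb0 : 0 < b) (hba : b ≤ a)
    (hab : a - b ≤ 3 / 4 * (a * b)) (hK : K ≤ b * B) :
    (1 - b) * (8 * V ^ 2 * a + B) + (2 * b ^ 2 * V ^ 2 + K) ≤ 8 * V ^ 2 * b + B := by
  have h1 : 8 * (a - b) + 2 * b ^ 2 ≤ 8 * (a * b) := by
    nlinarith [mul_le_mul_of_nonneg_left hba hb0.le]
  nlinarith [mul_le_mul_of_nonneg_left h1 (sq_nonneg V)]

lemma IsRun.measurable_iterate {α η : ℕ → ℝ} (hM : M.Regular lμ Mg Mh)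
    (hτ : M.IsRun P γ T α η θ₀ τ) {t : ℕ} (ht : t ≤ T) :
    Measurable (fun ω => M.iterate γ α η θ₀ (fun n => τ n ω) t) := by
  cases t with
  | zero => exact measurable_const
  | succ t => exact (measurable_normalizedStep (α t)).comp (hτ.measurable_state hM ht)

variable [IsProbabilityMeasure P]

/-- Mean squared error of the gradient estimator along the algorithm. -/
lemma IsRun.lintegral_estError_le (hM : M.Regular lμ Mg Mh) (hMg : 0 ≤ Mg) (hMh : 0 ≤ Mh)
    (hR : M.RewardBound R) (h0 : 0 ≤ γ) (h1 : γ < 1)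
    (hτ : M.IsRun P γ T (fun _ => α) momentum θ₀ τ) (hα : 0 ≤ α) {B : ℝ} (hB0 : 0 ≤ B)
    (hB : ∀ t, t + 1 < T →
      2 * (diffConst γ R Mg Mh (constCw H Mg Mh α) * α ^ 2) ≤ momentum (t + 1) * B)
    {t : ℕ} (ht : t < T) :
    ∫⁻ ω, ENNReal.ofReal
        (‖M.estError γ H (M.nvrpg γ (fun _ => α) momentum θ₀ (fun n => τ n ω) t)‖ ^ 2) ∂P ≤
      ENNReal.ofReal (8 * constV γ R Mg ^ 2 * momentum t + B) := by
  induction t with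
  | zero =>
    refine (hτ.lintegral_estError_zero_le hM hMg hR h0 h1 ht).trans (ENNReal.ofReal_le_ofReal ?_)
    -- The value at 0 exceeds 1; it is never used as an averaging weight, only as a bound here.
    have h2 : (1 : ℝ) ≤ momentum 0 := by
      have : momentum 1 = 1 := by norm_num [momentum]
      exact this ▸ momentum_anti zero_le_one
    nlinarith [sq_nonneg (constV γ R Mg)]
  | succ t ih =>
    have ha := momentum_pos t
    have hb := momentum_pos (t + 1)
    have hb1 := momentum_succ_le_one t
    refine (hτ.lintegral_estError_succ_le hM hMg hMh hR h0 h1 ht hα hb.le hb1).trans ?_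
    refine (add_le_add_left (mul_le_mul_right (ih (t.lt_succ_self.trans ht)) _) _).trans ?_
    rw [← ENNReal.ofReal_mul (by linarith), ← ENNReal.ofReal_add]
    · exact ENNReal.ofReal_le_ofReal (mse_recursion hb (momentum_anti t.le_succ)
        (momentum_sub_le t) (hB t ht))
    · exact mul_nonneg (by linarith) (by positivity)
    · have := diffConst_nonneg (γ := γ) (R := R) (Mg := Mg) hMh H α
      positivity

/-- Mean error of the gradient estimator along the algorithm. -/
lemma IsRun.integral_norm_estError_le (hM : M.Regular lμ Mg Mh) (hMg : 0 ≤ Mg) (hMh : 0 ≤ Mh)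
    (hR : M.RewardBound R) (h0 : 0 ≤ γ) (h1 : γ < 1)
    (hτ : M.IsRun P γ T (fun _ => α) momentum θ₀ τ) (hα : 0 ≤ α) {S : ℝ} (hS0 : 0 ≤ S)
    (hS : ∀ t, t + 1 < T →
      2 * (diffConst γ R Mg Mh (constCw H Mg Mh α) * α ^ 2) ≤ momentum (t + 1) * S ^ 2)
    {t : ℕ} (ht : t < T) :
    Integrable (fun ω =>
        ‖M.estError γ H (M.nvrpg γ (fun _ => α) momentum θ₀ (fun n => τ n ω) t)‖) P ∧
      ∫ ω, ‖M.estError γ H (M.nvrpg γ (fun _ => α) momentum θ₀ (fun n => τ n ω) t)‖ ∂P ≤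
        3 * constV γ R Mg * sqrtMomentum t + S := by
  have hV := constV_nonneg (γ := γ) (rewardBound_nonneg hR) hMg h1
  have hr := sqrtMomentum_pos t
  have hm : Measurable fun ω =>
      ‖M.estError γ H (M.nvrpg γ (fun _ => α) momentum θ₀ (fun n => τ n ω) t)‖ :=
    ((measurable_estError hM hMg hR H).comp (hτ.measurable_state hM ht)).norm
  have h := hτ.lintegral_estError_le hM hMg hMh hR h0 h1 hα (sq_nonneg S) hS ht
  have hL := memLp_two_of_lintegral_sq_le hm.aemeasurable h
  refine ⟨hL.integrable one_le_two, (integral_le_sqrt_integral_sq hL).trans ?_⟩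
  -- The root of 8 V² η + S² is at most 3 V √η + S because 8 ≤ 9.
  refine Real.sqrt_le_iff.2 ⟨by positivity, ?_⟩
  refine (integral_sq_le_of_lintegral_sq_le hm.aemeasurable (by
    have := momentum_pos t; positivity) h).trans ?_
  rw [momentum_eq_sq]
  have h3 : 0 ≤ constV γ R Mg * sqrtMomentum t := by positivity
  nlinarith [mul_nonneg h3 hS0, sq_nonneg (constV γ R Mg * sqrtMomentum t)]

/-- Replacing g by v costs ‖v - g‖ twice, once in the norm and once in the inner product. For v = 0
the left side is -‖g‖, so a vanishing direction needs no separate treatment later. -/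
lemma inner_normalized_ge (g v : E d) :
    ‖g‖ - 2 * ‖v - g‖ ≤ inner ℝ g (‖v‖⁻¹ • v) := by
  have htri : ‖g‖ ≤ ‖v‖ + ‖v - g‖ := by
    have : g = v - (v - g) := by abel
    calc ‖g‖ = ‖v - (v - g)‖ := by rw [← this]
      _ ≤ _ := norm_sub_le _ _
  rcases eq_or_ne v 0 with rfl | hv
  · simp only [smul_zero, inner_zero_right, zero_sub, norm_neg]
    linarith [norm_nonneg g]
  · have hv' : ‖v‖ ≠ 0 := norm_ne_zero_iff.2 hv
    have e : inner ℝ g (‖v‖⁻¹ • v) = ‖v‖ - inner ℝ (v - g) (‖v‖⁻¹ • v) := by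
      rw [inner_sub_left, inner_smul_right v v, real_inner_self_eq_norm_sq]
      field_simp
      ring
    have hu : ‖‖v‖⁻¹ • v‖ = 1 := by
      rw [norm_smul, norm_inv, norm_norm, inv_mul_cancel₀ hv']
    have h2 := real_inner_le_norm (v - g) (‖v‖⁻¹ • v)
    rw [hu, mul_one] at h2
    rw [e]
    linarith

/-- Ascent of the expected return in one normalized step. -/
lemma mul_norm_gradJ_le (hM : M.Regular lμ Mg Mh) (hMg : 0 ≤ Mg) (hMh : 0 ≤ Mh)
    (hR : M.RewardBound R) (h0 : 0 ≤ γ) (h1 : γ < 1) (hα : 0 ≤ α) (H : ℕ) {b : ℝ}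
    (hb : ∀ θ : E d, ‖M.gradJ γ θ - M.gradJTrunc γ H θ‖ ≤ b) (x : E d × E d) :
    α * ‖M.gradJ γ x.1‖ ≤ M.J γ (normalizedStep x.1 α x.2) - M.J γ x.1 +
      2 * α * (‖M.estError γ H x‖ + b) + 2 * constLg γ R Mg Mh * α ^ 2 := by
  have hL := constLg_nonneg (Mg := Mg) (rewardBound_nonneg hR) hMh h1
  have key := J_lower_bound hM hMg hR hMh h0 h1 x.1 (normalizedStep x.1 α x.2)
  have hstep : normalizedStep x.1 α x.2 - x.1 = α • (‖x.2‖⁻¹ • x.2) := by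
    unfold normalizedStep; abel
  have hn : ‖normalizedStep x.1 α x.2 - x.1‖ ^ 2 ≤ α ^ 2 := by
    rw [norm_sub_rev]
    exact pow_le_pow_left₀ (norm_nonneg _) (norm_sub_normalizedStep_le hα _ _) 2
  have hin : α * (‖M.gradJ γ x.1‖ - 2 * ‖x.2 - M.gradJ γ x.1‖) ≤
      inner ℝ (M.gradJ γ x.1) (normalizedStep x.1 α x.2 - x.1) := by
    rw [hstep, real_inner_smul_right]
    exact mul_le_mul_of_nonneg_left (inner_normalized_ge _ _) hα
  have herr : ‖x.2 - M.gradJ γ x.1‖ ≤ ‖M.estError γ H x‖ + b := by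
    have e : x.2 - M.gradJ γ x.1 =
        M.estError γ H x - (M.gradJ γ x.1 - M.gradJTrunc γ H x.1) := by
      unfold estError; abel
    rw [e]
    exact (norm_sub_le _ _).trans (add_le_add_right (hb _) _)
  have h2 := mul_le_mul_of_nonneg_left herr hα
  have h3 := mul_le_mul_of_nonneg_left hn hL
  linarith

end Rate

end Problem

/-! ### The law of the output -/

section Output

variable {Ω : Type*} [MeasurableSpace Ω] (P : Measure Ω) [IsProbabilityMeasure P]

/-- Writing the product with the uniform law as a finite mixture turns expectations of the output
into averages over t, and integrability needs checking only for each fixed t. -/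
lemma outputLaw_eq_sum {T : ℕ} (hT : 1 ≤ T) :
    outputLaw P T =
      ∑ t ∈ Finset.Icc 1 T, (T : ℝ≥0∞)⁻¹ • P.map (fun ω => (ω, t)) := by
  have hne : (Set.Icc 1 T).Nonempty := ⟨1, le_rfl, hT⟩
  have := isProbabilityMeasure_uniformOn (Set.finite_Icc 1 T) hne
  unfold outputLaw
  refine Measure.ext_prod fun {B C} hB hC => ?_
  rw [Measure.prod_prod, Measure.finsetSum_apply]
  have hmap : ∀ t, (P.map (fun ω => (ω, t))) (B ×ˢ C) = P B * C.indicator 1 t := by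
    intro t
    rw [Measure.map_apply (by fun_prop) (hB.prod hC)]
    by_cases h : t ∈ C
    · have : (fun ω => (ω, t)) ⁻¹' (B ×ˢ C) = B := by ext ω; simp [h]
      rw [this]; simp [h]
    · have : (fun ω => (ω, t)) ⁻¹' (B ×ˢ C) = ∅ := by ext ω; simp [h]
      rw [this]; simp [h]
  simp only [Measure.smul_apply, smul_eq_mul, hmap]
  classical
  have hu : uniformOn (Set.Icc 1 T) C =
      (T : ℝ≥0∞)⁻¹ * ∑ t ∈ Finset.Icc 1 T, C.indicator 1 t := by
    rw [uniformOn, cond_apply (measurableSet_Icc), ← Finset.coe_Icc, Measure.count_apply_finset]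
    congr 1
    · simp
    · have e : ((Finset.Icc 1 T : Finset ℕ) : Set ℕ) ∩ C =
          (((Finset.Icc 1 T).filter (· ∈ C) : Finset ℕ) : Set ℕ) := by
        ext; simp
      rw [e, Measure.count_apply_finset, Finset.card_filter]
      push_cast
      exact Finset.sum_congr rfl fun t _ => by by_cases h : t ∈ C <;> simp [h]
  rw [hu, Finset.mul_sum, Finset.mul_sum]
  exact Finset.sum_congr rfl fun t _ => by ring

lemma integrable_outputLaw {T : ℕ} (hT : 1 ≤ T) {f : Ω × ℕ → ℝ}
    (hf : ∀ t ∈ Finset.Icc 1 T, Integrable (fun ω => f (ω, t)) P) :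
    Integrable f (outputLaw P T) := by
  rw [outputLaw_eq_sum P hT, integrable_finsetSum_measure]
  intro t ht
  refine Integrable.smul_measure ?_ (by
    rw [ne_eq, ENNReal.inv_eq_top]; simp; omega)
  exact (measurableEmbedding_prod_mk_right t).integrable_map_iff.2 (hf t ht)

lemma integral_outputLaw {T : ℕ} (hT : 1 ≤ T) {f : Ω × ℕ → ℝ}
    (hf : ∀ t ∈ Finset.Icc 1 T, Integrable (fun ω => f (ω, t)) P) :
    ∫ x, f x ∂outputLaw P T = (T : ℝ)⁻¹ * ∑ t ∈ Finset.Icc 1 T, ∫ ω, f (ω, t) ∂P := by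
  rw [outputLaw_eq_sum P hT, integral_finsetSum_measure, Finset.mul_sum]
  · refine Finset.sum_congr rfl fun t _ => ?_
    rw [integral_smul_measure, (measurableEmbedding_prod_mk_right t).integral_map]
    simp
  · intro t ht
    refine Integrable.smul_measure ?_ (by
      rw [ne_eq, ENNReal.inv_eq_top]; simp; omega)
    exact (measurableEmbedding_prod_mk_right t).integrable_map_iff.2 (hf t ht)

lemma sum_Icc_one_succ (n : ℕ) (f : ℕ → ℝ) :
    ∑ t ∈ Finset.Icc 1 (n + 1), f t = ∑ t ∈ Finset.range n, f (t + 1) + f (n + 1) := by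
  rw [Finset.sum_Icc_succ_top (by omega), Finset.range_eq_Ico, Finset.sum_Ico_add' f 0 n 1]
  rfl

end Output

namespace Problem

/-! ### Convergence rate -/

section Convergence

variable {p q d : ℕ} {M : Problem p q d} {lμ Mg Mh R γ α₀ : ℝ}
  {Ω : Type*} [MeasurableSpace Ω] {P : Measure Ω} {T : ℕ} {θ₀ : E d}
  {τ : ℕ → Ω → Traj p q (horizon γ T)}

lemma IsStandardRun.measurable_θ (hM : M.Regular lμ Mg Mh)
    (hτ : M.IsStandardRun γ α₀ T θ₀ P τ) {t : ℕ} (ht : t ≤ T) :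
    Measurable (M.θ γ α₀ T θ₀ τ t) :=
  IsRun.measurable_iterate hM hτ ht

variable [IsProbabilityMeasure P]

lemma stepsize_eq (α₀ : ℝ) (T : ℕ) : stepsize α₀ T = α₀ / ((T : ℝ) ^ ((1 : ℝ) / 3)) ^ 2 := by
  rw [stepsize, rpow_third_sq (Nat.cast_nonneg T)]

lemma integrable_norm_gradJ (hM : M.Regular lμ Mg Mh) (hMg : 0 ≤ Mg) (hMh : 0 ≤ Mh)
    (hR : M.RewardBound R) (h0 : 0 ≤ γ) (h1 : γ < 1) {X : Ω → E d} (hX : Measurable X) :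
    Integrable (fun ω => ‖M.gradJ γ (X ω)‖) P :=
  Integrable.of_bound (((measurable_gradJ hM hMg hMh hR h0 h1).comp hX).norm.aestronglyMeasurable)
    (constV γ R Mg) (Filter.Eventually.of_forall fun ω => by
      rw [norm_norm]; exact norm_gradJ_le hM hMg hR h0 h1 _)

lemma differentiable_J (hM : M.Regular lμ Mg Mh) (hMg : 0 ≤ Mg) (hR : M.RewardBound R)
    (h0 : 0 ≤ γ) (h1 : γ < 1) : Differentiable ℝ (M.J γ) :=
  fun θ => (hasGradientAt_J hM hMg hR h0 h1 θ).hasFDerivAt.differentiableAt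

lemma integrable_J (hM : M.Regular lμ Mg Mh) (hMg : 0 ≤ Mg) (hR : M.RewardBound R)
    (h0 : 0 ≤ γ) (h1 : γ < 1) {X : Ω → E d} (hX : Measurable X) :
    Integrable (fun ω => M.J γ (X ω)) P :=
  Integrable.of_bound
    ((differentiable_J hM hMg hR h0 h1).continuous.measurable.comp hX).aestronglyMeasurable
    (R / (1 - γ)) (Filter.Eventually.of_forall fun _ => abs_J_le hR h0 h1 _)

lemma integral_J_le_Jstar (hM : M.Regular lμ Mg Mh) (hMg : 0 ≤ Mg) (hR : M.RewardBound R)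
    (h0 : 0 ≤ γ) (h1 : γ < 1) {X : Ω → E d} (hX : Measurable X) :
    ∫ ω, M.J γ (X ω) ∂P ≤ M.Jstar γ := by
  refine (integral_mono (integrable_J hM hMg hR h0 h1 hX) (integrable_const _)
    fun ω => le_ciSup (bddAbove_range_J hR h0 h1) (X ω)).trans ?_
  simp [Jstar]

lemma integral_norm_gradJ_le (hM : M.Regular lμ Mg Mh) (hMg : 0 ≤ Mg) (hMh : 0 ≤ Mh)
    (hR : M.RewardBound R) (h0 : 0 ≤ γ) (h1 : γ < 1) {X : Ω → E d} (hX : Measurable X) :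
    ∫ ω, ‖M.gradJ γ (X ω)‖ ∂P ≤ constV γ R Mg := by
  refine (integral_mono (integrable_norm_gradJ hM hMg hMh hR h0 h1 hX) (integrable_const _)
    fun ω => norm_gradJ_le hM hMg hR h0 h1 (X ω)).trans ?_
  simp

/-- Expected ascent in one step of the algorithm. -/
lemma IsRun.mul_integral_norm_gradJ_le {α : ℝ} {H : ℕ} {τ : ℕ → Ω → Traj p q H}
    (hM : M.Regular lμ Mg Mh) (hMg : 0 ≤ Mg) (hMh : 0 ≤ Mh)
    (hR : M.RewardBound R) (h0 : 0 ≤ γ) (h1 : γ < 1) (hα : 0 ≤ α)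
    (hτ : M.IsRun P γ T (fun _ => α) momentum θ₀ τ) {b e : ℝ}
    (hb : ∀ θ : E d, ‖M.gradJ γ θ - M.gradJTrunc γ H θ‖ ≤ b) {t : ℕ} (ht : t < T)
    (hi : Integrable (fun ω =>
      ‖M.estError γ H (M.nvrpg γ (fun _ => α) momentum θ₀ (fun n => τ n ω) t)‖) P)
    (he : ∫ ω, ‖M.estError γ H (M.nvrpg γ (fun _ => α) momentum θ₀ (fun n => τ n ω) t)‖ ∂P ≤ e) :
    α * ∫ ω, ‖M.gradJ γ (M.iterate γ (fun _ => α) momentum θ₀ (fun n => τ n ω) t)‖ ∂P ≤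
      ∫ ω, M.J γ (M.iterate γ (fun _ => α) momentum θ₀ (fun n => τ n ω) (t + 1)) ∂P -
        ∫ ω, M.J γ (M.iterate γ (fun _ => α) momentum θ₀ (fun n => τ n ω) t) ∂P +
        2 * α * (e + b) + 2 * constLg γ R Mg Mh * α ^ 2 := by
  have hm := hτ.measurable_iterate hM ht.le
  have hm' := hτ.measurable_iterate hM (Nat.succ_le_of_lt ht)
  have i1 := (integrable_norm_gradJ (P := P) hM hMg hMh hR h0 h1 hm).const_mul α
  have i2 := (integrable_J (P := P) hM hMg hR h0 h1 hm').sub (integrable_J hM hMg hR h0 h1 hm)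
  have i3 := (hi.fun_add (integrable_const b)).const_mul (2 * α)
  have key := integral_mono i1 ((i2.add i3).add
    (integrable_const (2 * constLg γ R Mg Mh * α ^ 2))) fun ω =>
      mul_norm_gradJ_le hM hMg hMh hR h0 h1 hα H hb
        (M.nvrpg γ (fun _ => α) momentum θ₀ (fun n => τ n ω) t)
  rw [integral_const_mul, integral_add' (i2.add i3) (integrable_const _), integral_add' i2 i3,
    integral_sub' (integrable_J hM hMg hR h0 h1 hm') (integrable_J hM hMg hR h0 h1 hm),
    integral_const_mul, integral_add hi (integrable_const b)] at key
  simp only [integral_const, probReal_univ, smul_eq_mul, one_mul] at key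
  have h2 := mul_le_mul_of_nonneg_left he (mul_nonneg zero_le_two hα)
  linarith

end Convergence

end Problem

/-! ### Assembling the general rate -/

namespace Problem

section MainRate

variable {p q d : ℕ} {M : Problem p q d} {lμ Mg Mh R γ α₀ : ℝ}
  {Ω : Type*} [MeasurableSpace Ω] {P : Measure Ω} [IsProbabilityMeasure P] {T : ℕ} {θ₀ : E d}
  {τ : ℕ → Ω → Traj p q (horizon γ T)}

/-- The momentum never falls below T^(-2/3) during the run; this lower bound divides the constant
noise of order α² in the recursion. -/
lemma one_div_sq_le_momentum {x : ℝ} (hT : x = (T : ℝ) ^ ((1 : ℝ) / 3)) {t : ℕ}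
    (ht : t + 1 < T) : 1 / x ^ 2 ≤ momentum (t + 1) := by
  have hT0 : (0 : ℝ) < T := by exact_mod_cast (Nat.zero_lt_of_lt ht)
  have e : 1 / x ^ 2 = (1 / (T : ℝ)) ^ ((2 : ℝ) / 3) := by
    rw [hT, rpow_third_sq hT0.le, Real.div_rpow zero_le_one hT0.le, Real.one_rpow]
  rw [e, momentum]
  have h2 : ((t : ℝ) + 1 + 1) ≤ T := by exact_mod_cast ht
  refine Real.rpow_le_rpow (by positivity) ?_ (by norm_num)
  rw [div_le_div_iff₀ hT0 (by positivity)]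
  push_cast
  linarith

/-- Determines the noise floor S: of the factor x^(-4) in α², one x^(-2) is paid by the momentum and
the other makes S of order 1/x. -/
lemma two_mul_diffConst_le {m g C a x η : ℝ} (hm : 0 ≤ m) (hg : 0 ≤ g) (hC : 0 ≤ C) (hx : 0 < x)
    (hη : 1 / x ^ 2 ≤ η) :
    2 * ((2 * m ^ 2 + 2 * (g ^ 2 * C)) * (a / x ^ 2) ^ 2) ≤
      η * (2 * (m + g * Real.sqrt C) * a / x) ^ 2 := by
  have hs := Real.sq_sqrt hC
  have h1 : 2 * (2 * m ^ 2 + 2 * (g ^ 2 * C)) ≤ 4 * (m + g * Real.sqrt C) ^ 2 := by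
    have : 0 ≤ m * (g * Real.sqrt C) := by positivity
    calc _ = 4 * (m ^ 2 + g ^ 2 * Real.sqrt C ^ 2) := by rw [hs]; ring
      _ ≤ _ := by nlinarith
  calc _ = (2 * (2 * m ^ 2 + 2 * (g ^ 2 * C))) * (a ^ 2 / x ^ 4) := by ring
    _ ≤ (4 * (m + g * Real.sqrt C) ^ 2) * (a ^ 2 / x ^ 4) := by gcongr
    _ = (1 / x ^ 2) * (2 * (m + g * Real.sqrt C) * a / x) ^ 2 := by field_simp; ring
    _ ≤ _ := by gcongr

/-- Here x is T^(1/3), `A` is the sum of the gradient norms except the last, and the extra V is for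
the last iterate. The constant is 17 = 12 + 4 + 1: momentum sum, truncation bias, last iterate. -/
lemma rate_arithmetic {x a A D V L K N : ℝ} (hx : 1 ≤ x) (ha : 0 < a) (hD : 0 ≤ D) (hV : 0 ≤ V)
    (hL : 0 ≤ L) (hK : 0 ≤ K) (hN : N ≤ x ^ 3)
    (hA : a / x ^ 2 * A ≤ D + 2 * (a / x ^ 2) * (3 * V * (2 * x ^ 2) +
      N * (2 * K * a / x) + N * (V * (2 / x))) + N * (2 * L * (a / x ^ 2) ^ 2)) :
    (x ^ 3)⁻¹ * (A + V) ≤ 17 * (D / (a * x) + (V + (L + K) * a) / x) := by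
  have hx0 : 0 < x := by linarith
  have h1 : A ≤ D * x ^ 2 / a + 2 * (3 * V * (2 * x ^ 2) +
      x ^ 3 * (2 * K * a / x) + x ^ 3 * (V * (2 / x))) + x ^ 3 * (2 * L * (a / x ^ 2)) := by
    have h2 : a / x ^ 2 * A ≤ D + 2 * (a / x ^ 2) * (3 * V * (2 * x ^ 2) +
        x ^ 3 * (2 * K * a / x) + x ^ 3 * (V * (2 / x))) + x ^ 3 * (2 * L * (a / x ^ 2) ^ 2) := by
      refine hA.trans ?_
      gcongr
    have h3 : A = (x ^ 2 / a) * (a / x ^ 2 * A) := by field_simp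
    rw [h3]
    refine (mul_le_mul_of_nonneg_left h2 (by positivity)).trans (le_of_eq ?_)
    field_simp
  have h4 : A ≤ x ^ 2 * (D / a + 16 * V + 4 * K * a) + x * (2 * L * a) := by
    refine h1.trans (le_of_eq ?_)
    field_simp
    ring
  have h5 : x * (2 * L * a) ≤ x ^ 2 * (2 * L * a) := by
    have : x ≤ x ^ 2 := by nlinarith
    gcongr
  have h6 : V ≤ x ^ 2 * V := by
    have : 1 ≤ x ^ 2 := by nlinarith
    nlinarith
  have h7 : A + V ≤ x ^ 2 * (17 * (D / a + (V + (L + K) * a))) := by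
    have hDa : 0 ≤ D / a := by positivity
    have hKa : 0 ≤ K * a := by positivity
    have hLa : 0 ≤ L * a := by positivity
    have h8 : D / a + 16 * V + 4 * K * a + 2 * L * a + V ≤ 17 * (D / a + (V + (L + K) * a)) := by
      nlinarith
    have := mul_le_mul_of_nonneg_left h8 (sq_nonneg x)
    nlinarith
  calc (x ^ 3)⁻¹ * (A + V) ≤ (x ^ 3)⁻¹ * (x ^ 2 * (17 * (D / a + (V + (L + K) * a)))) := by gcongr
    _ = _ := by field_simp

lemma IsStandardRun.integrable_norm_gradient (hM : M.Regular lμ Mg Mh) (hMg : 0 ≤ Mg)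
    (hMh : 0 ≤ Mh) (hR : M.RewardBound R) (h0 : 0 ≤ γ) (h1 : γ < 1)
    (hτ : M.IsStandardRun γ α₀ T θ₀ P τ) {t : ℕ} (ht : t ∈ Finset.Icc 1 T) :
    Integrable (fun ω => ‖gradient (M.J γ) (M.θ γ α₀ T θ₀ τ t ω)‖) P := by
  simp only [gradient_J hM hMg hR h0 h1]
  exact integrable_norm_gradJ hM hMg hMh hR h0 h1 (hτ.measurable_θ hM (Finset.mem_Icc.1 ht).2)

/-- The general convergence rate of the algorithm. -/
lemma IsStandardRun.outputGradNorm_le (hM : M.Regular lμ Mg Mh) (hMg : 0 ≤ Mg)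
    (hMh : 0 ≤ Mh) (hR : M.RewardBound R) (h0 : 0 < γ) (h1 : γ < 1) (hα₀ : 0 < α₀) (hT : 1 ≤ T)
    (hτ : M.IsStandardRun γ α₀ T θ₀ P τ) :
    M.outputGradNorm γ α₀ T θ₀ P τ ≤
      34 * ((M.Jstar γ - ∫ ω, M.J γ (M.θ γ α₀ T θ₀ τ 1 ω) ∂P) / (α₀ * (T : ℝ) ^ ((1 : ℝ) / 3)) +
        (constV γ R Mg + (constLg γ R Mg Mh + constG γ R Mg *
          Real.sqrt (constCw (horizon γ T) Mg Mh (stepsize α₀ T))) * α₀) /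
            (T : ℝ) ^ ((1 : ℝ) / 3)) := by
  have hR0 := rewardBound_nonneg hR
  have hγ : 0 < 1 - γ := by linarith
  have hV := constV_nonneg (γ := γ) hR0 hMg h1
  have hG := constG_nonneg (γ := γ) hR0 hMg
  have hL := constLg_nonneg (Mg := Mg) hR0 hMh h1
  set x : ℝ := (T : ℝ) ^ ((1 : ℝ) / 3) with hxdef
  have hx : 1 ≤ x := Real.one_le_rpow (by exact_mod_cast hT) (by norm_num)
  have hx0 : 0 < x := by linarith
  have hTx : (T : ℝ) = x ^ 3 := (rpow_third_cube (Nat.cast_nonneg T)).symm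
  set α := stepsize α₀ T with hα
  have hαx : α = α₀ / x ^ 2 := stepsize_eq α₀ T
  have hα0 : 0 < α := by rw [hαx]; positivity
  set Cw := constCw (horizon γ T) Mg Mh α with hCw
  have hCw0 : 0 ≤ Cw := constCw_nonneg _ hMh _
  set m := Mh * R / (1 - γ) ^ 2 with hm
  have hm0 : 0 ≤ m := by positivity
  have hmL : m ≤ constLg γ R Mg Mh := by
    have : 0 ≤ 2 * Mg ^ 2 * R / (1 - γ) ^ 3 := by positivity
    unfold constLg; linarith
  set K := m + constG γ R Mg * Real.sqrt Cw with hK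
  have hK0 : 0 ≤ K := by positivity
  set S := 2 * K * α₀ / x with hS
  have hS0 : 0 ≤ S := by positivity
  have hrec : ∀ t, t + 1 < T →
      2 * (diffConst γ R Mg Mh (constCw (horizon γ T) Mg Mh α) * α ^ 2) ≤
        momentum (t + 1) * S ^ 2 := by
    intro t ht
    have := two_mul_diffConst_le (a := α₀) hm0 hG hCw0 hx0 (one_div_sq_le_momentum hxdef ht)
    rw [← hαx] at this
    exact this
  have hb : ∀ θ : E d, ‖M.gradJ γ θ - M.gradJTrunc γ (horizon γ T) θ‖ ≤
      constV γ R Mg * (2 / x) := fun θ =>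
    (norm_gradJ_sub_gradJTrunc_le hM hMg hR h0.le h1 _ θ).trans
      (mul_le_mul_of_nonneg_left (truncation_factor_le h0 h1 hx hTx) hV)
  have hrun : M.IsRun P γ T (fun _ => α) momentum θ₀ τ := hτ
  set a : ℕ → ℝ := fun t => ∫ ω, ‖M.gradJ γ (M.θ γ α₀ T θ₀ τ t ω)‖ ∂P with ha
  set j : ℕ → ℝ := fun t => ∫ ω, M.J γ (M.θ γ α₀ T θ₀ τ t ω) ∂P with hj
  have hstep : ∀ t, t < T → α * a t ≤ j (t + 1) - j t +
      2 * α * ((3 * constV γ R Mg * sqrtMomentum t + S) + constV γ R Mg * (2 / x)) +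
        2 * constLg γ R Mg Mh * α ^ 2 := by
    intro t ht
    obtain ⟨hi, he⟩ := hrun.integral_norm_estError_le hM hMg hMh hR h0.le h1 hα0.le hS0 hrec ht
    exact hrun.mul_integral_norm_gradJ_le hM hMg hMh hR h0.le h1 hα0.le hb ht hi he
  have hjT : j T ≤ M.Jstar γ := integral_J_le_Jstar hM hMg hR h0.le h1 (hτ.measurable_θ hM le_rfl)
  have hj1 : j 1 ≤ M.Jstar γ := integral_J_le_Jstar hM hMg hR h0.le h1 (hτ.measurable_θ hM hT)
  have haT : a T ≤ constV γ R Mg :=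
    integral_norm_gradJ_le hM hMg hMh hR h0.le h1 (hτ.measurable_θ hM le_rfl)
  have hout : M.outputGradNorm γ α₀ T θ₀ P τ = (T : ℝ)⁻¹ * ∑ t ∈ Finset.Icc 1 T, a t := by
    unfold outputGradNorm
    rw [integral_outputLaw P hT
      (fun t ht => hτ.integrable_norm_gradient hM hMg hMh hR h0.le h1 ht)]
    simp only [gradient_J hM hMg hR h0.le h1]
    rfl
  -- Only θ_1, …, θ_{T-1} have both an estimator and a successor in the run; the output index T has
  -- neither and its gradient is bounded by V. The index 0 is not an output, so the telescope starts
  -- at J(θ_1).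
  obtain ⟨n, hn⟩ : ∃ n, T = n + 1 := ⟨T - 1, by omega⟩
  have hsum : α * ∑ t ∈ Finset.range n, a (t + 1) ≤ (M.Jstar γ - j 1) + 2 * α *
      (3 * constV γ R Mg * (2 * x ^ 2) + n * S + n * (constV γ R Mg * (2 / x))) +
        n * (2 * constLg γ R Mg Mh * α ^ 2) := by
    have htel : ∑ t ∈ Finset.range n, (j (t + 1 + 1) - j (t + 1)) = j T - j 1 := by
      rw [Finset.sum_range_sub (fun t => j (t + 1)), hn]
    have hmom : ∑ t ∈ Finset.range n, sqrtMomentum (t + 1) ≤ 2 * x ^ 2 := by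
      have := sum_sqrtMomentum_le T
      rw [hn, Finset.sum_range_succ', ← hn] at this
      linarith [sqrtMomentum_pos 0]
    rw [Finset.mul_sum]
    calc ∑ t ∈ Finset.range n, α * a (t + 1)
        ≤ ∑ t ∈ Finset.range n, ((j (t + 1 + 1) - j (t + 1)) +
            (2 * α * (3 * constV γ R Mg)) * sqrtMomentum (t + 1) +
              (2 * α * (S + constV γ R Mg * (2 / x)) + 2 * constLg γ R Mg Mh * α ^ 2)) := by
          refine Finset.sum_le_sum fun t ht => ?_
          have := hstep (t + 1) (by have := Finset.mem_range.1 ht; omega)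
          linarith
      _ = (j T - j 1) + (2 * α * (3 * constV γ R Mg)) *
            (∑ t ∈ Finset.range n, sqrtMomentum (t + 1)) +
              n * (2 * α * (S + constV γ R Mg * (2 / x)) + 2 * constLg γ R Mg Mh * α ^ 2) := by
          rw [Finset.sum_add_distrib, Finset.sum_add_distrib, htel, ← Finset.mul_sum,
            Finset.sum_const, Finset.card_range, nsmul_eq_mul]
      _ ≤ (j T - j 1) + (2 * α * (3 * constV γ R Mg)) * (2 * x ^ 2) +
              n * (2 * α * (S + constV γ R Mg * (2 / x)) + 2 * constLg γ R Mg Mh * α ^ 2) := by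
          gcongr
      _ ≤ _ := by linarith
  have hsplit : ∑ t ∈ Finset.Icc 1 T, a t ≤
      ∑ t ∈ Finset.range n, a (t + 1) + constV γ R Mg := by
    have h2 := sum_Icc_one_succ n a
    rw [← hn] at h2
    rw [h2]
    linarith
  have hnx : (n : ℝ) ≤ x ^ 3 := by rw [← hTx, hn]; push_cast; linarith
  rw [hαx] at hsum
  have hD0 : 0 ≤ M.Jstar γ - j 1 := sub_nonneg.2 hj1
  have hj1' : ∫ ω, M.J γ (M.θ γ α₀ T θ₀ τ 1 ω) ∂P = j 1 := rfl
  rw [hout, hj1', hTx]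
  clear_value j a x Cw m
  have hfin : (x ^ 3)⁻¹ * (∑ t ∈ Finset.range n, a (t + 1) + constV γ R Mg) ≤ _ :=
    rate_arithmetic hx hα₀ hD0 hV (hm0.trans hmL) hK0 hnx hsum
  -- The summand m of K is at most `constLg`, so replacing K by G √C_w costs a factor 2; this turns
  -- 17 into 34.
  have h2 : (constV γ R Mg + (constLg γ R Mg Mh + K) * α₀) / x ≤
      2 * ((constV γ R Mg + (constLg γ R Mg Mh + constG γ R Mg * Real.sqrt Cw) * α₀) / x) := by
    rw [← mul_div_assoc]
    gcongr
    have h5 : K * α₀ ≤ (constLg γ R Mg Mh + constG γ R Mg * Real.sqrt Cw) * α₀ := by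
      rw [hK]; gcongr
    have h6 : 0 ≤ constG γ R Mg * Real.sqrt Cw * α₀ := by positivity
    linarith
  have h3 : 0 ≤ (M.Jstar γ - j 1) / (α₀ * x) := by positivity
  have h4 : (x ^ 3)⁻¹ * ∑ t ∈ Finset.Icc 1 T, a t ≤
      (x ^ 3)⁻¹ * (∑ t ∈ Finset.range n, a (t + 1) + constV γ R Mg) := by gcongr
  linarith

end MainRate

end Problem

/-! ### Explicit rate for the initial stepsize 1 - γ, and sample complexity -/

lemma one_le_two_mul_log {y : ℝ} (hy : 2 ≤ y) : 1 ≤ 2 * Real.log y := by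
  have h := Real.log_le_log (by norm_num) hy
  have := Real.log_two_gt_d9
  linarith

/-- With x = T^(1/3), H α² = (1-γ)² H / x⁴ ≤ (x³ + 1)/x⁴ ≤ 2. Hence W is bounded independently of γ
and T, and C_w is of order H². -/
lemma constCw_horizon_le {γ Mg Mh : ℝ} (h0 : 0 < γ) (h1 : γ < 1) (hMh : 0 ≤ Mh) {T : ℕ}
    (hT : 1 ≤ T) :
    constCw (horizon γ T) Mg Mh (stepsize (1 - γ) T) ≤
      (2 * Mg ^ 2 + Mh) * (Real.exp (2 * Mg ^ 2) + 1) * (horizon γ T : ℝ) ^ 2 := by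
  set H := horizon γ T with hH
  have hγ : 0 < 1 - γ := by linarith
  set x : ℝ := (T : ℝ) ^ ((1 : ℝ) / 3) with hxdef
  have hx : 1 ≤ x := Real.one_le_rpow (by exact_mod_cast hT) (by norm_num)
  have hTx : x ^ 3 = (T : ℝ) := rpow_third_cube (Nat.cast_nonneg T)
  have hHl : (1 - γ) * H ≤ x ^ 3 + 1 := by
    have h2 : (1 - γ) * (H : ℝ) ≤ Real.log (T + 1) + 1 := horizon_mul_le h0 h1 T
    have h3 : Real.log ((T : ℝ) + 1) ≤ T := by
      have := Real.log_le_sub_one_of_pos (x := (T : ℝ) + 1) (by positivity)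
      linarith
    rw [hTx]; linarith
  have hW : constW H Mg (stepsize (1 - γ) T) ≤ Real.exp (2 * Mg ^ 2) := by
    rw [constW, Real.exp_le_exp, Problem.stepsize_eq, ← hxdef]
    have h4 : (H : ℝ) * (((1 - γ) / x ^ 2) ^ 2) ≤ 2 := by
      have h5 : (1 - γ) * ((1 - γ) * H) ≤ 1 * (x ^ 3 + 1) := by
        gcongr
        linarith
      have h6 : x ^ 3 ≤ x ^ 4 := pow_le_pow_right₀ hx (by norm_num)
      have h7 : 1 ≤ x ^ 4 := one_le_pow₀ hx
      rw [div_pow, ← mul_div_assoc, div_le_iff₀ (by positivity)]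
      nlinarith
    have := mul_le_mul_of_nonneg_right h4 (sq_nonneg Mg)
    linarith
  have hHH : (H : ℝ) ≤ (H : ℝ) ^ 2 := by
    exact_mod_cast Nat.le_self_pow (by norm_num) H
  have hWp : 0 ≤ constW H Mg (stepsize (1 - γ) T) := (Real.exp_pos _).le
  calc constCw H Mg Mh (stepsize (1 - γ) T)
      ≤ (2 * (H : ℝ) ^ 2 * Mg ^ 2 + (H : ℝ) ^ 2 * Mh) * (Real.exp (2 * Mg ^ 2) + 1) := by
        unfold constCw; gcongr
    _ = _ := by ring

/-- The constant of the convergence rate for the initial stepsize `1 - γ`. -/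
noncomputable def rateConst (Mg Mh R : ℝ) : ℝ :=
  34 * (|R| * (4 + 2 * Mg + 2 * (2 * Mg ^ 2 + Mh) +
    3 * Mg * Real.sqrt ((2 * Mg ^ 2 + Mh) * (Real.exp (2 * Mg ^ 2) + 1)))) + 1

lemma rateConst_pos {Mg Mh : ℝ} (hMg : 0 ≤ Mg) (hMh : 0 ≤ Mh) (R : ℝ) :
    0 < rateConst Mg Mh R := by
  unfold rateConst; positivity

/-- Every term is of order (1-γ)^(-2) for this stepsize. In G √C_w α₀ the factor (1-γ) H appears, at
most 3 log(T+1); the other terms acquire the logarithm through 1 ≤ 2 log(T+1). -/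
lemma rate_le_log {γ Mg Mh R D : ℝ} (h0 : 0 < γ) (h1 : γ < 1) (hMg : 0 ≤ Mg) (hMh : 0 ≤ Mh)
    (hR : 0 ≤ R) {T : ℕ} (hT : 1 ≤ T) (hD : D ≤ 2 * R / (1 - γ)) :
    34 * (D / ((1 - γ) * (T : ℝ) ^ ((1 : ℝ) / 3)) +
        (constV γ R Mg + (constLg γ R Mg Mh + constG γ R Mg *
          Real.sqrt (constCw (horizon γ T) Mg Mh (stepsize (1 - γ) T))) * (1 - γ)) /
            (T : ℝ) ^ ((1 : ℝ) / 3)) ≤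
      rateConst Mg Mh R * Real.log (T + 1) / ((1 - γ) ^ 2 * (T : ℝ) ^ ((1 : ℝ) / 3)) := by
  have hγ : 0 < 1 - γ := by linarith
  have hT' : (1 : ℝ) ≤ T := by exact_mod_cast hT
  have hx : 0 < (T : ℝ) ^ ((1 : ℝ) / 3) := by positivity
  have hl := one_le_two_mul_log (y := (T : ℝ) + 1) (by linarith)
  have hC := constCw_horizon_le (Mg := Mg) h0 h1 hMh hT
  have hH : (1 - γ) * (horizon γ T : ℝ) ≤ Real.log (T + 1) + 1 := horizon_mul_le h0 h1 T
  have hV : constV γ R Mg ≤ Mg * R / (1 - γ) ^ 2 := by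
    unfold constV
    have : (1 - γ) ^ 2 ≤ (1 - γ) ^ ((3 : ℝ) / 2) := by
      rw [← Real.rpow_two]
      exact Real.rpow_le_rpow_of_exponent_ge hγ (by linarith) (by norm_num)
    gcongr
  have hLg : constLg γ R Mg Mh * (1 - γ) ≤ (2 * Mg ^ 2 + Mh) * R / (1 - γ) ^ 2 := by
    have e : constLg γ R Mg Mh * (1 - γ) =
        2 * Mg ^ 2 * R / (1 - γ) ^ 2 + Mh * R * (1 - γ) / (1 - γ) ^ 2 := by
      unfold constLg; field_simp
    have : Mh * R * (1 - γ) ≤ Mh * R * 1 := by gcongr; linarith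
    rw [e, ← add_div]
    gcongr
    linarith
  set c := Real.sqrt ((2 * Mg ^ 2 + Mh) * (Real.exp (2 * Mg ^ 2) + 1)) with hc
  set l := Real.log ((T : ℝ) + 1)
  set H : ℝ := (horizon γ T : ℝ) with hHdef
  have hH0 : 0 ≤ H := Nat.cast_nonneg _
  have hs : Real.sqrt (constCw (horizon γ T) Mg Mh (stepsize (1 - γ) T)) ≤ c * H := by
    refine (Real.sqrt_le_sqrt hC).trans (le_of_eq ?_)
    rw [Real.sqrt_mul (by positivity), Real.sqrt_sq hH0]
  have hGs : constG γ R Mg * Real.sqrt (constCw (horizon γ T) Mg Mh (stepsize (1 - γ) T)) *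
      (1 - γ) ≤ Mg * R * (c * (3 * l)) / (1 - γ) ^ 2 := by
    have hc0 : 0 ≤ c := Real.sqrt_nonneg _
    unfold constG
    calc _ ≤ Mg * R / (1 - γ) ^ 2 * (c * H) * (1 - γ) := by gcongr
      _ = Mg * R / (1 - γ) ^ 2 * (c * ((1 - γ) * H)) := by ring
      _ ≤ Mg * R / (1 - γ) ^ 2 * (c * (3 * l)) := by 
        gcongr Mg * R / (1 - γ) ^ 2 * (c * ?_)
        linarith
      _ = _ := by ring
  have hRl : R ≤ R * (2 * l) := le_mul_of_one_le_right hR hl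
  set x := (T : ℝ) ^ ((1 : ℝ) / 3) with hxdef
  have hDx : D / ((1 - γ) * x) ≤ 2 * R / (1 - γ) ^ 2 / x := by
    calc _ ≤ 2 * R / (1 - γ) / ((1 - γ) * x) := by gcongr
      _ = _ := by field_simp
  have hsum : D / ((1 - γ) * x) + (constV γ R Mg + (constLg γ R Mg Mh + constG γ R Mg *
        Real.sqrt (constCw (horizon γ T) Mg Mh (stepsize (1 - γ) T))) * (1 - γ)) / x ≤
      (2 * R + Mg * R + (2 * Mg ^ 2 + Mh) * R + Mg * R * (c * (3 * l))) / (1 - γ) ^ 2 / x := by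
    have e : (2 * R + Mg * R + (2 * Mg ^ 2 + Mh) * R + Mg * R * (c * (3 * l))) / (1 - γ) ^ 2 / x =
        2 * R / (1 - γ) ^ 2 / x + (Mg * R / (1 - γ) ^ 2 + ((2 * Mg ^ 2 + Mh) * R / (1 - γ) ^ 2 +
          Mg * R * (c * (3 * l)) / (1 - γ) ^ 2)) / x := by ring
    rw [e, add_mul]
    gcongr
  refine (mul_le_mul_of_nonneg_left hsum (by norm_num)).trans ?_
  rw [div_div, ← mul_div_assoc, rateConst, abs_of_nonneg hR, ← hc]
  refine div_le_div_of_nonneg_right ?_ (by positivity)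
  have h3 := mul_le_mul_of_nonneg_left hRl hMg
  have h4 := mul_le_mul_of_nonneg_left hRl (show 0 ≤ 2 * Mg ^ 2 + Mh by positivity)
  linarith

/-- The number of iterations and samples for accuracy `ε`, given a rate `C₁ log (T+1) / T^(1/3)`. -/
lemma exists_sample_size {C₁ : ℝ} (hC₁ : 0 < C₁) : ∃ C : ℝ, C₁ ≤ C ∧
    ∀ γ : ℝ, 0 < γ → γ < 1 → ∀ ε : ℝ, 0 < ε → ε < 1 → ∃ T : ℕ, 1 ≤ T ∧
      (T : ℝ) ≤ C * ((1 - γ) ^ 6 * ε ^ 3)⁻¹ * Real.log (2 / ((1 - γ) * ε)) ^ 3 ∧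
      (T : ℝ) * horizon γ T ≤ C * ((1 - γ) ^ 7 * ε ^ 3)⁻¹ * Real.log (2 / ((1 - γ) * ε)) ^ 4 ∧
      C₁ * Real.log (T + 1) / ((1 - γ) ^ 2 * (T : ℝ) ^ ((1 : ℝ) / 3)) ≤ ε := by
  obtain ⟨A, B, hA, hB, hBA, hlogA⟩ : ∃ A B : ℝ, 1 ≤ A ∧ 0 ≤ B ∧ C₁ * B ≤ A ∧
      13 + 6 * Real.log A = B := by
    -- T will be about (A x l)³ with log(T+1) ≤ B l, so the rate is at most ε once C₁ B ≤ A. As B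
    -- grows only logarithmically in A, a quadratic A in C₁ is enough.
    have hs : 1 ≤ 25 * C₁ + 1 := by linarith
    refine ⟨(25 * C₁ + 1) ^ 2, _, one_le_pow₀ hs, ?_, ?_, rfl⟩
    · have := Real.log_nonneg (one_le_pow₀ (n := 2) hs)
      linarith
    · have h1 : Real.log ((25 * C₁ + 1) ^ 2) ≤ 2 * (25 * C₁ + 1) := by
        rw [Real.log_pow]
        have := Real.log_le_sub_one_of_pos (x := 25 * C₁ + 1) (by linarith)
        push_cast
        linarith
      nlinarith
  refine ⟨C₁ + (A ^ 3 + 8) * (B + 2), by nlinarith [pow_pos (by linarith : 0 < A) 3], ?_⟩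
  intro γ h0 h1 ε hε hε1
  have hγ : 0 < 1 - γ := by linarith
  set g := 1 - γ with hg
  have hgε : 0 < g * ε := by positivity
  have hgε1 : g * ε ≤ 1 := mul_le_one₀ (by linarith) hε.le hε1.le
  set l := Real.log (2 / (g * ε)) with hl
  have hl1 : 1 ≤ 2 * l := one_le_two_mul_log (by rw [le_div_iff₀ hgε]; linarith)
  have hel : Real.exp l = 2 / (g * ε) := Real.exp_log (by positivity)
  set x := (g ^ 2 * ε)⁻¹ with hx
  have hx1 : 1 ≤ x := by
    rw [hx, one_le_inv₀ (by positivity)]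
    calc g ^ 2 * ε = g * (g * ε) := by ring
      _ ≤ 1 := mul_le_one₀ (by linarith) hgε.le hgε1
  have hxe : x ≤ Real.exp l ^ 2 := by
    rw [hel, hx, div_pow, inv_eq_one_div]
    gcongr
    · norm_num
    · rw [mul_pow]
      gcongr
      nlinarith
  have hle : l ≤ Real.exp l := by have := Real.add_one_le_exp l; linarith
  have hA0 : 0 < A := by linarith
  have hl0 : 0 < l := by linarith
  have hx0 : 0 < x := by linarith
  set y := A * x * l with hy
  have hy0 : 0 < y := by positivity
  have hye : y ≤ A * Real.exp l ^ 3 := by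
    calc y ≤ A * Real.exp l ^ 2 * Real.exp l := by rw [hy]; gcongr
      _ = _ := by ring
  have hexp1 : 1 ≤ Real.exp l := Real.one_le_exp hl0.le
  -- The target is T^(1/3) ≥ A x l with x = 1/((1-γ)² ε), the extra l compensating log(T+1).
  set T := ⌈y ^ 3⌉₊ with hT
  have hT1 : 1 ≤ T := Nat.one_le_ceil_iff.2 (by positivity)
  have hTy : y ^ 3 ≤ T := Nat.le_ceil _
  have hTy' : (T : ℝ) ≤ y ^ 3 + 1 := (Nat.ceil_lt_add_one (by positivity)).le
  have hlog : Real.log (T + 1) ≤ B * l := by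
    have h2 : (T : ℝ) + 1 ≤ 3 * (A ^ 3 * Real.exp l ^ 9) := by
      have h3 : y ^ 3 ≤ A ^ 3 * Real.exp l ^ 9 := by
        calc y ^ 3 ≤ (A * Real.exp l ^ 3) ^ 3 := by gcongr
          _ = _ := by ring
      have h4 : 1 ≤ A ^ 3 * Real.exp l ^ 9 :=
        one_le_mul_of_one_le_of_one_le (one_le_pow₀ hA) (one_le_pow₀ hexp1)
      linarith
    -- Logarithms give log 3 + 3 log A + 9 l. As 1 ≤ 2l, the first is at most 4 l and the second at
    -- most 6 l log A, whence B = 13 + 6 log A.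
    have h5 := Real.log_le_log (by positivity) h2
    rw [Real.log_mul (by norm_num) (by positivity), Real.log_mul (by positivity) (by positivity),
      Real.log_pow, Real.log_pow, Real.log_exp] at h5
    have h6 : Real.log 3 ≤ 2 := by
      have := Real.log_le_sub_one_of_pos (x := 3) (by norm_num)
      linarith
    have h7 := mul_le_mul_of_nonneg_right hl1 (Real.log_nonneg hA)
    push_cast at h5
    rw [← hlogA]
    linarith
  have hTx : (T : ℝ) ≤ (A ^ 3 + 8) * (x ^ 3 * l ^ 3) := by
    -- The 1 lost by rounding up is absorbed using x ≥ 1 and 2l ≥ 1; this is the 8 in the constant.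
    have h2 : 1 ≤ (2 * (x * l)) ^ 3 := one_le_pow₀ (by nlinarith)
    calc (T : ℝ) ≤ y ^ 3 + (2 * (x * l)) ^ 3 := by linarith
      _ = _ := by rw [hy]; ring
  have hx3 : x ^ 3 = (g ^ 6 * ε ^ 3)⁻¹ := by rw [hx, inv_pow]; congr 1; ring
  have hAC : A ^ 3 + 8 ≤ C₁ + (A ^ 3 + 8) * (B + 2) := by
    nlinarith [pow_pos hA0 3]
  refine ⟨T, hT1, ?_, ?_, ?_⟩
  · rw [← hx3, mul_assoc]
    exact hTx.trans (by gcongr)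
  · have h2 : g * (horizon γ T : ℝ) ≤ (B + 2) * l := by
      have h3 : g * (horizon γ T : ℝ) ≤ Real.log (T + 1) + 1 := horizon_mul_le h0 h1 T
      linarith
    calc (T : ℝ) * horizon γ T = T * (g * horizon γ T) / g := by field_simp
      _ ≤ (A ^ 3 + 8) * (x ^ 3 * l ^ 3) * ((B + 2) * l) / g := by gcongr
      _ = ((A ^ 3 + 8) * (B + 2)) * (g ^ 7 * ε ^ 3)⁻¹ * l ^ 4 := by rw [hx3]; field_simp
      _ ≤ _ := by gcongr; linarith
  · have h2 : y ≤ (T : ℝ) ^ ((1 : ℝ) / 3) := by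
      refine le_of_pow_le_pow_left₀ (n := 3) (by norm_num) (by positivity) ?_
      rw [rpow_third_cube (Nat.cast_nonneg T)]
      exact hTy
    calc C₁ * Real.log (T + 1) / (g ^ 2 * (T : ℝ) ^ ((1 : ℝ) / 3))
        ≤ C₁ * (B * l) / (g ^ 2 * y) := by gcongr
      _ = C₁ * B * ε / A := by rw [hy, hx]; field_simp
      _ ≤ A * ε / A := by gcongr
      _ = ε := by field_simp

/-! ### Weights and explicit rate along a standard run -/

namespace Problem

variable {p q d : ℕ} {M : Problem p q d} {lμ Mg Mh R γ α₀ : ℝ}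
  {Ω : Type*} [MeasurableSpace Ω] {P : Measure Ω} [IsProbabilityMeasure P] {T : ℕ} {θ₀ : E d}
  {τ : ℕ → Ω → Traj p q (horizon γ T)}

lemma IsStandardRun.isWeight_moments (hM : M.Regular lμ Mg Mh) (hMh : 0 ≤ Mh) (hα₀ : 0 ≤ α₀)
    (hτ : M.IsStandardRun γ α₀ T θ₀ P τ) {t : ℕ} (ht : t + 1 < T) :
    MemLp (fun ω => M.isWeight (τ (t + 1) ω) (M.θ γ α₀ T θ₀ τ t ω)
        (M.θ γ α₀ T θ₀ τ (t + 1) ω)) 2 P ∧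
      ∫ ω, M.isWeight (τ (t + 1) ω) (M.θ γ α₀ T θ₀ τ t ω) (M.θ γ α₀ T θ₀ τ (t + 1) ω) ∂P = 1 ∧
      variance (fun ω => M.isWeight (τ (t + 1) ω) (M.θ γ α₀ T θ₀ τ t ω)
        (M.θ γ α₀ T θ₀ τ (t + 1) ω)) P ≤
          constCw (horizon γ T) Mg Mh (stepsize α₀ T) * stepsize α₀ T ^ 2 :=
  IsRun.stateWeight_moments hM hMh hτ ht (by unfold stepsize; positivity) rfl

lemma IsStandardRun.outputGradNorm_le_log (hM : M.Regular lμ Mg Mh) (hMg : 0 ≤ Mg)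
    (hMh : 0 ≤ Mh) (hR : M.RewardBound R) (h0 : 0 < γ) (h1 : γ < 1) (hT : 1 ≤ T)
    (hτ : M.IsStandardRun γ (1 - γ) T θ₀ P τ) :
    M.outputGradNorm γ (1 - γ) T θ₀ P τ ≤
      rateConst Mg Mh R * Real.log (T + 1) / ((1 - γ) ^ 2 * (T : ℝ) ^ ((1 : ℝ) / 3)) := by
  refine (hτ.outputGradNorm_le hM hMg hMh hR h0 h1 (sub_pos.2 h1) hT).trans
    (rate_le_log h0 h1 hMg hMh (rewardBound_nonneg hR) hT ?_)
  -- All returns lie within R/(1-γ) of 0, so the initial gap is at most 2R/(1-γ) whatever `θ₀` is.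
  have hJ : M.Jstar γ ≤ R / (1 - γ) := ciSup_le fun θ =>
    (le_abs_self _).trans (abs_J_le hR h0.le h1 θ)
  have hE : -(R / (1 - γ)) ≤ ∫ ω, M.J γ (M.θ γ (1 - γ) T θ₀ τ 1 ω) ∂P := by
    have h := integral_mono (μ := P) (integrable_const (-(R / (1 - γ))))
      (integrable_J hM hMg hR h0.le h1 (hτ.measurable_θ hM hT))
      fun ω => (abs_le.1 (abs_J_le hR h0.le h1 _)).1
    simpa using h
  calc _ ≤ R / (1 - γ) - -(R / (1 - γ)) := sub_le_sub hJ hE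
    _ = _ := by ring

end Problem

end GaussianPG

theorem mainTheorem8 :
    -- importance sampling weights after a normalized update
    (∀ {p q d : ℕ} (M : GaussianPG.Problem p q d) (lμ Mg Mh : ℝ), 0 < Mg → 0 < Mh →
      M.Regular lμ Mg Mh → ∀ (H : ℕ), 1 ≤ H → ∀ (α : ℝ), 0 < α →
      ∀ (θ dir θ' : GaussianPG.E d), dir ≠ 0 → θ' = θ + (α / ‖dir‖) • dir →
        MeasureTheory.MemLp (fun τ => M.isWeight τ θ θ') 2 (M.trajLaw H θ') ∧
        ∫ τ, M.isWeight τ θ θ' ∂(M.trajLaw H θ') = 1 ∧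
        ProbabilityTheory.variance (fun τ => M.isWeight τ θ θ') (M.trajLaw H θ') ≤
          GaussianPG.constCw H Mg Mh α * α ^ 2) ∧
    -- general rate, with an absolute constant; weights along the algorithm
    (∃ C : ℝ, 0 < C ∧
      ∀ {p q d : ℕ} (M : GaussianPG.Problem p q d) (lμ Mg Mh R γ α₀ : ℝ), 0 < Mg → 0 < Mh →
      M.Regular lμ Mg Mh → M.RewardBound R → 0 < γ → γ < 1 → 0 < α₀ →
      ∀ (T : ℕ), 1 ≤ T → ∀ (θ₀ : GaussianPG.E d)
        {Ω : Type*} [MeasurableSpace Ω] (P : MeasureTheory.Measure Ω)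
        [MeasureTheory.IsProbabilityMeasure P]
        (τ : ℕ → Ω → GaussianPG.Traj p q (GaussianPG.horizon γ T)),
      M.IsStandardRun γ α₀ T θ₀ P τ →
        (∀ t, 1 ≤ t → t < T →
          MeasureTheory.MemLp (fun ω => M.isWeight (τ t ω) (M.θ γ α₀ T θ₀ τ (t - 1) ω)
            (M.θ γ α₀ T θ₀ τ t ω)) 2 P ∧
          ∫ ω, M.isWeight (τ t ω) (M.θ γ α₀ T θ₀ τ (t - 1) ω) (M.θ γ α₀ T θ₀ τ t ω) ∂P = 1 ∧
          ProbabilityTheory.variance (fun ω => M.isWeight (τ t ω) (M.θ γ α₀ T θ₀ τ (t - 1) ω)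
            (M.θ γ α₀ T θ₀ τ t ω)) P ≤
              GaussianPG.constCw (GaussianPG.horizon γ T) Mg Mh (GaussianPG.stepsize α₀ T) *
                GaussianPG.stepsize α₀ T ^ 2) ∧
        Differentiable ℝ (M.J γ) ∧
        BddAbove (Set.range (M.J γ)) ∧
        MeasureTheory.Integrable (fun ω => M.J γ (M.θ γ α₀ T θ₀ τ 1 ω)) P ∧
        MeasureTheory.Integrable
          (fun x : Ω × ℕ => ‖gradient (M.J γ) (M.θ γ α₀ T θ₀ τ x.2 x.1)‖)
          (GaussianPG.outputLaw P T) ∧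
        M.outputGradNorm γ α₀ T θ₀ P τ ≤
          C * ((M.Jstar γ - ∫ ω, M.J γ (M.θ γ α₀ T θ₀ τ 1 ω) ∂P) /
                (α₀ * (T : ℝ) ^ ((1 : ℝ) / 3)) +
              (GaussianPG.constV γ R Mg +
                (GaussianPG.constLg γ R Mg Mh + GaussianPG.constG γ R Mg *
                  Real.sqrt (GaussianPG.constCw (GaussianPG.horizon γ T) Mg Mh
                    (GaussianPG.stepsize α₀ T))) * α₀) /
                (T : ℝ) ^ ((1 : ℝ) / 3))) ∧
    -- rate for `α₀ = 1 - γ`, and the number of samples needed for accuracy `ε`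
    (∀ (Mg Mh R : ℝ), 0 < Mg → 0 < Mh → ∃ C : ℝ, 0 < C ∧ ∀ (γ : ℝ), 0 < γ → γ < 1 →
      (∀ {p q d : ℕ} (M : GaussianPG.Problem p q d) (lμ : ℝ),
        M.Regular lμ Mg Mh → M.RewardBound R →
        ∀ (T : ℕ), 1 ≤ T → ∀ (θ₀ : GaussianPG.E d)
          {Ω : Type*} [MeasurableSpace Ω] (P : MeasureTheory.Measure Ω)
          [MeasureTheory.IsProbabilityMeasure P]
          (τ : ℕ → Ω → GaussianPG.Traj p q (GaussianPG.horizon γ T)),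
        M.IsStandardRun γ (1 - γ) T θ₀ P τ →
          M.outputGradNorm γ (1 - γ) T θ₀ P τ ≤
            C * Real.log (T + 1) / ((1 - γ) ^ 2 * (T : ℝ) ^ ((1 : ℝ) / 3))) ∧
      (∀ ε : ℝ, 0 < ε → ε < 1 → ∃ T : ℕ, 1 ≤ T ∧
        (T : ℝ) ≤ C * ((1 - γ) ^ 6 * ε ^ 3)⁻¹ * Real.log (2 / ((1 - γ) * ε)) ^ 3 ∧
        (T : ℝ) * GaussianPG.horizon γ T ≤
          C * ((1 - γ) ^ 7 * ε ^ 3)⁻¹ * Real.log (2 / ((1 - γ) * ε)) ^ 4 ∧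
        ∀ {p q d : ℕ} (M : GaussianPG.Problem p q d) (lμ : ℝ),
          M.Regular lμ Mg Mh → M.RewardBound R →
          ∀ (θ₀ : GaussianPG.E d)
            {Ω : Type*} [MeasurableSpace Ω] (P : MeasureTheory.Measure Ω)
            [MeasureTheory.IsProbabilityMeasure P]
            (τ : ℕ → Ω → GaussianPG.Traj p q (GaussianPG.horizon γ T)),
          M.IsStandardRun γ (1 - γ) T θ₀ P τ →
            M.outputGradNorm γ (1 - γ) T θ₀ P τ ≤ ε)) := by
  refine ⟨?_, ⟨34, by norm_num, ?_⟩, ?_⟩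
  · rintro p q d M lμ Mg Mh - hMh hM H - α hα θ dir θ' hdir rfl
    refine GaussianPG.Problem.isWeight_moments hM hMh.le H ?_
    rw [sub_add_cancel_left, norm_neg, norm_smul, Real.norm_of_nonneg (by positivity),
      div_mul_cancel₀ _ (norm_ne_zero_iff.2 hdir)]
  · intro p q d M lμ Mg Mh R γ α₀ hMg hMh hM hR h0 h1 hα₀ T hT θ₀ Ω _ P _ τ hτ
    refine ⟨?_, GaussianPG.Problem.differentiable_J hM hMg.le hR h0.le h1,
      GaussianPG.Problem.bddAbove_range_J hR h0.le h1,
      GaussianPG.Problem.integrable_J hM hMg.le hR h0.le h1 (hτ.measurable_θ hM hT),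
      GaussianPG.integrable_outputLaw P hT fun t ht =>
        hτ.integrable_norm_gradient hM hMg.le hMh.le hR h0.le h1 ht,
      hτ.outputGradNorm_le hM hMg.le hMh.le hR h0 h1 hα₀ hT⟩
    rintro (_ | t) ht htT
    · omega
    · exact hτ.isWeight_moments hM hMh.le hα₀.le htT
  · intro Mg Mh R hMg hMh
    have hpos := GaussianPG.rateConst_pos hMg.le hMh.le R
    -- One constant serves the rate and the sample sizes: it dominates `rateConst`, and T is
    -- produced before any problem is fixed.
    obtain ⟨C, hC, hsize⟩ := GaussianPG.exists_sample_size hpos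
    refine ⟨C, hpos.trans_le hC, fun γ h0 h1 => ⟨?_, fun ε hε hε1 => ?_⟩⟩
    · intro p q d M lμ hM hR T hT θ₀ Ω _ P _ τ hτ
      refine (hτ.outputGradNorm_le_log hM hMg.le hMh.le hR h0 h1 hT).trans ?_
      have hγ : 0 < 1 - γ := by linarith
      have hlog : 0 ≤ Real.log ((T : ℝ) + 1) :=
        Real.log_nonneg (le_add_of_nonneg_left (Nat.cast_nonneg T))
      gcongr
    · obtain ⟨T, hT, hT1, hT2, hT3⟩ := hsize γ h0 h1 ε hε hε1
      refine ⟨T, hT, hT1, hT2, ?_⟩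
      intro p q d M lμ hM hR θ₀ Ω _ P _ τ hτ
      exact (hτ.outputGradNorm_le_log hM hMg.le hMh.le hR h0 h1 hT).trans hT3
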